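/- **Meanders.** A meander of order $n$ consists of a disk $D$ and two smoothly and properly embedded arcs $m$ (from $p_1$ to $p_3$) and $l$ (from $p_2$ to $p_4$) that meet transversally in $n$ points, where $p_3,p_4$ lie in one component of $\partial D\setminus\{p_1,p_2\}$. Meanders are considered up to homeomorphism, i.e. they are given by their permutations: label the intersection points $0,\dots,n-1$ along $l$ and let $\sigma(i)$ be the label of the $i$-th point along $m$. The permutations that occur are those for which, with $s_0=-1$, $s_{i+1}=\sigma(i)$ for $0\le i<n$, $s_{n+1}=n$, no two arcs $\{s_i,s_{i+1}\}$, $\{s_j,s_{j+1}\}$ with $0\le i,j\le n$ and $i\equiv j \pmod 2$ cross (two arcs cross if their endpoints interlace). **Disks.** A disk $D'\subset D$ is in correct position if $\partial D'$ meets each of $m$ and $l$ in exactly two points, none of them an intersection point of $m$ and $l$, and $D'\cap m\cap l\ne\emptyset$. Two such disks are equivalent if they contain the same intersection points; so the classes of disks are the nonempty sets of intersection points that are consecutive both along $l$ and along $m$. The width $w(D')$ is the number of intersection points in $D'$, and $M|_{D'}$ is the meander that $M$ induces in $D'$. The decomposition graph of $M$ has the classes of disks as vertices, with an edge between two classes if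 one covers the other with respect to inclusion. An articulation point of a graph is a vertex whose removal increases the number of connected components. A disk $D'$ simplifies a meander $M$ of order $n$ if $2<w(D')<n$ and $[D']$ is an articulation point of the decomposition graph. $M$ is prime if no disk simplifies it, irreducible if there is no disk in correct position with $2<w(D')<n$, and a snake if no class of width greater than $2$ (the class of the whole disk included) is an articulation point of its decomposition graph. **Construction tree.** Let $S(M)$ be the set of classes $[D']$ such that $D'$ simplifies $M$ and $M|_{D'}$ is prime. As long as the meander is not prime, cut all disks of $S(M)$ simultaneously: replace each of them by a disk with one intersection point if its width is odd, and with two if its width is even. The vertices of the construction tree of $M$ are the disks cut in this process, each carrying the prime meander $M'|_{D'}$, where $M'$ is the meander from which $D'$ is cut, together with a root carrying the prime meander that remains at the end. The children of a vertex are the disks cut earlier whose replacing points are among the intersection points of the prime meander carried by this vertex. A vertex is black if its prime meander is irreducible and not a snake, and white otherwise. An *iterated snake* is a meander whose construction tree has no black vertices. Let $\mathcal M^{(I)}_n$ be the number of (equivalence classes of) iterated snakes of order $n$. **Statement.** For every integer $n\ge 2$, with $\delta = n \bmod 2$, $$\mathcal M^{(I)}_n=(1+\delta)\sum_{r=1}^{\lfloor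 n/2\rfloor}\ \sum_{\mu\vdash \frac{n-2r-\delta}{2}}\binom{2r+\delta}{\mu}\prod_{i}\left(\frac{\mathcal M^{(I)}_{2i+1}}{2}\right)^{s_i},$$ where $\mu=(1^{s_1};2^{s_2};\dots)$ runs through the partitions of $\frac{n-2r-\delta}2$, $|\mu|=\sum_i s_i$, and $\binom{N}{\mu}=\frac{N!}{s_1!\,s_2!\cdots\,(N-|\mu|)!}$, which is $0$ if $|\mu|>N$. -/

import Mathlib

/-- `v` is an articulation point of `G`: removing `v` increases the number of connected
components. -/
def IsArticulationPoint {V : Type*} (G : SimpleGraph V) (v : V) : Prop :=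
  Nat.card G.ConnectedComponent < Nat.card (G.induce {v}ᶜ).ConnectedComponent

/-- The arcs with endpoints `a, b` and `c, d`, drawn on the same side of the line `l`, are linked
in the order `a b`, `c d`, `a b`, `c d`. -/
def ArcsLinked (a b c d : ℤ) : Prop :=
  min a b < min c d ∧ min c d < max a b ∧ max a b < max c d

/-- The points that the curve `m` visits on the line `l`, for a curve that meets `l` in the points
`0, …, n - 1` in the order given by `σ`. The endpoint `p₁` of `m` lies next to the left end of `l`
and the endpoint `p₃` next to the right end, and they are recorded as the positions `-1` and `n`. -/
def visit {n : ℕ} (σ : Equiv.Perm (Fin n)) (i : ℕ) : ℤ :=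
  if i = 0 then -1 else if h : i - 1 < n then ((σ ⟨i - 1, h⟩ : ℕ) : ℤ) else n

/-- A meander of order `n` up to equivalence, encoded by its permutation: the intersection points
of `m` and `l` are labelled `0, …, n - 1` along `l` (from `p₂` to `p₄`), and `perm i` is the label
of the `i`-th intersection point along `m` (from `p₁` to `p₃`). The curve `m` consists of the
`n + 1` arcs from `visit perm i` to `visit perm (i + 1)`, `0 ≤ i ≤ n`; by transversality they lie
alternately above `l` (even `i`) and below `l` (odd `i`). A permutation is the permutation of a
meander exactly if arcs on the same side of `l` do not cross. -/
structure Meander (n : ℕ) where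
  perm : Equiv.Perm (Fin n)
  noncrossing : ∀ i j : ℕ, i ≤ n → j ≤ n → i % 2 = j % 2 →
    ¬ ArcsLinked (visit perm i) (visit perm (i + 1)) (visit perm j) (visit perm (j + 1))

/-- Construction trees: every vertex has a colour (black or white) and an order, and a finite
family of subtrees. -/
inductive ConstructionTree : Type
  | node (black : Bool) (ord : ℕ) (children : List ConstructionTree) : ConstructionTree

/-- No vertex of the tree is black. -/
inductive ConstructionTree.NoBlackVertex : ConstructionTree → Prop
  | node (ord : ℕ) (children : List ConstructionTree)
      (h : ∀ T ∈ children, ConstructionTree.NoBlackVertex T) :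
      ConstructionTree.NoBlackVertex (ConstructionTree.node false ord children)

namespace Meander

variable {n : ℕ}

/-- The position along `m` of the intersection point with label `c`. -/
def time (M : Meander n) (c : Fin n) : Fin n := M.perm.symm c

/-!
All meanders obtained from `M` by restriction to disks and by cuts have as intersection points a
subset `A` of those of `M`, with the orders along `m` and along `l` that are induced by `M`
(for the meander inside a disk of even width `l` may have to be traversed backwards, which changes
neither its disks nor its decomposition graph). They are represented by the pair `(M, A)`; the
meander `M` itself is `(M, univ)`, and the meander `M|_D` is `(M, S)` where `S` is the set of
intersection points in `D`.
-/

/-- Equivalence classes of disks in correct position with respect to `(M, A)`, each given by the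
set `S` of intersection points it contains. The boundary of such a disk meets each of `m` and `l`
in exactly two points, so that the disk cuts out one segment of `m` and one segment of `l`;
hence `S` is a nonempty set of intersection points that are consecutive along `l` and consecutive
along `m`. Conversely, for every such `S` a thin neighbourhood of the two segments
spanned by `S`, with its holes filled, is a disk in correct position. -/
def IsDisk (M : Meander n) (A S : Finset (Fin n)) : Prop :=
  S.Nonempty ∧ S ⊆ A ∧
  (∀ a ∈ S, ∀ b ∈ S, ∀ c ∈ A, a < c → c < b → c ∈ S) ∧
  (∀ a ∈ S, ∀ b ∈ S, ∀ c ∈ A, M.time a < M.time c → M.time c < M.time b → c ∈ S)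

/-- The classes of disks in correct position with respect to `(M, A)`, ordered by inclusion. -/
abbrev DiskClass (M : Meander n) (A : Finset (Fin n)) : Type :=
  {S : Finset (Fin n) // M.IsDisk A S}

/-- The decomposition graph of `(M, A)` (edges join classes such that one covers the other). -/
def decompositionGraph (M : Meander n) (A : Finset (Fin n)) : SimpleGraph (M.DiskClass A) :=
  SimpleGraph.hasse (M.DiskClass A)

/-- The disk class `S` simplifies `(M, A)`. -/
def Simplifies (M : Meander n) (A S : Finset (Fin n)) : Prop :=
  2 < S.card ∧ S.card < A.card ∧
  ∃ h : M.IsDisk A S, IsArticulationPoint (M.decompositionGraph A) ⟨S, h⟩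

/-- `(M, A)` is prime. -/
def IsPrime (M : Meander n) (A : Finset (Fin n)) : Prop :=
  ∀ S : Finset (Fin n), ¬ M.Simplifies A S

/-- `(M, A)` is irreducible. -/
def IsIrreducible (M : Meander n) (A : Finset (Fin n)) : Prop :=
  ∀ S : Finset (Fin n), M.IsDisk A S → ¬ (2 < S.card ∧ S.card < A.card)

/-- `(M, A)` is a snake: no class of non-elementary disks (disks of width at least 3, the whole
disk included) is an articulation point of the decomposition graph. -/
def IsSnake (M : Meander n) (A : Finset (Fin n)) : Prop :=
  ∀ S : M.DiskClass A, 2 < S.1.card → ¬ IsArticulationPoint (M.decompositionGraph A) S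

/-- Colour of a vertex of the construction tree that carries the prime meander `(M, A)`: black for
the irreducible meanders, white for the snakes (among them all meanders of order at most 3). -/
def IsBlack (M : Meander n) (A : Finset (Fin n)) : Prop :=
  M.IsIrreducible A ∧ ¬ M.IsSnake A

open scoped Classical in
/-- The set of all disk classes `S` that simplify `(M, A)` and for which `(M, S)` is prime. -/
noncomputable def primeDisks (M : Meander n) (A : Finset (Fin n)) : Finset (Finset (Fin n)) :=
  A.powerset.filter fun S => M.Simplifies A S ∧ M.IsPrime S

/-- `c` is the first point of `S` along `m`. -/
def IsFirst (M : Meander n) (S : Finset (Fin n)) (c : Fin n) : Prop :=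
  c ∈ S ∧ ∀ d ∈ S, M.time c ≤ M.time d

/-- `c` is the last point of `S` along `m`. -/
def IsLast (M : Meander n) (S : Finset (Fin n)) (c : Fin n) : Prop :=
  c ∈ S ∧ ∀ d ∈ S, M.time d ≤ M.time c

open scoped Classical in
/-- The result of cutting all disks of `primeDisks` from `(M, A)`: a disk of odd width is replaced
by a disk with one intersection point, a disk of even width by a disk with two. The new points
are represented by the first point of the disk along `m`, respectively by the first and the
last one. -/
noncomputable def cut (M : Meander n) (A : Finset (Fin n)) : Finset (Fin n) :=
  A.filter fun c => ∀ S ∈ M.primeDisks A, c ∈ S →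
    M.IsFirst S c ∨ (Even S.card ∧ M.IsLast S c)

open scoped Classical in
/-- The tree whose root carries the prime meander `(M, A)`, and whose subtrees are all trees in
`F c`, `c ∈ A`, where `F c` are the trees of the meanders inserted at the point `c`
(for an insertion at a disk of width 2, at its first point along `m`). -/
noncomputable def treeOver (M : Meander n) (A : Finset (Fin n))
    (F : Fin n → List ConstructionTree) : ConstructionTree :=
  ConstructionTree.node (decide (M.IsBlack A)) A.card ((A.sort (· ≤ ·)).flatMap F)

open scoped Classical in
/-- One step of the decomposition: cut all disks of `primeDisks` simultaneously, and
record at the first point of every disk that is cut the tree of the part cut out.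
Nothing changes if `(M, A)` is prime. -/
noncomputable def decompositionStep (M : Meander n)
    (s : Finset (Fin n) × (Fin n → List ConstructionTree)) :
    Finset (Fin n) × (Fin n → List ConstructionTree) :=
  (M.cut s.1, fun c =>
    if ∃ S ∈ M.primeDisks s.1, c ∈ S then
      ((M.primeDisks s.1).filter fun S => M.IsFirst S c).toList.map fun S => M.treeOver S s.2
    else s.2 c)

/-- The construction tree of `M`: the decomposition step is repeated until the remaining meander is
prime (every step before that removes points, so that `n` steps are enough), and this last prime
meander is carried by the root. -/
noncomputable def constructionTree (M : Meander n) : ConstructionTree :=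
  let s := (M.decompositionStep)^[n] (Finset.univ, fun _ => [])
  M.treeOver s.1 s.2

/-- An iterated snake is a meander whose construction tree has no black vertices. -/
def IsIteratedSnake (M : Meander n) : Prop :=
  M.constructionTree.NoBlackVertex

end Meander

/-- The number of (equivalence classes of) iterated snakes of order `n`. -/
noncomputable def numIteratedSnakes (n : ℕ) : ℕ :=
  Nat.card {M : Meander n // M.IsIteratedSnake}

/-- For a partition `μ = (1^{s₁}; 2^{s₂}; …)` with `|μ| = s₁ + s₂ + ⋯` parts, the number
`N! / (s₁! s₂! ⋯ (N - |μ|)!)`, which is `0` if `|μ| > N`. -/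
def partitionBinom (N : ℕ) {k : ℕ} (μ : Nat.Partition k) : ℚ :=
  if μ.parts.card ≤ N then
    (N.factorial : ℚ) /
      ((∏ i ∈ μ.parts.toFinset, ((μ.parts.count i).factorial : ℚ)) *
        ((N - μ.parts.card).factorial : ℚ))
  else 0

/-!
Iterated snakes turn out to be the meanders whose permutation is separable, and these can be
counted block by block.

Call a disk *strong* if no other disk overlaps it. A proper strong disk with at least two points is
an articulation point of the decomposition graph, because everything inside it is linked to the
outside only through it (`IsStrong.articulates`). The converse fails only for disks that consist of
two pieces of width at most two (`exists_split_of_articulates`), and such a disk is black if it is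
cut. So in an iterated snake the disks that are cut are strong and disjoint, and each step of the
construction contracts disjoint blocks to points. A prime meander that is not black is separable,
that is, each of its subsets with at least two points splits into a direct or skew sum of two parts
(`isSeparable_of_isPrime`): the smallest disk around a minimal indecomposable subset is strong.
Since contraction of separable blocks reflects separability, iterated snakes are separable.

Next, the arcs of a separable meander leave no room for blocks of even size: if a meander is the sum
of two parts in some direction, a part of even size is a sum in the same direction, and a part of
odd size can be regarded as a sum in either direction (`exists_isBlockSum`). Hence the permutation
is an iterated direct and skew sum of blocks of odd size (`IsBlockSum`), where a skew sum can occur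
at the top only if the order is odd. Conversely, iterated sums of odd blocks have no crossing arcs
(`IsBlockSum.isArcSystem`), they are separable, and all their proper strong disks are odd. These
last two properties survive restriction to disks and the cuts, and exclude black vertices
(`not_isBlack_of_hasOddStrongDisks`), so these meanders are iterated snakes.

It remains to count sums of blocks. A sum determines its first block, so the number of direct sums
of `N` blocks with `n` points in total is the coefficient of `X ^ n` in the `N`-th power of the
generating function of blocks. A block is a point or a skew sum of odd order, and by complementation
half of the iterated snakes of odd order are skew sums. Expanding the power by the multinomial
theorem yields the sum over partitions.
-/

/-! ### Articulation points of Hasse diagrams -/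

theorem SimpleGraph.reachable_hasse_of_le {P : Type*} [PartialOrder P] [Finite P] {a b : P}
    (hab : a ≤ b) : (SimpleGraph.hasse P).Reachable a b := by
  classical
  have := Fintype.ofFinite P
  let _ : LocallyFiniteOrder P := Fintype.toLocallyFiniteOrder
  induction le_iff_reflTransGen_covBy.1 hab with
  | refl => exact SimpleGraph.Reachable.refl _
  | tail h1 h2 ih =>
    exact (ih (le_iff_reflTransGen_covBy.2 h1)).trans
      (SimpleGraph.Adj.reachable (SimpleGraph.hasse_adj.2 (Or.inl h2)))

/-- A maximal chain from `a` to `b` avoids `v` unless `a ≤ v ≤ b`. -/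
theorem SimpleGraph.reachable_induce_hasse_of_le {P : Type*} [PartialOrder P] [Finite P]
    {v a b : P} (ha : a ≠ v) (hb : b ≠ v) (hab : a ≤ b) (h : ¬ (a ≤ v ∧ v ≤ b)) :
    ((SimpleGraph.hasse P).induce {v}ᶜ).Reachable ⟨a, ha⟩ ⟨b, hb⟩ := by
  classical
  have := Fintype.ofFinite P
  let _ : LocallyFiniteOrder P := Fintype.toLocallyFiniteOrder
  induction le_iff_reflTransGen_covBy.1 hab with
  | refl => exact SimpleGraph.Reachable.refl _
  | @tail c d h1 h2 ih =>
    have hac := le_iff_reflTransGen_covBy.2 h1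
    have hc : c ≠ v := by
      rintro rfl
      exact h ⟨hac, h2.le⟩
    refine (ih hc hac fun h' => h ⟨h'.1, h'.2.trans h2.le⟩).trans (SimpleGraph.Adj.reachable ?_)
    exact SimpleGraph.hasse_adj.2 (Or.inl h2)

theorem isArticulationPoint_hasse_iff {P : Type*} [PartialOrder P] [Finite P] {t : P}
    (ht : IsTop t) (v : P) :
    IsArticulationPoint (SimpleGraph.hasse P) v ↔
      ∃ (a b : P) (ha : a ≠ v) (hb : b ≠ v),
        ¬ ((SimpleGraph.hasse P).induce {v}ᶜ).Reachable ⟨a, ha⟩ ⟨b, hb⟩ := by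
  have h1 : Nat.card (SimpleGraph.hasse P).ConnectedComponent = 1 := by
    rw [Nat.card_eq_one_iff_unique]
    refine ⟨⟨fun x y => ?_⟩, ⟨SimpleGraph.connectedComponentMk _ t⟩⟩
    induction x, y using SimpleGraph.ConnectedComponent.ind₂ with
    | _ x y =>
      exact SimpleGraph.ConnectedComponent.sound
        ((SimpleGraph.reachable_hasse_of_le (ht x)).trans
          (SimpleGraph.reachable_hasse_of_le (ht y)).symm)
  unfold IsArticulationPoint
  have : Finite ((SimpleGraph.hasse P).induce {v}ᶜ).ConnectedComponent :=
    Quot.finite _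
  rw [h1, Finite.one_lt_card_iff_nontrivial]
  constructor
  · rintro ⟨x, y, hxy⟩
    induction x, y using SimpleGraph.ConnectedComponent.ind₂ with
    | _ x y =>
      exact ⟨x.1, y.1, x.2, y.2, fun h => hxy (SimpleGraph.ConnectedComponent.sound h)⟩
  · rintro ⟨a, b, ha, hb, hab⟩
    exact ⟨_, _, fun h => hab (SimpleGraph.ConnectedComponent.exact h)⟩

namespace Meander

variable {n : ℕ} {M : Meander n} {A S T U V W X Y B C D : Finset (Fin n)}

theorem time_injective (M : Meander n) : Function.Injective M.time :=
  M.perm.symm.injective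

/-! ### The algebra of disks -/

theorem IsDisk.nonempty (h : M.IsDisk A S) : S.Nonempty := h.1

theorem IsDisk.subset (h : M.IsDisk A S) : S ⊆ A := h.2.1

theorem isDisk_self (h : A.Nonempty) : M.IsDisk A A :=
  ⟨h, subset_rfl, fun _ _ _ _ _ hc _ _ => hc, fun _ _ _ _ _ hc _ _ => hc⟩

theorem isDisk_singleton {a : Fin n} (h : a ∈ A) : M.IsDisk A {a} := by
  refine ⟨Finset.singleton_nonempty a, by simpa using h, ?_, ?_⟩
  · intro x hx y hy c _ h1 h2
    rw [Finset.mem_singleton] at hx hy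
    subst hx hy
    exact absurd (h1.trans h2) (lt_irrefl _)
  · intro x hx y hy c _ h1 h2
    rw [Finset.mem_singleton] at hx hy
    subst hx hy
    exact absurd (h1.trans h2) (lt_irrefl _)

theorem IsDisk.trans (h : M.IsDisk S U) (hS : M.IsDisk A S) : M.IsDisk A U :=
  ⟨h.1, h.2.1.trans hS.2.1,
    fun a ha b hb c hc h1 h2 => h.2.2.1 a ha b hb c
      (hS.2.2.1 a (h.2.1 ha) b (h.2.1 hb) c hc h1 h2) h1 h2,
    fun a ha b hb c hc h1 h2 => h.2.2.2 a ha b hb c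
      (hS.2.2.2 a (h.2.1 ha) b (h.2.1 hb) c hc h1 h2) h1 h2⟩

theorem IsDisk.inter_of_subset (h : M.IsDisk A T) (hB : B ⊆ A) (hne : (T ∩ B).Nonempty) :
    M.IsDisk B (T ∩ B) := by
  refine ⟨hne, Finset.inter_subset_right, ?_, ?_⟩
  · intro a ha b hb c hc h1 h2
    rw [Finset.mem_inter] at *
    exact ⟨h.2.2.1 a ha.1 b hb.1 c (hB hc) h1 h2, hc⟩
  · intro a ha b hb c hc h1 h2
    rw [Finset.mem_inter] at *
    exact ⟨h.2.2.2 a ha.1 b hb.1 c (hB hc) h1 h2, hc⟩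

theorem IsDisk.of_subset (h : M.IsDisk A T) (hB : B ⊆ A) (hT : T ⊆ B) : M.IsDisk B T := by
  have h1 : T ∩ B = T := Finset.inter_eq_left.2 hT
  rw [← h1]
  exact h.inter_of_subset hB (by rw [h1]; exact h.1)

theorem IsDisk.inter (h : M.IsDisk A S) (h' : M.IsDisk A T) (hne : (S ∩ T).Nonempty) :
    M.IsDisk A (S ∩ T) :=
  (h.inter_of_subset h'.subset hne).trans h'

/-- `S` and `T` meet, and neither contains the other. -/
def Overlap (S T : Finset (Fin n)) : Prop :=
  (S ∩ T).Nonempty ∧ (S \ T).Nonempty ∧ (T \ S).Nonempty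

theorem Overlap.symm (h : Overlap S T) : Overlap T S :=
  ⟨by rw [Finset.inter_comm]; exact h.1, h.2.2, h.2.1⟩

theorem subset_or_subset_of_not_overlap (h : ¬ Overlap S T) (hne : (S ∩ T).Nonempty) :
    S ⊆ T ∨ T ⊆ S := by
  by_contra hc
  rw [not_or] at hc
  exact h ⟨hne, Finset.sdiff_nonempty.2 hc.1, Finset.sdiff_nonempty.2 hc.2⟩

/-- For an injective `f` into a linear order and two overlapping `f`-convex sets, the union and the
difference are `f`-convex. -/
theorem convex_union_sdiff {β : Type*} [LinearOrder β] {f : Fin n → β}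
    (hf : Function.Injective f)
    (hS : ∀ a ∈ S, ∀ b ∈ S, ∀ c ∈ A, f a < f c → f c < f b → c ∈ S)
    (hT : ∀ a ∈ T, ∀ b ∈ T, ∀ c ∈ A, f a < f c → f c < f b → c ∈ T)
    (hSA : S ⊆ A) (hTA : T ⊆ A) (h : Overlap S T) :
    (∀ a ∈ S ∪ T, ∀ b ∈ S ∪ T, ∀ c ∈ A, f a < f c → f c < f b → c ∈ S ∪ T) ∧
    (∀ a ∈ S \ T, ∀ b ∈ S \ T, ∀ c ∈ A, f a < f c → f c < f b → c ∈ S \ T) := by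
  obtain ⟨⟨x, hx⟩, -, ⟨z, hz⟩⟩ := h
  rw [Finset.mem_inter] at hx
  rw [Finset.mem_sdiff] at hz
  constructor
  · intro a ha b hb c hc h1 h2
    rw [Finset.mem_union] at *
    rcases lt_trichotomy (f c) (f x) with h3 | h3 | h3
    · rcases ha with ha | ha
      · exact Or.inl (hS a ha x hx.1 c hc h1 h3)
      · exact Or.inr (hT a ha x hx.2 c hc h1 h3)
    · exact Or.inl (hf h3 ▸ hx.1)
    · rcases hb with hb | hb
      · exact Or.inl (hS x hx.1 b hb c hc h3 h2)
      · exact Or.inr (hT x hx.2 b hb c hc h3 h2)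
  · intro a ha b hb c hc h1 h2
    rw [Finset.mem_sdiff] at *
    have hcS := hS a ha.1 b hb.1 c hc h1 h2
    refine ⟨hcS, fun hcT => ?_⟩
    -- `z ∈ T \ S` lies outside the `f`-interval from `a` to `b`, so `a` or `b` lies between
    -- `z` and `c`.
    have hzc : f z ≠ f c := fun h => hz.2 (hf h ▸ hcS)
    rcases lt_or_gt_of_ne hzc with h3 | h3
    · have hza : f z ≠ f a := fun h => hz.2 (hf h ▸ ha.1)
      rcases lt_or_gt_of_ne hza with h4 | h4
      · exact ha.2 (hT z hz.1 c hcT a (hSA ha.1) h4 h1)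
      · exact hz.2 (hS a ha.1 c hcS z (hTA hz.1) h4 h3)
    · have hzb : f z ≠ f b := fun h => hz.2 (hf h ▸ hb.1)
      rcases lt_or_gt_of_ne hzb with h4 | h4
      · exact hz.2 (hS c hcS b hb.1 z (hTA hz.1) h3 h4)
      · exact hb.2 (hT c hcT z hz.1 b (hSA hb.1) h2 h4)

theorem IsDisk.union (hS : M.IsDisk A S) (hT : M.IsDisk A T) (h : Overlap S T) :
    M.IsDisk A (S ∪ T) :=
  ⟨hS.1.mono Finset.subset_union_left, Finset.union_subset hS.subset hT.subset,
    (convex_union_sdiff (f := id) Function.injective_id hS.2.2.1 hT.2.2.1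
      hS.subset hT.subset h).1,
    (convex_union_sdiff M.time_injective hS.2.2.2 hT.2.2.2 hS.subset hT.subset h).1⟩

theorem IsDisk.sdiff (hS : M.IsDisk A S) (hT : M.IsDisk A T) (h : Overlap S T) :
    M.IsDisk A (S \ T) :=
  ⟨h.2.1, Finset.sdiff_subset.trans hS.subset,
    (convex_union_sdiff (f := id) Function.injective_id hS.2.2.1 hT.2.2.1
      hS.subset hT.subset h).2,
    (convex_union_sdiff M.time_injective hS.2.2.2 hT.2.2.2 hS.subset hT.subset h).2⟩

/-- A disk is strong if no disk overlaps it (this is a strong interval of the permutation). -/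
def IsStrong (M : Meander n) (A S : Finset (Fin n)) : Prop :=
  M.IsDisk A S ∧ ∀ T, M.IsDisk A T → ¬ Overlap S T

theorem IsStrong.subset_or_subset (h : M.IsStrong A S) (hT : M.IsDisk A T)
    (hne : (S ∩ T).Nonempty) : S ⊆ T ∨ T ⊆ S :=
  subset_or_subset_of_not_overlap (h.2 T hT) hne

theorem exists_overlap_of_not_isStrong (hS : M.IsDisk A S) (h : ¬ M.IsStrong A S) :
    ∃ T, M.IsDisk A T ∧ Overlap S T := by
  by_contra hc
  push Not at hc
  exact h ⟨hS, hc⟩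

theorem IsStrong.of_subset (h : M.IsStrong A D) (hS : M.IsDisk A S) (hDS : D ⊆ S) :
    M.IsStrong S D :=
  ⟨h.1.of_subset hS.subset hDS, fun T hT => h.2 T (hT.trans hS)⟩

/-- A proper strong disk of a disk `S` is strong: if `T` overlapped it without lying in `S`, then
`T ∩ S` or `S \ T` would overlap it. -/
theorem IsStrong.trans (h : M.IsStrong S D) (hDS : D ≠ S) (hS : M.IsDisk A S) :
    M.IsStrong A D := by
  refine ⟨h.1.trans hS, fun T hT hov => ?_⟩
  obtain ⟨⟨x, hx⟩, ⟨y, hy⟩, ⟨z, hz⟩⟩ := id hov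
  have hDsub := h.1.subset
  obtain ⟨w, hwS, hwD⟩ := Finset.exists_of_ssubset (hDsub.ssubset_of_ne hDS)
  simp only [Finset.mem_inter, Finset.mem_sdiff] at hx hy hz
  have hTS : M.IsDisk S (T ∩ S) := hT.inter_of_subset hS.subset ⟨x, by simp [hx, hDsub hx.1]⟩
  have h1 : T ∩ S ⊆ D := by
    intro v hv
    by_contra hvD
    exact h.2 _ hTS ⟨⟨x, by simp [hx, hDsub hx.1]⟩, ⟨y, by simp [hy]⟩,
      ⟨v, by simp only [Finset.mem_sdiff]; exact ⟨hv, hvD⟩⟩⟩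
  have hzS : z ∉ S := fun hzS => hz.2 (h1 (by simp [hz, hzS]))
  have hST : M.IsDisk A (S \ T) := hS.sdiff hT
    ⟨⟨x, by simp [hx, hDsub hx.1]⟩, ⟨y, by simp [hy, hDsub hy.1]⟩, ⟨z, by simp [hz, hzS]⟩⟩
  have hwT : w ∉ T := fun hwT => hwD (h1 (by simp [hwT, hwS]))
  exact h.2 _ (hST.of_subset hS.subset Finset.sdiff_subset)
    ⟨⟨y, by simp [hy, hDsub hy.1]⟩, ⟨x, by simp [hx]⟩, ⟨w, by simp [hwS, hwT, hwD]⟩⟩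

/-! ### Articulation points of the decomposition graph -/

/-- `U` and `W` are disks other than `S`, and `U` lies in `W` without `S` lying in between. -/
def LinkStep (M : Meander n) (A S U W : Finset (Fin n)) : Prop :=
  M.IsDisk A U ∧ M.IsDisk A W ∧ U ≠ S ∧ W ≠ S ∧ U ⊆ W ∧ ¬ (U ⊆ S ∧ S ⊆ W)

/-- `U` and `W` lie in the same connected component of the decomposition graph without `S`. -/
def Linked (M : Meander n) (A S : Finset (Fin n)) : Finset (Fin n) → Finset (Fin n) → Prop :=
  Relation.EqvGen (M.LinkStep A S)

theorem Linked.symm (h : M.Linked A S U W) : M.Linked A S W U := Relation.EqvGen.symm _ _ h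

theorem Linked.trans (h : M.Linked A S U V) (h' : M.Linked A S V W) : M.Linked A S U W :=
  Relation.EqvGen.trans _ _ _ h h'

theorem linked_of_subset (hU : M.IsDisk A U) (hW : M.IsDisk A W) (hUS : U ≠ S) (hWS : W ≠ S)
    (h : U ⊆ W) (h' : ¬ (U ⊆ S ∧ S ⊆ W)) : M.Linked A S U W :=
  Relation.EqvGen.rel _ _ ⟨hU, hW, hUS, hWS, h, h'⟩

theorem Linked.iff_of_step {p : Finset (Fin n) → Prop}
    (hp : ∀ U W, M.LinkStep A S U W → (p U ↔ p W)) (h : M.Linked A S U W) : p U ↔ p W := by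
  induction h with
  | rel U W h => exact hp U W h
  | refl => exact Iff.rfl
  | symm _ _ _ ih => exact ih.symm
  | trans _ _ _ _ _ ih1 ih2 => exact ih1.trans ih2

/-- `S` is an articulation point of the decomposition graph of `(M, A)`. -/
def Articulates (M : Meander n) (A S : Finset (Fin n)) : Prop :=
  ∃ U W, M.IsDisk A U ∧ M.IsDisk A W ∧ U ≠ S ∧ W ≠ S ∧ ¬ M.Linked A S U W

theorem isArticulationPoint_iff (h : M.IsDisk A S) :
    IsArticulationPoint (M.decompositionGraph A) ⟨S, h⟩ ↔ M.Articulates A S := by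
  have ht : IsTop (⟨A, isDisk_self (h.1.mono h.2.1)⟩ : M.DiskClass A) := fun U => U.2.2.1
  unfold decompositionGraph
  rw [isArticulationPoint_hasse_iff ht]
  have hne : ∀ {U : M.DiskClass A}, U ≠ ⟨S, h⟩ ↔ U.1 ≠ S := fun {U} => by
    rw [Ne, Subtype.ext_iff]
  constructor
  · rintro ⟨U, W, hU, hW, hUW⟩
    refine ⟨U.1, W.1, U.2, W.2, hne.1 hU, hne.1 hW, fun hl => hUW ?_⟩
    have key : ∀ U W : Finset (Fin n), M.Linked A S U W →
        U = W ∨ ∃ (hU : M.IsDisk A U) (hW : M.IsDisk A W) (hUS : U ≠ S) (hWS : W ≠ S),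
        ((SimpleGraph.hasse (M.DiskClass A)).induce {⟨S, h⟩}ᶜ).Reachable
          ⟨⟨U, hU⟩, hne.2 hUS⟩ ⟨⟨W, hW⟩, hne.2 hWS⟩ := by
      intro U W hl
      induction hl with
      | rel U W hl =>
        obtain ⟨hU, hW, hUS, hWS, hUW, hn⟩ := hl
        exact Or.inr ⟨hU, hW, hUS, hWS,
          SimpleGraph.reachable_induce_hasse_of_le (hne.2 hUS) (hne.2 hWS) hUW hn⟩
      | refl => exact Or.inl rfl
      | symm _ _ _ ih =>
        rcases ih with rfl | ⟨h1, h2, h3, h4, h5⟩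
        · exact Or.inl rfl
        · exact Or.inr ⟨h2, h1, h4, h3, h5.symm⟩
      | trans _ _ _ _ _ ih1 ih2 =>
        rcases ih1 with rfl | ⟨h1, h2, h3, h4, h5⟩
        · exact ih2
        · rcases ih2 with rfl | ⟨k1, k2, k3, k4, k5⟩
          · exact Or.inr ⟨h1, h2, h3, h4, h5⟩
          · exact Or.inr ⟨h1, k2, h3, k4, h5.trans k5⟩
    rcases key _ _ hl with he | ⟨_, _, _, _, h5⟩
    · have : U = W := Subtype.ext he
      subst this
      exact SimpleGraph.Reachable.refl _
    · exact h5
  · rintro ⟨U, W, hU, hW, hUS, hWS, hUW⟩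
    refine ⟨⟨U, hU⟩, ⟨W, hW⟩, hne.2 hUS, hne.2 hWS, fun hr => hUW ?_⟩
    obtain ⟨p⟩ := hr
    have key : ∀ X Y : ({⟨S, h⟩}ᶜ : Set (M.DiskClass A)),
        ((SimpleGraph.hasse (M.DiskClass A)).induce {⟨S, h⟩}ᶜ).Walk X Y →
        M.Linked A S X.1.1 Y.1.1 := by
      intro X Y p
      induction p with
      | nil => exact Relation.EqvGen.refl _
      | @cons X Y Z hadj _ ih =>
        refine Linked.trans ?_ ih
        have hX : X.1.1 ≠ S := hne.1 X.2
        have hY : Y.1.1 ≠ S := hne.1 Y.2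
        -- nothing lies strictly between a class and one that covers it
        rcases SimpleGraph.hasse_adj.1 hadj with hc | hc
        · refine linked_of_subset X.1.2 Y.1.2 hX hY hc.1.1 fun hS => ?_
          exact hc.2 (c := ⟨S, h⟩) (lt_of_le_of_ne hS.1 X.2)
            (lt_of_le_of_ne hS.2 (Ne.symm Y.2))
        · refine (linked_of_subset Y.1.2 X.1.2 hY hX hc.1.1 fun hS => ?_).symm
          exact hc.2 (c := ⟨S, h⟩) (lt_of_le_of_ne hS.1 Y.2)
            (lt_of_le_of_ne hS.2 (Ne.symm X.2))
    exact key _ _ p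

theorem simplifies_iff :
    M.Simplifies A S ↔ 2 < S.card ∧ S.card < A.card ∧ M.IsDisk A S ∧ M.Articulates A S := by
  unfold Simplifies
  refine and_congr_right fun _ => and_congr_right fun _ => ⟨?_, ?_⟩
  · rintro ⟨h, h'⟩
    exact ⟨h, (isArticulationPoint_iff h).1 h'⟩
  · rintro ⟨h, h'⟩
    exact ⟨h, (isArticulationPoint_iff h).2 h'⟩

theorem isBlack_iff :
    M.IsBlack A ↔ M.IsIrreducible A ∧ 2 < A.card ∧ M.Articulates A A := by
  unfold IsBlack IsSnake
  refine and_congr_right fun hirr => ?_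
  constructor
  · intro h
    push Not at h
    obtain ⟨⟨S, hS⟩, h2, ha⟩ := h
    have hSA : S = A := by
      refine Finset.eq_of_subset_of_card_le hS.subset ?_
      by_contra hlt
      exact hirr S hS ⟨h2, not_le.1 hlt⟩
    subst hSA
    exact ⟨h2, (isArticulationPoint_iff hS).1 ha⟩
  · rintro ⟨h2, ha⟩ hsn
    have hne : A.Nonempty := Finset.card_pos.1 (by omega)
    exact hsn ⟨A, isDisk_self hne⟩ h2 ((isArticulationPoint_iff _).2 ha)

/-- Everything inside a strong disk is linked to the outside only through that disk. -/
theorem IsStrong.articulates (h : M.IsStrong A S) (hc : 1 < S.card) (hSA : S ≠ A) :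
    M.Articulates A S := by
  obtain ⟨x, hx⟩ := h.1.1
  have hxS : ({x} : Finset (Fin n)) ≠ S := by
    rintro rfl
    simp at hc
  refine ⟨{x}, A, isDisk_singleton (h.1.subset hx), isDisk_self (h.1.1.mono h.1.2.1),
    hxS, hSA.symm, fun hl => ?_⟩
  have := (hl.iff_of_step (p := fun U => U ⊆ S) ?_).1 (by simpa using hx)
  · exact hSA (h.1.subset.antisymm this)
  · rintro U W ⟨hU, hW, hUS, hWS, hUW, hn⟩
    refine ⟨fun hU' => ?_, fun hW' => hUW.trans hW'⟩
    obtain ⟨u, hu⟩ := hU.1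
    rcases h.subset_or_subset hW ⟨u, Finset.mem_inter.2 ⟨hU' hu, hUW hu⟩⟩ with h1 | h1
    · exact absurd ⟨hU', h1⟩ hn
    · exact h1

theorem IsStrong.simplifies (h : M.IsStrong A S) (hc : 2 < S.card) (hSA : S ≠ A) :
    M.Simplifies A S :=
  simplifies_iff.2 ⟨hc, Finset.card_lt_card (h.1.subset.ssubset_of_ne hSA), h.1,
    h.articulates (by omega) hSA⟩

theorem Articulates.of_isDisk (h : M.Articulates A V) (hS : M.IsDisk A S) (hVS : V ⊆ S)
    (hne : V ≠ S) : M.Articulates S V := by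
  by_contra hc
  unfold Articulates at hc h
  push Not at hc
  have hA := isDisk_self (M := M) (hS.1.mono hS.subset)
  have hSV : ¬ S ⊆ V := fun h => hne (hVS.antisymm h)
  have hAV : A ≠ V := fun h => hSV (h ▸ hS.subset)
  have key : ∀ U, M.IsDisk A U → U ≠ V → M.Linked A V U A := by
    intro U hU hUV
    by_cases hUV' : U ⊆ V
    · have hl := hc U S (hU.of_subset hS.subset (hUV'.trans hVS)) (isDisk_self hS.1) hUV hne.symm
      refine Linked.trans (hl.mono ?_) (linked_of_subset hS hA hne.symm hAV hS.subset
        fun h => hSV h.1)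
      rintro X Y ⟨h1, h2, h3⟩
      exact ⟨h1.trans hS, h2.trans hS, h3⟩
    · exact linked_of_subset hU hA hUV hAV hU.subset fun h => hUV' h.1
  obtain ⟨U, W, hU, hW, hUV, hWV, hl⟩ := h
  exact hl ((key U hU hUV).trans (key W hW hWV).symm)

/-- The disks that do not lie in a strong disk `S` can be contracted to `S`. -/
theorem IsStrong.articulates_of_articulates (hS : M.IsStrong A S) (h : M.Articulates S V)
    (hVS : V ⊆ S) (hne : V ≠ S) : M.Articulates A V := by
  classical
  have hSV : ¬ S ⊆ V := fun h => hne (hVS.antisymm h)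
  obtain ⟨U, W, hU, hW, hUV, hWV, hl⟩ := h
  refine ⟨U, W, hU.trans hS.1, hW.trans hS.1, hUV, hWV, fun hl' => hl ?_⟩
  have key : ∀ X Y, M.Linked A V X Y →
      M.Linked S V (if X ⊆ S then X else S) (if Y ⊆ S then Y else S) := by
    intro X Y hXY
    induction hXY with
    | refl => exact Relation.EqvGen.refl _
    | symm _ _ _ ih => exact ih.symm
    | trans _ _ _ _ _ ih1 ih2 => exact ih1.trans ih2
    | rel X Y hXY =>
      obtain ⟨hX, hY, hXV, hYV, hsub, hn⟩ := hXY
      by_cases hYS : Y ⊆ S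
      · rw [if_pos hYS, if_pos (hsub.trans hYS)]
        exact linked_of_subset (hX.of_subset hS.1.subset (hsub.trans hYS))
          (hY.of_subset hS.1.subset hYS) hXV hYV hsub hn
      · rw [if_neg hYS]
        by_cases hXS : X ⊆ S
        · rw [if_pos hXS]
          obtain ⟨x, hx⟩ := hX.1
          have hSY : S ⊆ Y := (hS.subset_or_subset hY
            ⟨x, Finset.mem_inter.2 ⟨hXS hx, hsub hx⟩⟩).resolve_right hYS
          exact linked_of_subset (hX.of_subset hS.1.subset hXS) (isDisk_self hS.1.1) hXV hne.symm
            hXS fun h => hn ⟨h.1, hVS.trans hSY⟩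
        · rw [if_neg hXS]
          exact Relation.EqvGen.refl _
  have := key U W hl'
  rwa [if_pos hU.subset, if_pos hW.subset] at this

/-! ### Simplifying disks -/

/-- If `S` is an articulation point that some disk overlaps, then `S` is the union of two small
disks with no disk in between, unless `S` contains a smaller strong disk. With `T` overlapping `S`
the two parts are `S \ T` and `S ∩ T`: disks outside `S` are linked to each other, and so are
those that meet `T`, hence no disk inside `S` links the parts. -/
theorem exists_split_of_articulates (hS : M.IsDisk A S) (hart : M.Articulates A S)
    (hns : ¬ M.IsStrong A S)
    (hmin : ∀ D, M.IsStrong A D → D ⊆ S → D ≠ S → D.card ≤ 2) :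
    ∃ X Y, M.IsDisk A X ∧ M.IsDisk A Y ∧ Disjoint X Y ∧ X ∪ Y = S ∧ X.card ≤ 2 ∧ Y.card ≤ 2 ∧
      ∀ U, M.IsDisk A U → U ⊆ S → U ≠ S → U ⊆ X ∨ U ⊆ Y := by
  obtain ⟨T, hT, hov⟩ := exists_overlap_of_not_isStrong hS hns
  obtain ⟨⟨y, hy⟩, ⟨x, hx⟩, ⟨z, hz⟩⟩ := id hov
  have hX : M.IsDisk A (S \ T) := hS.sdiff hT hov
  have hY : M.IsDisk A (S ∩ T) := hS.inter hT hov.1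
  simp only [Finset.mem_inter, Finset.mem_sdiff] at hx hy hz
  have hST : ¬ S ⊆ T := fun h => hx.2 (h hx.1)
  have hTS : ¬ T ⊆ S := fun h => hz.2 (h hz.1)
  have hA : M.IsDisk A A := isDisk_self (hS.1.mono hS.subset)
  have hAS : A ≠ S := fun h => hTS (h ▸ hT.subset)
  have hXS : S \ T ≠ S := fun h => by
    have := h.symm ▸ hy.1
    simp [hy.2] at this
  have hSX : ¬ S ⊆ S \ T := fun h => hXS (Finset.sdiff_subset.antisymm h)
  have hout : ∀ V, M.IsDisk A V → ¬ V ⊆ S → M.Linked A S V A := fun V hV hVS =>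
    linked_of_subset hV hA (fun h => hVS h.subset) hAS hV.subset fun h => hVS h.1
  have hmeet : ∀ V, M.IsDisk A V → V ≠ S → (V ∩ T).Nonempty → M.Linked A S V A := by
    intro V hV hVS hVT
    by_cases hVS' : V ⊆ S
    · have hVT' := hV.inter hT hVT
      have hne : V ∩ T ≠ S := fun h => hST (h ▸ Finset.inter_subset_right)
      have hSV : ¬ S ⊆ V := fun h => hVS (hVS'.antisymm h)
      refine Linked.trans (linked_of_subset hVT' hV hne hVS Finset.inter_subset_left
        fun h => hSV h.2).symm ?_
      refine Linked.trans (linked_of_subset hVT' hT hne (fun h => hTS h.subset)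
        Finset.inter_subset_right fun h => hST h.2) (hout T hT hTS)
    · exact hout V hV hVS'
  have hXl : ¬ M.Linked A S (S \ T) A := by
    intro hXl
    have key : ∀ V, M.IsDisk A V → V ≠ S → M.Linked A S V A := by
      intro V hV hVS
      by_cases hVS' : V ⊆ S
      · by_cases hVT : (V ∩ T).Nonempty
        · exact hmeet V hV hVS hVT
        · refine Linked.trans (linked_of_subset hV hX hVS hXS ?_ fun h => hSX h.2) hXl
          intro v hv
          exact Finset.mem_sdiff.2 ⟨hVS' hv, fun hvT => hVT ⟨v, Finset.mem_inter.2 ⟨hv, hvT⟩⟩⟩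
      · exact hout V hV hVS'
    obtain ⟨U, W, hU, hW, hUS, hWS, hl⟩ := hart
    exact hl ((key U hU hUS).trans (key W hW hWS).symm)
  -- A linked disk that meets `S \ T` contains `S`.
  have hsub : ∀ V, M.IsDisk A V → M.Linked A S V A → V ≠ S → (V ∩ (S \ T)).Nonempty → S ⊆ V := by
    intro V hV hVl hVS hVX
    by_contra hSV
    have hVX' := hV.inter hX hVX
    have hne : V ∩ (S \ T) ≠ S := fun h =>
      hSX (h.symm.subset.trans Finset.inter_subset_right)
    exact hXl ((linked_of_subset hVX' hX hne hXS Finset.inter_subset_right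
      fun h => hSX h.2).symm.trans
      ((linked_of_subset hVX' hV hne hVS Finset.inter_subset_left fun h => hSV h.2).trans hVl))
  have hU : ∀ U, M.IsDisk A U → U ⊆ S → U ≠ S → U ⊆ S \ T ∨ U ⊆ S ∩ T := by
    intro U hU hUS hUne
    by_cases hUT : (U ∩ T).Nonempty
    · right
      intro u hu
      refine Finset.mem_inter.2 ⟨hUS hu, ?_⟩
      by_contra huT
      exact hUne (hUS.antisymm (hsub U hU (hmeet U hU hUne hUT) hUne
        ⟨u, Finset.mem_inter.2 ⟨hu, Finset.mem_sdiff.2 ⟨hUS hu, huT⟩⟩⟩))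
    · left
      intro u hu
      exact Finset.mem_sdiff.2 ⟨hUS hu, fun h => hUT ⟨u, Finset.mem_inter.2 ⟨hu, h⟩⟩⟩
  refine ⟨S \ T, S ∩ T, hX, hY, Finset.disjoint_sdiff_inter S T, Finset.sdiff_union_inter S T,
    ?_, ?_, hU⟩
  · by_contra hc
    have hnX : ¬ M.IsStrong A (S \ T) := fun h => hc (hmin _ h Finset.sdiff_subset hXS)
    obtain ⟨V, hV, hVX, ⟨w, hw⟩, ⟨v, hv⟩⟩ := exists_overlap_of_not_isStrong hX hnX
    simp only [Finset.mem_sdiff, not_and, not_not] at hw hv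
    have hSV : ¬ S ⊆ V := fun h => hw.2 (h hw.1.1)
    have hVS : V ≠ S := fun h => hSV h.symm.subset
    rw [Finset.inter_comm] at hVX
    by_cases hVS' : V ⊆ S
    · exact hSV (hsub V hV (hmeet V hV hVS
        ⟨v, Finset.mem_inter.2 ⟨hv.1, hv.2 (hVS' hv.1)⟩⟩) hVS hVX)
    · exact hSV (hsub V hV (hout V hV hVS') hVS hVX)
  · by_contra hc
    have hYS : S ∩ T ≠ S := fun h => hST (h ▸ Finset.inter_subset_right)
    have hnY : ¬ M.IsStrong A (S ∩ T) := fun h => hc (hmin _ h Finset.inter_subset_left hYS)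
    obtain ⟨V, hV, ⟨u, hu⟩, ⟨w, hw⟩, ⟨v, hv⟩⟩ := exists_overlap_of_not_isStrong hY hnY
    simp only [Finset.mem_sdiff, Finset.mem_inter, not_and] at hw hv hu
    have hSV : ¬ S ⊆ V := fun h => hw.2 (h hw.1.1)
    have hVS : V ≠ S := fun h => hSV h.symm.subset
    by_cases hVX : (V ∩ (S \ T)).Nonempty
    · exact hSV (hsub V hV (hmeet V hV hVS ⟨u, Finset.mem_inter.2 ⟨hu.2, hu.1.2⟩⟩) hVS hVX)
    · -- `V` overlaps `S` as well, and `S \ V` is a disk that meets both parts.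
      have hxV : x ∉ V := fun h =>
        hVX ⟨x, Finset.mem_inter.2 ⟨h, Finset.mem_sdiff.2 hx⟩⟩
      have hvS : v ∉ S := fun h => by
        by_cases hvT : v ∈ T
        · exact hv.2 h hvT
        · exact hVX ⟨v, Finset.mem_inter.2 ⟨hv.1, Finset.mem_sdiff.2 ⟨h, hvT⟩⟩⟩
      have hSV' : M.IsDisk A (S \ V) := hS.sdiff hV
        ⟨⟨u, by simp [hu]⟩, ⟨x, by simp [hx.1, hxV]⟩, ⟨v, by simp [hv.1, hvS]⟩⟩
      have hne : S \ V ≠ S := fun h => by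
        have := h.symm ▸ hu.1.1
        simp [hu.2] at this
      rcases hU _ hSV' Finset.sdiff_subset hne with h | h
      · have := h (Finset.mem_sdiff.2 ⟨hw.1.1, hw.2⟩)
        simp [hw.1.2] at this
      · have := h (Finset.mem_sdiff.2 ⟨hx.1, hxV⟩)
        simp [hx.2] at this

theorem mem_primeDisks : S ∈ M.primeDisks A ↔ M.Simplifies A S ∧ M.IsPrime S := by
  classical
  unfold primeDisks
  rw [Finset.mem_filter, Finset.mem_powerset]
  refine ⟨fun h => h.2, fun h => ⟨?_, h⟩⟩
  exact (simplifies_iff.1 h.1).2.2.1.subset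

theorem isDisk_of_mem_primeDisks (h : S ∈ M.primeDisks A) : M.IsDisk A S :=
  (simplifies_iff.1 (mem_primeDisks.1 h).1).2.2.1

theorem two_lt_card_of_mem_primeDisks (h : S ∈ M.primeDisks A) : 2 < S.card :=
  (simplifies_iff.1 (mem_primeDisks.1 h).1).1

theorem articulates_of_mem_primeDisks (h : S ∈ M.primeDisks A) : M.Articulates A S :=
  (simplifies_iff.1 (mem_primeDisks.1 h).1).2.2.2

theorem IsPrime.eq_of_isStrong (h : M.IsPrime A) (hS : M.IsStrong A S) (hc : 2 < S.card) :
    S = A := by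
  by_contra hne
  exact h S (hS.simplifies hc hne)

theorem primeDisks_nonempty (h : ¬ M.IsPrime A) : (M.primeDisks A).Nonempty := by
  classical
  unfold IsPrime at h
  push Not at h
  obtain ⟨S, hS, hmin⟩ := WellFounded.has_min (measure Finset.card).wf
    {S | M.Simplifies A S} h
  refine ⟨S, mem_primeDisks.2 ⟨hS, fun U hU => ?_⟩⟩
  obtain ⟨hc, hcA, hSd, hSa⟩ := simplifies_iff.1 hS
  obtain ⟨hcU, hcUS, hUd, hUa⟩ := simplifies_iff.1 hU
  have hUne : U ≠ S := fun h => by subst h; omega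
  by_cases hst : M.IsStrong A S
  · refine hmin U (simplifies_iff.2 ⟨hcU, by omega, hUd.trans hSd, ?_⟩) hcUS
    exact hst.articulates_of_articulates hUa hUd.subset hUne
  · obtain ⟨X, Y, -, -, -, -, hcX, hcY, hXY⟩ := exists_split_of_articulates hSd hSa hst (by
      intro D hD hDS hDne
      by_contra hcD
      refine hmin D (hD.simplifies (not_le.1 hcD) ?_)
        (Finset.card_lt_card (hDS.ssubset_of_ne hDne))
      rintro rfl
      have := Finset.card_le_card hDS
      omega)
    rcases hXY U (hUd.trans hSd) hUd.subset hUne with h' | h' <;>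
    · have := Finset.card_le_card h'
      omega

theorem exists_split_of_mem_primeDisks (hS : S ∈ M.primeDisks A) (hns : ¬ M.IsStrong A S) :
    ∃ X Y, M.IsDisk A X ∧ M.IsDisk A Y ∧ Disjoint X Y ∧ X ∪ Y = S ∧ X.card ≤ 2 ∧ Y.card ≤ 2 ∧
      ∀ U, M.IsDisk A U → U ⊆ S → U ≠ S → U ⊆ X ∨ U ⊆ Y := by
  have hd := isDisk_of_mem_primeDisks hS
  refine exists_split_of_articulates hd (articulates_of_mem_primeDisks hS) hns ?_
  intro D hD hDS hDne
  by_contra hcD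
  exact hDne ((mem_primeDisks.1 hS).2.eq_of_isStrong (hD.of_subset hd hDS) (not_le.1 hcD))

theorem isBlack_of_mem_primeDisks (hS : S ∈ M.primeDisks A) (hns : ¬ M.IsStrong A S) :
    M.IsBlack S := by
  obtain ⟨X, Y, hX, hY, hdis, hXY, hcX, hcY, hU⟩ := exists_split_of_mem_primeDisks hS hns
  have hd := isDisk_of_mem_primeDisks hS
  have hc := two_lt_card_of_mem_primeDisks hS
  have hXS : X ⊆ S := hXY ▸ Finset.subset_union_left
  have hYS : Y ⊆ S := hXY ▸ Finset.subset_union_right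
  refine isBlack_iff.2 ⟨fun U hUd hUc => ?_, hc, ?_⟩
  · have hUne : U ≠ S := fun h => by subst h; omega
    rcases hU U (hUd.trans hd) hUd.subset hUne with h' | h' <;>
    · have := Finset.card_le_card h'
      omega
  · refine ⟨X, Y, hX.of_subset hd.subset hXS, hY.of_subset hd.subset hYS,
      fun h => by subst h; omega, fun h => by subst h; omega, fun hl => ?_⟩
    have := (hl.iff_of_step (p := fun U => U ⊆ X) ?_).1 subset_rfl
    · obtain ⟨y, hy⟩ := hY.1
      exact Finset.disjoint_left.1 hdis (this hy) hy
    · rintro U W ⟨hUd, hWd, hUS, hWS, hUW, -⟩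
      refine ⟨fun hUX => ?_, fun hWX => hUW.trans hWX⟩
      refine (hU W (hWd.trans hd) hWd.subset hWS).resolve_right fun hWY => ?_
      obtain ⟨u, hu⟩ := hUd.1
      exact Finset.disjoint_left.1 hdis (hUX hu) (hWY (hUW hu))

theorem eq_of_mem_primeDisks_of_subset (hS : S ∈ M.primeDisks A) (hT : T ∈ M.primeDisks A)
    (h : S ⊆ T) : S = T := by
  by_contra hne
  refine (mem_primeDisks.1 hT).2 S (simplifies_iff.2 ⟨two_lt_card_of_mem_primeDisks hS,
    Finset.card_lt_card (h.ssubset_of_ne hne), ?_, ?_⟩)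
  · exact (isDisk_of_mem_primeDisks hS).of_subset (isDisk_of_mem_primeDisks hT).subset h
  · exact (articulates_of_mem_primeDisks hS).of_isDisk (isDisk_of_mem_primeDisks hT) h hne

theorem eq_of_mem_primeDisks_of_inter (hS : S ∈ M.primeDisks A) (hT : T ∈ M.primeDisks A)
    (hst : M.IsStrong A S) (h : (S ∩ T).Nonempty) : S = T := by
  rcases hst.subset_or_subset (isDisk_of_mem_primeDisks hT) h with h' | h'
  · exact eq_of_mem_primeDisks_of_subset hS hT h'
  · exact (eq_of_mem_primeDisks_of_subset hT hS h').symm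

end Meander

/-- `x` comes before `y` in the order of a linear order (`d = true`) or in its dual order. -/
def DirLT {α : Type*} [LT α] (d : Bool) (x y : α) : Prop :=
  if d then x < y else y < x

theorem DirLT.trans {α : Type*} [Preorder α] {d : Bool} {x y z : α} (h : DirLT d x y)
    (h' : DirLT d y z) : DirLT d x z := by
  cases d
  · exact lt_trans (α := α) h' h
  · exact lt_trans (α := α) h h'

theorem DirLT.not_dirLT_not {α : Type*} [Preorder α] {d : Bool} {x y : α} (h : DirLT d x y) :
    ¬ DirLT (!d) x y := by
  cases d
  · exact lt_asymm (α := α) h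
  · exact lt_asymm (α := α) h

namespace Meander

variable {n : ℕ} {M : Meander n} {A S T U V W X Y B C D : Finset (Fin n)}

/-! ### Separable point sets -/

/-- The points of `C` precede those of `D` along `m`, and along `l` as well (`d = true`), or follow
them along `l` (`d = false`). -/
def Precedes (M : Meander n) (d : Bool) (C D : Finset (Fin n)) : Prop :=
  ∀ x ∈ C, ∀ y ∈ D, M.time x < M.time y ∧ DirLT d x y

theorem Precedes.disjoint {d : Bool} (h : M.Precedes d C D) : Disjoint C D :=
  Finset.disjoint_left.2 fun x hx hy => lt_irrefl _ (h x hx x hy).1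

theorem Precedes.isDisk_left {d : Bool} (h : M.Precedes d C D) (hC : C.Nonempty) :
    M.IsDisk (C ∪ D) C := by
  refine ⟨hC, Finset.subset_union_left, fun a ha b hb c hc h1 h2 => ?_,
    fun a ha b hb c hc h1 h2 => ?_⟩
  · refine (Finset.mem_union.1 hc).resolve_right fun hcD => ?_
    cases d
    · exact lt_asymm h1 (h a ha c hcD).2
    · exact lt_asymm h2 (h b hb c hcD).2
  · exact (Finset.mem_union.1 hc).resolve_right fun hcD => lt_asymm h2 (h b hb c hcD).1

theorem Precedes.isDisk_right {d : Bool} (h : M.Precedes d C D) (hD : D.Nonempty) :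
    M.IsDisk (C ∪ D) D := by
  refine ⟨hD, Finset.subset_union_right, fun a ha b hb c hc h1 h2 => ?_,
    fun a ha b hb c hc h1 h2 => ?_⟩
  · refine (Finset.mem_union.1 hc).resolve_left fun hcC => ?_
    cases d
    · exact lt_asymm h2 (h c hcC b hb).2
    · exact lt_asymm h1 (h c hcC a ha).2
  · exact (Finset.mem_union.1 hc).resolve_left fun hcC => lt_asymm h1 (h c hcC a ha).1

/-- `B` splits into two nonempty parts, the first of which precedes the second one along `m`
and lies entirely on one side of it along `l`. -/
def IsDecomposable (M : Meander n) (B : Finset (Fin n)) : Prop :=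
  ∃ (d : Bool) (C D : Finset (Fin n)), C.Nonempty ∧ D.Nonempty ∧ C ∪ D = B ∧
    M.Precedes d C D

/-- `A` carries a separable permutation: all its subsets with at least two points are
decomposable. -/
def IsSeparable (M : Meander n) (A : Finset (Fin n)) : Prop :=
  ∀ B ⊆ A, 2 ≤ B.card → M.IsDecomposable B

theorem IsSeparable.mono (h : M.IsSeparable A) (hS : S ⊆ A) : M.IsSeparable S :=
  fun B hB => h B (hB.trans hS)

theorem isDecomposable_of_card_eq_two (h : B.card = 2) : M.IsDecomposable B := by
  have key : ∀ x y : Fin n, M.time x < M.time y → B = {x, y} → M.IsDecomposable B := by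
    intro x y hxy hB
    have hne : x ≠ y := fun h => by subst h; exact lt_irrefl _ hxy
    refine ⟨decide (x < y), {x}, {y}, by simp, by simp, by rw [hB]; rfl, ?_⟩
    unfold Precedes
    simp only [Finset.mem_singleton, forall_eq]
    refine ⟨hxy, ?_⟩
    unfold DirLT
    by_cases hlt : x < y
    · simp [hlt]
    · simpa [hlt] using lt_of_le_of_ne (not_lt.1 hlt) hne.symm
  obtain ⟨x, y, hne, hB⟩ := Finset.card_eq_two.1 h
  rcases lt_trichotomy (M.time x) (M.time y) with h1 | h1 | h1
  · exact key x y h1 hB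
  · exact absurd (M.time_injective h1) hne
  · exact key y x h1 (by rw [hB, Finset.pair_comm])

/-- `r` contracts disjoint disks of `(M, A)` to one point each. -/
def IsCollapse (M : Meander n) (A : Finset (Fin n)) (r : Fin n → Fin n) : Prop :=
  ∀ x ∈ A, ∃ I, M.IsDisk A I ∧ x ∈ I ∧ r x ∈ I ∧ ∀ y ∈ I, r y = r x

theorem lt_of_convex_of_lt {β : Type*} [LinearOrder β] {f : Fin n → β}
    (hf : Function.Injective f) {I : Finset (Fin n)}
    (hI : ∀ a ∈ I, ∀ b ∈ I, ∀ c ∈ A, f a < f c → f c < f b → c ∈ I) {x x' y : Fin n}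
    (hx : x ∈ I) (hx' : x' ∈ I) (hy : y ∈ A) (hyI : y ∉ I) :
    (f x < f y → f x' < f y) ∧ (f y < f x → f y < f x') := by
  have hne : f x' ≠ f y := fun h => hyI (hf h ▸ hx')
  constructor <;> intro h <;> by_contra hc
  · exact hyI (hI x hx x' hx' y hy h (lt_of_le_of_ne (not_lt.1 hc) hne.symm))
  · exact hyI (hI x' hx' x hx y hy (lt_of_le_of_ne (not_lt.1 hc) hne) h)

theorem IsCollapse.lt {r : Fin n → Fin n} (hr : M.IsCollapse A r) {x y : Fin n} (hx : x ∈ A)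
    (hy : y ∈ A) (hne : r x ≠ r y) :
    (x < y → r x < r y) ∧ (M.time x < M.time y → M.time (r x) < M.time (r y)) := by
  obtain ⟨I, hI, hxI, hrI, hIr⟩ := hr x hx
  obtain ⟨J, hJ, hyJ, hrJ, hJr⟩ := hr y hy
  have hyI : y ∉ I := fun h => hne (hIr y h).symm
  have hrxJ : r x ∉ J := fun h => hne (by rw [← hJr _ h, hIr _ hrI])
  have hrxA : r x ∈ A := hI.subset hrI
  constructor
  · intro h
    have h1 := (lt_of_convex_of_lt (f := id) Function.injective_id hI.2.2.1 hxI hrI hy hyI).1 h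
    exact (lt_of_convex_of_lt (f := id) Function.injective_id hJ.2.2.1 hyJ hrJ hrxA hrxJ).2 h1
  · intro h
    have h1 := (lt_of_convex_of_lt M.time_injective hI.2.2.2 hxI hrI hy hyI).1 h
    exact (lt_of_convex_of_lt M.time_injective hJ.2.2.2 hyJ hrJ hrxA hrxJ).2 h1

theorem IsCollapse.time_lt_and_lt {r : Fin n → Fin n} (hr : M.IsCollapse A r) {x y : Fin n}
    (hx : x ∈ A) (hy : y ∈ A) {d : Bool}
    (h : M.time (r x) < M.time (r y) ∧ DirLT d (r x) (r y)) :
    M.time x < M.time y ∧ DirLT d x y := by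
  have hne : r x ≠ r y := fun he => by
    rw [he] at h
    exact lt_irrefl _ h.1
  have hxy : x ≠ y := fun he => hne (he ▸ rfl)
  obtain ⟨h1, h2⟩ := hr.lt hx hy hne
  obtain ⟨h3, h4⟩ := hr.lt hy hx hne.symm
  constructor
  · rcases lt_trichotomy (M.time x) (M.time y) with h5 | h5 | h5
    · exact h5
    · exact absurd (M.time_injective h5) hxy
    · exact absurd (h4 h5) (lt_asymm h.1)
  · cases d
    · rcases lt_trichotomy x y with h5 | h5 | h5
      · exact absurd (h1 h5) (lt_asymm (show r y < r x from h.2))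
      · exact absurd h5 hxy
      · exact h5
    · rcases lt_trichotomy x y with h5 | h5 | h5
      · exact h5
      · exact absurd h5 hxy
      · exact absurd (h3 h5) (lt_asymm (show r x < r y from h.2))

theorem IsCollapse.isDecomposable {r : Fin n → Fin n} (hr : M.IsCollapse A r) (hB : B ⊆ A)
    (h : M.IsDecomposable (B.image r)) : M.IsDecomposable B := by
  obtain ⟨d, C, D, ⟨c, hc⟩, ⟨e, he⟩, hCD, hlt⟩ := h
  refine ⟨d, B.filter fun x => r x ∈ C, B.filter fun x => r x ∈ D, ?_, ?_, ?_, ?_⟩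
  · obtain ⟨x, hx, rfl⟩ := Finset.mem_image.1 (hCD ▸ Finset.mem_union_left D hc)
    exact ⟨x, Finset.mem_filter.2 ⟨hx, hc⟩⟩
  · obtain ⟨x, hx, rfl⟩ := Finset.mem_image.1 (hCD ▸ Finset.mem_union_right C he)
    exact ⟨x, Finset.mem_filter.2 ⟨hx, he⟩⟩
  · rw [← Finset.filter_or]
    refine Finset.filter_true_of_mem fun x hx => ?_
    rw [← Finset.mem_union, hCD]
    exact Finset.mem_image_of_mem r hx
  · intro x hx y hy
    rw [Finset.mem_filter] at hx hy
    exact hr.time_lt_and_lt (hB hx.1) (hB hy.1) (hlt _ hx.2 _ hy.2)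

theorem isCollapse_single {I : Finset (Fin n)} (hI : M.IsDisk A I) {i : Fin n} (hi : i ∈ I) :
    M.IsCollapse A fun x => if x ∈ I then i else x := by
  intro x hx
  by_cases hxI : x ∈ I
  · exact ⟨I, hI, hxI, by simp [hxI, hi], fun y hy => by simp [hy, hxI]⟩
  · exact ⟨{x}, isDisk_singleton hx, by simp, by simp [hxI],
      fun y hy => by rw [Finset.mem_singleton.1 hy]⟩

/-- A minimal set that is not decomposable meets disks trivially. -/
theorem card_inter_le_one_or_subset (hB : B ⊆ A) (hnd : ¬ M.IsDecomposable B)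
    (hmin : ∀ C ⊆ A, 2 ≤ C.card → C.card < B.card → M.IsDecomposable C) (hS : M.IsDisk A S) :
    (B ∩ S).card ≤ 1 ∨ B ⊆ S := by
  by_contra hc
  rw [not_or, not_le, Finset.one_lt_card] at hc
  obtain ⟨⟨i, hi, j, hj, hij⟩, hBS⟩ := hc
  rw [Finset.mem_inter] at hi hj
  obtain ⟨w, hwB, hwS⟩ := Finset.not_subset.1 hBS
  refine hnd ((isCollapse_single hS hi.2).isDecomposable hB (hmin _ ?_ ?_ ?_))
  · intro x hx
    obtain ⟨y, hy, rfl⟩ := Finset.mem_image.1 hx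
    split_ifs
    · exact hB hi.1
    · exact hB hy
  · refine Finset.one_lt_card.2 ⟨i, Finset.mem_image.2 ⟨i, hi.1, by simp [hi.2]⟩, w,
      Finset.mem_image.2 ⟨w, hwB, by simp [hwS]⟩, fun h => hwS (h ▸ hi.2)⟩
  · refine lt_of_le_of_ne Finset.card_image_le fun h => hij ?_
    exact Finset.card_image_iff.1 h hi.1 hj.1 (by simp [hi.2, hj.2])

/-- The smallest disk containing `B`. -/
theorem exists_hull (hB : B ⊆ A) (hne : B.Nonempty) :
    ∃ D, M.IsDisk A D ∧ B ⊆ D ∧ ∀ S, M.IsDisk A S → B ⊆ S → D ⊆ S := by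
  obtain ⟨D, ⟨hD, hBD⟩, hmin⟩ := WellFounded.has_min (measure Finset.card).wf
    {S | M.IsDisk A S ∧ B ⊆ S} ⟨A, isDisk_self (hne.mono hB), hB⟩
  refine ⟨D, hD, hBD, fun S hS hBS => ?_⟩
  have h1 : B ⊆ D ∩ S := Finset.subset_inter hBD hBS
  have h2 := Finset.eq_of_subset_of_card_le (Finset.inter_subset_left (s₁ := D) (s₂ := S))
    (not_lt.1 (hmin (D ∩ S) ⟨hD.inter hS (hne.mono h1), h1⟩))
  exact Finset.inter_eq_left.1 h2

/-- The hull `D` of a minimal indecomposable subset `B` is strong. If it is not all of `A`, it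
simplifies `(M, A)`; otherwise a maximal proper disk is strong, hence has at most two points,
and separates the decomposition graph. -/
theorem isSeparable_of_isPrime (hp : M.IsPrime A) (hb : ¬ M.IsBlack A) : M.IsSeparable A := by
  by_contra hns
  unfold IsSeparable at hns
  push Not at hns
  obtain ⟨B, ⟨hBA, hB2, hBnd⟩, hmin'⟩ := WellFounded.has_min (measure Finset.card).wf
    {B | B ⊆ A ∧ 2 ≤ B.card ∧ ¬ M.IsDecomposable B} hns
  have hB3 : 2 < B.card := lt_of_le_of_ne hB2 fun h =>
    hBnd (isDecomposable_of_card_eq_two h.symm)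
  have hsimple : ∀ S, M.IsDisk A S → (B ∩ S).card ≤ 1 ∨ B ⊆ S := fun S hS =>
    card_inter_le_one_or_subset hBA hBnd (fun C hC hC2 hCB => by
      by_contra hCnd
      exact hmin' C ⟨hC, hC2, hCnd⟩ hCB) hS
  have hBne : B.Nonempty := Finset.card_pos.1 (by omega)
  obtain ⟨D, hD, hBD, hDmin⟩ := exists_hull hBA hBne
  have hDc := Finset.card_le_card hBD
  have hDst : M.IsStrong A D := by
    refine ⟨hD, fun T hT hov => ?_⟩
    have hDT := hD.sdiff hT hov
    rcases hsimple T hT with h | h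
    · have h1 : (B ∩ (D \ T)).card + (B ∩ T).card = B.card := by
        rw [← Finset.inter_sdiff_assoc, Finset.inter_eq_left.2 hBD,
          Finset.card_sdiff_add_card_inter]
      have h2 : B ⊆ D \ T := (hsimple _ hDT).resolve_left (by omega)
      obtain ⟨x, hx⟩ := hov.1
      rw [Finset.mem_inter] at hx
      exact (Finset.mem_sdiff.1 (hDmin _ hDT h2 hx.1)).2 hx.2
    · obtain ⟨x, hx⟩ := hov.2.1
      rw [Finset.mem_sdiff] at hx
      exact hx.2 (hDmin T hT h hx.1)
  obtain rfl := hp.eq_of_isStrong hDst (by omega)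
  obtain ⟨b, hbB⟩ := hBne
  have hprop : ∃ E, M.IsDisk D E ∧ E ≠ D :=
    ⟨{b}, isDisk_singleton (hBA hbB), fun h => by
      rw [← h, Finset.card_singleton] at hDc
      omega⟩
  obtain ⟨E, ⟨hE, hEne⟩, hEmax⟩ := Set.exists_max_image {E | M.IsDisk D E ∧ E ≠ D} Finset.card
    (Set.toFinite _) hprop
  have hsmall : ∀ S, M.IsDisk D S → S ≠ D → (B ∩ S).card ≤ 1 := fun S hS hSne =>
    (hsimple S hS).resolve_right fun h => hSne (hS.subset.antisymm (hDmin S hS h))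
  have hEst : M.IsStrong D E := by
    refine ⟨hE, fun T hT hov => ?_⟩
    have hTne : T ≠ D := fun h => by
      obtain ⟨x, hx⟩ := hov.2.1
      rw [Finset.mem_sdiff] at hx
      exact hx.2 (h ▸ hE.subset hx.1)
    have hlt : E.card < (E ∪ T).card := Finset.card_lt_card
      ⟨Finset.subset_union_left, fun h => by
        obtain ⟨x, hx⟩ := hov.2.2
        rw [Finset.mem_sdiff] at hx
        exact hx.2 (h (Finset.mem_union_right _ hx.1))⟩
    have hun : E ∪ T = D := by
      by_contra hne
      exact absurd (hEmax _ ⟨hE.union hT hov, hne⟩) (not_le.2 hlt)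
    have h1 := hsmall E hE hEne
    have h2 := hsmall T hT hTne
    have h3 : B = (B ∩ E) ∪ (B ∩ T) := by
      rw [← Finset.inter_union_distrib_left, hun, Finset.inter_eq_left.2 hBA]
    have h4 := Finset.card_union_le (B ∩ E) (B ∩ T)
    rw [← h3] at h4
    omega
  have hE2 : E.card ≤ 2 := by
    by_contra h
    exact hEne (hp.eq_of_isStrong hEst (not_le.1 h))
  refine hb (isBlack_iff.2 ⟨fun S hS hSc => ?_, by omega, ?_⟩)
  · have := hEmax S ⟨hS, fun h => by subst h; omega⟩
    omega
  · obtain ⟨x, hxD, hxE⟩ := Finset.exists_of_ssubset (hE.subset.ssubset_of_ne hEne)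
    refine ⟨E, {x}, hE, isDisk_singleton hxD, hEne, fun h => ?_, fun hl => ?_⟩
    · rw [← h, Finset.card_singleton] at hDc
      omega
    · have := (hl.iff_of_step (p := fun U => U ⊆ E) ?_).1 subset_rfl
      · exact hxE (this (Finset.mem_singleton_self x))
      · rintro U W ⟨hU, hW, -, hWne, hUW, -⟩
        refine ⟨fun hUE => ?_, fun hWE => hUW.trans hWE⟩
        obtain ⟨u, hu⟩ := hU.1
        rcases hEst.subset_or_subset hW ⟨u, Finset.mem_inter.2 ⟨hUE hu, hUW hu⟩⟩ with h | h
        · exact (Finset.eq_of_subset_of_card_le h (hEmax W ⟨hW, hWne⟩)).symm.subset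
        · exact h

end Meander

theorem ConstructionTree.noBlackVertex_node {b : Bool} {k : ℕ} {L : List ConstructionTree} :
    (ConstructionTree.node b k L).NoBlackVertex ↔ b = false ∧ ∀ T ∈ L, T.NoBlackVertex := by
  constructor
  · intro h
    cases h with
    | node _ _ h => exact ⟨rfl, h⟩
  · rintro ⟨rfl, h⟩
    exact .node k L h

namespace Meander

variable {n : ℕ} {M : Meander n} {A S T U V W X Y B D : Finset (Fin n)}

/-! ### Cutting disjoint strong disks -/

theorem noBlackVertex_treeOver {F : Fin n → List ConstructionTree} :
    (M.treeOver A F).NoBlackVertex ↔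
      ¬ M.IsBlack A ∧ ∀ c ∈ A, ∀ T ∈ F c, T.NoBlackVertex := by
  classical
  unfold treeOver
  rw [ConstructionTree.noBlackVertex_node, decide_eq_false_iff_not]
  refine and_congr_right fun _ => ?_
  simp only [List.mem_flatMap, Finset.mem_sort, forall_exists_index, and_imp]
  exact ⟨fun h c hc T hT => h T c hc hT, fun h T c hc hT => h c hc T hT⟩

theorem exists_isFirst (M : Meander n) (h : S.Nonempty) : ∃ c, M.IsFirst S c := by
  obtain ⟨c, hc, hmin⟩ := Finset.exists_min_image S M.time h
  exact ⟨c, hc, hmin⟩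

theorem IsFirst.unique {c d : Fin n} (h : M.IsFirst S c) (h' : M.IsFirst S d) : c = d :=
  M.time_injective (le_antisymm (h.2 d h'.1) (h'.2 c h.1))

theorem mem_cut {c : Fin n} : c ∈ M.cut A ↔ c ∈ A ∧ ∀ S ∈ M.primeDisks A, c ∈ S →
    M.IsFirst S c ∨ (Even S.card ∧ M.IsLast S c) := by
  classical
  exact Finset.mem_filter

theorem cut_subset : M.cut A ⊆ A := fun _ h => (mem_cut.1 h).1

/-- The trees at the points of the meander after the cut. -/
noncomputable def cutTrees (M : Meander n) (A : Finset (Fin n))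
    (F : Fin n → List ConstructionTree) (c : Fin n) : List ConstructionTree :=
  (M.decompositionStep (A, F)).2 c

theorem decompositionStep_eq (F : Fin n → List ConstructionTree) :
    M.decompositionStep (A, F) = (M.cut A, M.cutTrees A F) := rfl

theorem mem_cutTrees_of_isFirst {F : Fin n → List ConstructionTree} {c : Fin n}
    (hS : S ∈ M.primeDisks A) (hc : M.IsFirst S c) : M.treeOver S F ∈ M.cutTrees A F c := by
  classical
  unfold cutTrees decompositionStep
  dsimp only
  rw [if_pos ⟨S, hS, hc.1⟩, List.mem_map]
  exact ⟨S, by simpa using ⟨hS, hc⟩, rfl⟩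

theorem cutTrees_of_forall_notMem {F : Fin n → List ConstructionTree} {c : Fin n}
    (h : ∀ S ∈ M.primeDisks A, c ∉ S) : M.cutTrees A F c = F c := by
  classical
  unfold cutTrees decompositionStep
  dsimp only
  rw [if_neg]
  rintro ⟨S, hS, hc⟩
  exact h S hS hc

theorem mem_cutTrees {F : Fin n → List ConstructionTree} {c : Fin n} {T : ConstructionTree}
    (h : T ∈ M.cutTrees A F c) :
    T ∈ F c ∨ ∃ S ∈ M.primeDisks A, M.treeOver S F = T := by
  classical
  unfold cutTrees decompositionStep at h
  dsimp only at h
  split_ifs at h with hc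
  · rw [List.mem_map] at h
    obtain ⟨S, hS, rfl⟩ := h
    simp only [Finset.mem_toList, Finset.mem_filter] at hS
    exact Or.inr ⟨S, hS.1, rfl⟩
  · exact Or.inl h

theorem decompositionStep_of_isPrime (hp : M.IsPrime A) (F : Fin n → List ConstructionTree) :
    M.decompositionStep (A, F) = (A, F) := by
  have h : ∀ S, S ∉ M.primeDisks A := fun S hS => hp S (mem_primeDisks.1 hS).1
  rw [decompositionStep_eq, Prod.mk.injEq]
  refine ⟨Finset.Subset.antisymm cut_subset fun c hc => mem_cut.2 ⟨hc, fun S hS => ?_⟩,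
    funext fun c => cutTrees_of_forall_notMem fun S hS => ?_⟩
  · exact absurd hS (h S)
  · exact absurd hS (h S)

open scoped Classical in
/-- The map that sends each point of a disk in `P` to the first point of that disk along `m`, and
fixes all other points. -/
noncomputable def toFirst (M : Meander n) (P : Finset (Finset (Fin n))) (x : Fin n) : Fin n :=
  if h : ∃ c, ∃ S ∈ P, x ∈ S ∧ M.IsFirst S c then h.choose else x

theorem toFirst_of_forall_notMem {P : Finset (Finset (Fin n))} {x : Fin n}
    (h : ∀ S ∈ P, x ∉ S) : M.toFirst P x = x := by
  unfold toFirst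
  rw [dif_neg]
  rintro ⟨c, S, hS, hx, -⟩
  exact h S hS hx

theorem isFirst_toFirst {P : Finset (Finset (Fin n))}
    (hP : ∀ S ∈ P, ∀ T ∈ P, (S ∩ T).Nonempty → S = T) {x : Fin n} (hS : S ∈ P) (hx : x ∈ S) :
    M.IsFirst S (M.toFirst P x) := by
  have h : ∃ c, ∃ S ∈ P, x ∈ S ∧ M.IsFirst S c := by
    obtain ⟨c, hc⟩ := M.exists_isFirst ⟨x, hx⟩
    exact ⟨c, S, hS, hx, hc⟩
  unfold toFirst
  rw [dif_pos h]
  obtain ⟨T, hT, hxT, hc⟩ := h.choose_spec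
  rwa [hP S hS T hT ⟨x, Finset.mem_inter.2 ⟨hx, hxT⟩⟩]

theorem isCollapse_toFirst {P : Finset (Finset (Fin n))}
    (hP : ∀ S ∈ P, ∀ T ∈ P, (S ∩ T).Nonempty → S = T) (hd : ∀ S ∈ P, M.IsDisk A S) :
    M.IsCollapse A (M.toFirst P) := by
  intro x hx
  by_cases h : ∃ S ∈ P, x ∈ S
  · obtain ⟨S, hS, hxS⟩ := h
    have h1 := isFirst_toFirst (M := M) hP hS hxS
    exact ⟨S, hd S hS, hxS, h1.1, fun y hy => (isFirst_toFirst hP hS hy).unique h1⟩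
  · push Not at h
    refine ⟨{x}, isDisk_singleton hx, by simp, by simp [toFirst_of_forall_notMem h], ?_⟩
    intro y hy
    rw [Finset.mem_singleton.1 hy]

theorem toFirst_mem_cut
    (hP : ∀ S ∈ M.primeDisks A, ∀ T ∈ M.primeDisks A, (S ∩ T).Nonempty → S = T)
    {x : Fin n} (hx : x ∈ A) : M.toFirst (M.primeDisks A) x ∈ M.cut A := by
  by_cases h : ∃ S ∈ M.primeDisks A, x ∈ S
  · obtain ⟨S, hS, hxS⟩ := h
    have h1 := isFirst_toFirst (M := M) hP hS hxS
    refine mem_cut.2 ⟨(isDisk_of_mem_primeDisks hS).subset h1.1, fun T hT hcT => Or.inl ?_⟩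
    rwa [← hP S hS T hT ⟨_, Finset.mem_inter.2 ⟨h1.1, hcT⟩⟩]
  · push Not at h
    rw [toFirst_of_forall_notMem h]
    exact mem_cut.2 ⟨hx, fun S hS hxS => absurd hxS (h S hS)⟩

theorem isSeparable_of_cut
    (hP : ∀ S ∈ M.primeDisks A, ∀ T ∈ M.primeDisks A, (S ∩ T).Nonempty → S = T)
    (hS : ∀ S ∈ M.primeDisks A, M.IsSeparable S) (h : M.IsSeparable (M.cut A)) :
    M.IsSeparable A := by
  intro B hB hB2
  have hr := isCollapse_toFirst hP fun S hS => isDisk_of_mem_primeDisks (M := M) hS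
  by_cases h1 : ∃ S ∈ M.primeDisks A, B ⊆ S
  · obtain ⟨S, hSP, hBS⟩ := h1
    exact hS S hSP B hBS hB2
  · push Not at h1
    refine hr.isDecomposable hB (h _ ?_ ?_)
    · intro y hy
      obtain ⟨x, hx, rfl⟩ := Finset.mem_image.1 hy
      exact toFirst_mem_cut hP (hB hx)
    · by_contra hc
      have hc' : ∀ x ∈ B, ∀ y ∈ B,
          M.toFirst (M.primeDisks A) x = M.toFirst (M.primeDisks A) y := by
        intro x hx y hy
        exact Finset.card_le_one.1 (by omega) _ (Finset.mem_image_of_mem _ hx) _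
          (Finset.mem_image_of_mem _ hy)
      obtain ⟨x, hx, y, hy, hxy⟩ := Finset.one_lt_card.1 hB2
      obtain ⟨I, hI, hxI, hrI, hIr⟩ := hr x (hB hx)
      by_cases hin : ∃ S ∈ M.primeDisks A, ∃ z ∈ B, z ∈ S
      · obtain ⟨S, hSP, z, hz, hzS⟩ := hin
        obtain ⟨w, hw, hwS⟩ := Finset.not_subset.1 (h1 S hSP)
        have h2 := (isFirst_toFirst (M := M) hP hSP hzS).1
        rw [hc' z hz w hw] at h2
        by_cases hin' : ∃ T ∈ M.primeDisks A, w ∈ T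
        · obtain ⟨T, hTP, hwT⟩ := hin'
          have h3 := (isFirst_toFirst (M := M) hP hTP hwT).1
          have := hP S hSP T hTP ⟨_, Finset.mem_inter.2 ⟨h2, h3⟩⟩
          exact hwS (this ▸ hwT)
        · push Not at hin'
          rw [toFirst_of_forall_notMem hin'] at h2
          exact hwS h2
      · push Not at hin
        have h2 := hc' x hx y hy
        rw [toFirst_of_forall_notMem fun S hS => hin S hS x hx,
          toFirst_of_forall_notMem fun S hS => hin S hS y hy] at h2
        exact hxy h2

/-- Every cut removes a point, since the disks that are cut have at least three points. -/
theorem card_cut_lt (h : ¬ M.IsPrime A) : (M.cut A).card < A.card := by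
  obtain ⟨S, hS⟩ := primeDisks_nonempty h
  refine Finset.card_lt_card (cut_subset.ssubset_of_ne fun heq => ?_)
  have h2 := two_lt_card_of_mem_primeDisks hS
  obtain ⟨c, hc⟩ := M.exists_isFirst (isDisk_of_mem_primeDisks hS).1
  have hsub : ∀ x ∈ S, x = c ∨ M.IsLast S x := by
    intro x hx
    have hxc : x ∈ M.cut A := by
      rw [heq]
      exact (isDisk_of_mem_primeDisks hS).subset hx
    rcases (mem_cut.1 hxc).2 S hS hx with h | h
    · exact Or.inl (h.unique hc)
    · exact Or.inr h.2
  obtain ⟨x, y, hx, hy, hxy⟩ : ∃ x y, x ∈ S.erase c ∧ y ∈ S.erase c ∧ x ≠ y := by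
    have := Finset.card_erase_of_mem hc.1
    obtain ⟨x, hx, y, hy, hxy⟩ := Finset.one_lt_card.1 (show 1 < (S.erase c).card by omega)
    exact ⟨x, y, hx, hy, hxy⟩
  rw [Finset.mem_erase] at hx hy
  have h1 := (hsub x hx.2).resolve_left hx.1
  have h3 := (hsub y hy.2).resolve_left hy.1
  exact hxy (M.time_injective (le_antisymm (h3.2 x h1.1) (h1.2 y h3.1)))

/-- If one of the disks that are cut is not strong, then one of them is black and its tree survives
the cut: take the one with the earliest first point. A disk that is cut and contains this point in
its interior would be strong and would contain the given one. -/
theorem isStrong_of_noBlackVertex {F : Fin n → List ConstructionTree}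
    (h : ∀ c ∈ M.cut A, ∀ T ∈ M.cutTrees A F c, T.NoBlackVertex) (hS : S ∈ M.primeDisks A) :
    M.IsStrong A S := by
  by_contra hns
  obtain ⟨x, -⟩ := (isDisk_of_mem_primeDisks hS).1
  have : Nonempty (Fin n) := ⟨x⟩
  choose! f hf using fun (S : Finset (Fin n)) (h : S.Nonempty) => M.exists_isFirst h
  obtain ⟨S, ⟨hS, hns⟩, hmin⟩ := Set.exists_min_image
    {S | S ∈ M.primeDisks A ∧ ¬ M.IsStrong A S} (fun S => M.time (f S)) (Set.toFinite _)
    ⟨S, hS, hns⟩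
  have hSd := isDisk_of_mem_primeDisks hS
  have hfS := hf S hSd.1
  have hcut : f S ∈ M.cut A := by
    refine mem_cut.2 ⟨hSd.subset hfS.1, fun T hT hcT => Or.inl ?_⟩
    have hTd := isDisk_of_mem_primeDisks hT
    have hfT := hf T hTd.1
    by_cases hTst : M.IsStrong A T
    · have := eq_of_mem_primeDisks_of_inter hT hS hTst
        ⟨_, Finset.mem_inter.2 ⟨hcT, hfS.1⟩⟩
      rwa [this]
    · have h1 := hmin T ⟨hT, hTst⟩
      exact ⟨hcT, fun d hd => h1.trans (hfT.2 d hd)⟩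
  exact (noBlackVertex_treeOver.1 (h _ hcut _ (mem_cutTrees_of_isFirst hS hfS))).1
    (isBlack_of_mem_primeDisks hS hns)

/-- Separability is carried back from the final prime meander to the initial one. Every step
removes a point until a prime meander is reached, so `A.card` steps suffice. -/
theorem isSeparable_of_noBlackVertex (k : ℕ) :
    ∀ (A : Finset (Fin n)) (F : Fin n → List ConstructionTree), A.card ≤ k →
      (M.treeOver (M.decompositionStep^[k] (A, F)).1
        (M.decompositionStep^[k] (A, F)).2).NoBlackVertex →
      (∀ c ∈ A, ∀ T ∈ F c, T.NoBlackVertex) ∧ M.IsSeparable A := by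
  induction k with
  | zero =>
    intro A F hA _
    obtain rfl : A = ∅ := Finset.card_eq_zero.1 (by omega)
    refine ⟨by simp, fun B hB hB2 => ?_⟩
    rw [Finset.subset_empty.1 hB] at hB2
    simp at hB2
  | succ k ih =>
    intro A F hA h
    by_cases hp : M.IsPrime A
    · rw [Function.iterate_fixed (decompositionStep_of_isPrime hp F),
        noBlackVertex_treeOver] at h
      exact ⟨h.2, isSeparable_of_isPrime hp h.1⟩
    · rw [Function.iterate_succ_apply, decompositionStep_eq] at h
      have hlt := card_cut_lt hp
      obtain ⟨h1, h2⟩ := ih _ _ (by omega) h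
      have hst : ∀ S ∈ M.primeDisks A, M.IsStrong A S := fun S hS =>
        isStrong_of_noBlackVertex h1 hS
      have hP : ∀ S ∈ M.primeDisks A, ∀ T ∈ M.primeDisks A, (S ∩ T).Nonempty → S = T :=
        fun S hS T hT hST => eq_of_mem_primeDisks_of_inter hS hT (hst S hS) hST
      have htree : ∀ S ∈ M.primeDisks A, (M.treeOver S F).NoBlackVertex := by
        intro S hS
        obtain ⟨c, hc⟩ := M.exists_isFirst (isDisk_of_mem_primeDisks hS).1
        refine h1 c ?_ _ (mem_cutTrees_of_isFirst hS hc)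
        have := toFirst_mem_cut hP ((isDisk_of_mem_primeDisks hS).subset hc.1)
        rwa [(isFirst_toFirst hP hS hc.1).unique hc] at this
      constructor
      · intro c hc T hT
        by_cases hin : ∃ S ∈ M.primeDisks A, c ∈ S
        · obtain ⟨S, hS, hcS⟩ := hin
          exact (noBlackVertex_treeOver.1 (htree S hS)).2 c hcS T hT
        · push Not at hin
          have hcut := toFirst_mem_cut hP hc
          rw [toFirst_of_forall_notMem hin] at hcut
          refine h1 c hcut T ?_
          rwa [cutTrees_of_forall_notMem hin]
      · exact isSeparable_of_cut hP (fun S hS => isSeparable_of_isPrime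
          (mem_primeDisks.1 hS).2 (noBlackVertex_treeOver.1 (htree S hS)).1) h2

theorem IsIteratedSnake.isSeparable (h : M.IsIteratedSnake) : M.IsSeparable Finset.univ :=
  (isSeparable_of_noBlackVertex n Finset.univ (fun _ => []) (by simp) h).2

/-! ### Point sets whose proper strong disks have odd width -/

/-- All strong disks of `(M, A)` other than `A` itself have odd width. -/
def HasOddStrongDisks (M : Meander n) (A : Finset (Fin n)) : Prop :=
  ∀ S, M.IsStrong A S → S ≠ A → Odd S.card

theorem HasOddStrongDisks.of_isDisk (h : M.HasOddStrongDisks A) (hS : M.IsDisk A S) :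
    M.HasOddStrongDisks S := fun D hD hDS =>
  h D (hD.trans hDS hS) fun hDA => hDS (hD.1.subset.antisymm (hDA ▸ hS.subset))

/-- If every proper disk of `(M, S)` lies in one of two disks `X` and `Y` with at most two points
each, then `X` and `Y` are strong, so they are single points and `S` is small. -/
theorem HasOddStrongDisks.card_le_two (h : M.HasOddStrongDisks S) (hX : M.IsDisk S X)
    (hY : M.IsDisk S Y) (hdis : Disjoint X Y) (hXY : X ∪ Y = S) (hcX : X.card ≤ 2)
    (hcY : Y.card ≤ 2) (hU : ∀ U, M.IsDisk S U → U ≠ S → U ⊆ X ∨ U ⊆ Y) : S.card ≤ 2 := by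
  have hd : ∀ z, z ∈ X → z ∈ Y → False := fun z h1 h2 => Finset.disjoint_left.1 hdis h1 h2
  have hXst : M.IsStrong S X := by
    refine ⟨hX, fun T hT hov => ?_⟩
    obtain ⟨⟨x, hx⟩, ⟨y, hy⟩, ⟨z, hz⟩⟩ := hov
    simp only [Finset.mem_inter, Finset.mem_sdiff] at hx hy hz
    rcases hU T hT fun h => hy.2 (h ▸ hX.subset hy.1) with h' | h'
    · exact hz.2 (h' hz.1)
    · exact hd x hx.1 (h' hx.2)
  have hYst : M.IsStrong S Y := by
    refine ⟨hY, fun T hT hov => ?_⟩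
    obtain ⟨⟨x, hx⟩, ⟨y, hy⟩, ⟨z, hz⟩⟩ := hov
    simp only [Finset.mem_inter, Finset.mem_sdiff] at hx hy hz
    rcases hU T hT fun h => hy.2 (h ▸ hY.subset hy.1) with h' | h'
    · exact hd x (h' hx.2) hx.1
    · exact hz.2 (h' hz.1)
  obtain ⟨x, hx⟩ := hX.1
  obtain ⟨y, hy⟩ := hY.1
  have h1 := h X hXst fun h => hd y (h ▸ hY.subset hy) hy
  have h2 := h Y hYst fun h => hd x hx (h ▸ hX.subset hx)
  have h3 := Finset.card_union_le X Y
  rw [hXY] at h3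
  rw [Nat.odd_iff] at h1 h2
  omega

theorem not_isBlack_of_hasOddStrongDisks (hs : M.IsSeparable A) (h : M.HasOddStrongDisks A) :
    ¬ M.IsBlack A := by
  intro hb
  obtain ⟨hirr, hc, U, W, hU, hW, hUne, hWne, hl⟩ := isBlack_iff.1 hb
  obtain ⟨d, X, Y, hXne, hYne, hXY, hlt⟩ := hs A subset_rfl hc.le
  have hdis : Disjoint X Y := hlt.disjoint
  have hd : ∀ z, z ∈ X → z ∈ Y → False := fun z h1 h2 => Finset.disjoint_left.1 hdis h1 h2
  have hXA : X ⊆ A := hXY ▸ Finset.subset_union_left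
  have hYA : Y ⊆ A := hXY ▸ Finset.subset_union_right
  have hor : ∀ c ∈ A, c ∈ X ∨ c ∈ Y := fun c hc => Finset.mem_union.1 (hXY ▸ hc)
  have hX : M.IsDisk A X := hXY ▸ hlt.isDisk_left hXne
  have hY : M.IsDisk A Y := hXY ▸ hlt.isDisk_right hYne
  obtain ⟨x, hx⟩ := hXne
  obtain ⟨y, hy⟩ := hYne
  have hXne : X ≠ A := fun h => hd y (h ▸ hYA hy) hy
  have hYne : Y ≠ A := fun h => hd x hx (h ▸ hXA hx)
  have hsmall : ∀ V, M.IsDisk A V → V ≠ A → V.card ≤ 2 := fun V hV hVne => by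
    by_contra hVc
    exact hirr V hV ⟨not_le.1 hVc, Finset.card_lt_card (hV.subset.ssubset_of_ne hVne)⟩
  by_cases hex : ∃ V, M.IsDisk A V ∧ V ≠ A ∧ (V ∩ X).Nonempty ∧ (V ∩ Y).Nonempty
  · -- `V` links all disks inside `X` with all disks inside `Y`
    obtain ⟨V, hV, hVne, hVX, hVY⟩ := hex
    have key : ∀ U, M.IsDisk A U → U ≠ A → M.Linked A A U V := by
      have step : ∀ U W, M.IsDisk A U → U ≠ A → M.IsDisk A W → W ≠ A → (U ∩ W).Nonempty →
          M.Linked A A U W := by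
        intro U W hU hUne hW hWne hUW
        have hd := hU.inter hW hUW
        have hne : U ∩ W ≠ A := fun h =>
          hUne (hU.subset.antisymm (h.symm.subset.trans Finset.inter_subset_left))
        refine (linked_of_subset hd hU hne hUne Finset.inter_subset_left fun h =>
          hUne (hU.subset.antisymm h.2)).symm.trans
          (linked_of_subset hd hW hne hWne Finset.inter_subset_right fun h =>
          hWne (hW.subset.antisymm h.2))
      intro U hU hUne
      obtain ⟨u, hu⟩ := hU.1
      rcases hor u (hU.subset hu) with h' | h'
      · exact (step U X hU hUne hX hXne ⟨u, Finset.mem_inter.2 ⟨hu, h'⟩⟩).trans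
          (step V X hV hVne hX hXne hVX).symm
      · exact (step U Y hU hUne hY hYne ⟨u, Finset.mem_inter.2 ⟨hu, h'⟩⟩).trans
          (step V Y hV hVne hY hYne hVY).symm
    exact hl ((key U hU hUne).trans (key W hW hWne).symm)
  · have := h.card_le_two hX hY hdis hXY (hsmall X hX hXne) (hsmall Y hY hYne) (by
      intro V hV hVne
      by_contra hc
      rw [not_or, Finset.not_subset, Finset.not_subset] at hc
      obtain ⟨⟨a, ha, haX⟩, ⟨b, hb, hbY⟩⟩ := hc
      exact hex ⟨V, hV, hVne,
        ⟨b, Finset.mem_inter.2 ⟨hb, (hor b (hV.subset hb)).resolve_right hbY⟩⟩,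
        ⟨a, Finset.mem_inter.2 ⟨ha, (hor a (hV.subset ha)).resolve_left haX⟩⟩⟩)
    omega

theorem HasOddStrongDisks.isStrong (h : M.HasOddStrongDisks A) (hS : S ∈ M.primeDisks A) :
    M.IsStrong A S := by
  by_contra hns
  have hd := isDisk_of_mem_primeDisks hS
  have hc := two_lt_card_of_mem_primeDisks hS
  obtain ⟨X, Y, hX, hY, hdis, hXY, hcX, hcY, hU⟩ := exists_split_of_mem_primeDisks hS hns
  have := (h.of_isDisk hd).card_le_two
    (hX.of_subset hd.subset (hXY ▸ Finset.subset_union_left))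
    (hY.of_subset hd.subset (hXY ▸ Finset.subset_union_right)) hdis hXY hcX hcY
    fun U hUd hUne => hU U (hUd.trans hd) hUd.subset hUne
  omega

/-- A strong disk of the meander after the cut is the trace of a strong disk `D` of the meander
before the cut. All disks that are cut have odd width, so the two widths have the same parity. -/
theorem HasOddStrongDisks.cut (h : M.HasOddStrongDisks A) : M.HasOddStrongDisks (M.cut A) := by
  have hst : ∀ S ∈ M.primeDisks A, M.IsStrong A S := fun S hS => h.isStrong hS
  have hP : ∀ S ∈ M.primeDisks A, ∀ T ∈ M.primeDisks A, (S ∩ T).Nonempty → S = T :=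
    fun S hS T hT hST => eq_of_mem_primeDisks_of_inter hS hT (hst S hS) hST
  have hodd : ∀ S ∈ M.primeDisks A, Odd S.card := fun S hS => h S (hst S hS) fun he => by
    have := (simplifies_iff.1 (mem_primeDisks.1 hS).1).2.1
    rw [he] at this
    omega
  have hr := isCollapse_toFirst hP fun S hS => isDisk_of_mem_primeDisks (M := M) hS
  set r := M.toFirst (M.primeDisks A) with hrdef
  have hrcut : ∀ x ∈ A, r x ∈ M.cut A := fun x hx => toFirst_mem_cut hP hx
  have hrin : ∀ S ∈ M.primeDisks A, ∀ x ∈ S, M.IsFirst S (r x) := fun S hS x hx =>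
    isFirst_toFirst hP hS hx
  have hrout : ∀ x, (∀ S ∈ M.primeDisks A, x ∉ S) → r x = x := fun x hx =>
    toFirst_of_forall_notMem hx
  have hrfix : ∀ x ∈ M.cut A, r x = x := by
    intro x hx
    by_cases hin : ∃ S ∈ M.primeDisks A, x ∈ S
    · obtain ⟨S, hS, hxS⟩ := hin
      rcases (mem_cut.1 hx).2 S hS hxS with h1 | h1
      · exact (hrin S hS x hxS).unique h1
      · exact absurd h1.1 (Nat.not_even_iff_odd.2 (hodd S hS))
    · push Not at hin
      exact hrout x hin
  intro D' hD' hne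
  have hD'sub := hD'.1.subset
  set D := A.filter fun x => r x ∈ D' with hDdef
  have hmemD : ∀ {x}, x ∈ D ↔ x ∈ A ∧ r x ∈ D' := Finset.mem_filter
  have hD'D : D' ⊆ D := fun x hx => hmemD.2 ⟨cut_subset (hD'sub hx), by
    rwa [hrfix x (hD'sub hx)]⟩
  have hconv : ∀ {x y : Fin n}, x ∈ A → y ∈ A → r x ≠ r y → x < y → r x < r y :=
    fun hx hy hne => (hr.lt hx hy hne).1
  have hconv' : ∀ {x y : Fin n}, x ∈ A → y ∈ A → r x ≠ r y →
      M.time x < M.time y → M.time (r x) < M.time (r y) :=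
    fun hx hy hne => (hr.lt hx hy hne).2
  have hD : M.IsDisk A D := by
    refine ⟨hD'.1.1.mono hD'D, Finset.filter_subset _ _, ?_, ?_⟩ <;>
    · intro a ha b hb c hc h1 h2
      rw [hmemD] at *
      refine ⟨hc, ?_⟩
      by_cases hac : r a = r c
      · exact hac ▸ ha.2
      · by_cases hcb : r c = r b
        · exact hcb ▸ hb.2
        · first
          | exact hD'.1.2.2.1 _ ha.2 _ hb.2 _ (hrcut c hc) (hconv ha.1 hc hac h1)
              (hconv hc hb.1 hcb h2)
          | exact hD'.1.2.2.2 _ ha.2 _ hb.2 _ (hrcut c hc) (hconv' ha.1 hc hac h1)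
              (hconv' hc hb.1 hcb h2)
  have hDst : M.IsStrong A D := by
    refine ⟨hD, fun T hT hov => ?_⟩
    obtain ⟨⟨x, hx⟩, ⟨y, hy⟩, ⟨z, hz⟩⟩ := hov
    simp only [Finset.mem_inter, Finset.mem_sdiff, hmemD] at hx hy hz
    -- `T` is a union of fibres of `r`
    have hsat : ∀ v ∈ T, ∀ w ∈ A, r v = r w → w ∈ T := by
      intro v hv w hw hvw
      by_cases hin : ∃ S ∈ M.primeDisks A, w ∈ S ∧ v ∈ S
      · obtain ⟨S, hS, hwS, hvS⟩ := hin
        rcases (hst S hS).subset_or_subset hT ⟨v, Finset.mem_inter.2 ⟨hvS, hv⟩⟩ with h1 | h1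
        · exact h1 hwS
        · refine absurd ?_ hz.2
          refine ⟨hT.subset hz.1, ?_⟩
          rw [(hrin S hS z (h1 hz.1)).unique (hrin S hS x (h1 hx.2))]
          exact hx.1.2
      · push Not at hin
        by_cases hw' : ∃ S ∈ M.primeDisks A, w ∈ S
        · obtain ⟨S, hS, hwS⟩ := hw'
          refine absurd ?_ (hin S hS hwS)
          by_cases hv' : ∃ S ∈ M.primeDisks A, v ∈ S
          · obtain ⟨S', hS', hvS'⟩ := hv'
            rwa [hP S hS S' hS' ⟨r w, Finset.mem_inter.2 ⟨(hrin S hS w hwS).1,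
              hvw ▸ (hrin S' hS' v hvS').1⟩⟩]
          · push Not at hv'
            rw [← hrout v hv', hvw]
            exact (hrin S hS w hwS).1
        · push Not at hw'
          by_cases hv' : ∃ S ∈ M.primeDisks A, v ∈ S
          · obtain ⟨S, hS, hvS⟩ := hv'
            refine absurd ?_ (hw' S hS)
            rw [← hrout w hw', ← hvw]
            exact (hrin S hS v hvS).1
          · push Not at hv'
            rw [← hrout w hw', ← hvw, hrout v hv']
            exact hv
    have hrr : ∀ v ∈ A, r (r v) = r v := fun v hv => hrfix _ (hrcut v hv)
    have hrT : ∀ v ∈ T, r v ∈ T := fun v hv =>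
      hsat v hv _ (cut_subset (hrcut v (hT.subset hv))) (hrr v (hT.subset hv)).symm
    have hT' : M.IsDisk (M.cut A) (T ∩ M.cut A) := hT.inter_of_subset cut_subset
      ⟨r x, Finset.mem_inter.2 ⟨hrT x hx.2, hrcut x hx.1.1⟩⟩
    refine hD'.2 _ hT' ⟨⟨r x, ?_⟩, ⟨r y, ?_⟩, ⟨r z, ?_⟩⟩
    · exact Finset.mem_inter.2 ⟨hx.1.2, Finset.mem_inter.2 ⟨hrT x hx.2, hrcut x hx.1.1⟩⟩
    · refine Finset.mem_sdiff.2 ⟨hy.1.2, fun h' => hy.2 ?_⟩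
      exact hsat _ (Finset.mem_inter.1 h').1 y hy.1.1 (hrr y hy.1.1)
    · have hzA := hT.subset hz.1
      exact Finset.mem_sdiff.2 ⟨Finset.mem_inter.2 ⟨hrT z hz.1, hrcut z hzA⟩,
        fun h' => hz.2 ⟨hzA, h'⟩⟩
  have hDA : D ≠ A := by
    intro he
    refine hne (hD'sub.antisymm fun c hc => ?_)
    have : c ∈ D := he ▸ cut_subset hc
    rw [hmemD, hrfix c hc] at this
    exact this.2
  have hDodd := h D hDst hDA
  rw [Finset.card_eq_sum_card_fiberwise (f := r) (t := D') fun x hx => (hmemD.1 hx).2,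
    Finset.odd_sum_iff_odd_card_odd] at hDodd
  rwa [Finset.filter_true_of_mem] at hDodd
  intro c hc
  have hcA := cut_subset (hD'sub hc)
  by_cases hin : ∃ S ∈ M.primeDisks A, c ∈ S
  · obtain ⟨S, hS, hcS⟩ := hin
    have hcf : M.IsFirst S c := by
      have := hrin S hS c hcS
      rwa [hrfix c (hD'sub hc)] at this
    convert hodd S hS using 2
    ext x
    rw [Finset.mem_filter, hmemD]
    constructor
    · rintro ⟨⟨hxA, -⟩, rfl⟩
      by_cases hx' : ∃ S ∈ M.primeDisks A, x ∈ S
      · obtain ⟨S', hS', hxS'⟩ := hx'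
        rwa [hP S hS S' hS' ⟨r x, Finset.mem_inter.2 ⟨hcS, (hrin S' hS' x hxS').1⟩⟩]
      · push Not at hx'
        rwa [hrout x hx'] at hcS
    · intro hxS
      have hxc := (hrin S hS x hxS).unique hcf
      exact ⟨⟨(isDisk_of_mem_primeDisks hS).subset hxS, hxc.symm ▸ hc⟩, hxc⟩
  · push Not at hin
    have : {x ∈ D | r x = c} = {c} := by
      ext x
      rw [Finset.mem_filter, hmemD, Finset.mem_singleton]
      constructor
      · rintro ⟨-, rfl⟩
        by_contra hx
        by_cases hx' : ∃ S ∈ M.primeDisks A, x ∈ S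
        · obtain ⟨S, hS, hxS⟩ := hx'
          exact hin S hS (hrin S hS x hxS).1
        · push Not at hx'
          exact hx (hrout x hx').symm
      · rintro rfl
        rw [hrfix x (hD'sub hc)]
        exact ⟨⟨hcA, hc⟩, rfl⟩
    rw [this, Finset.card_singleton]
    exact odd_one

theorem noBlackVertex_of_hasOddStrongDisks (k : ℕ) :
    ∀ (A : Finset (Fin n)) (F : Fin n → List ConstructionTree), M.IsSeparable A →
      M.HasOddStrongDisks A → (∀ c ∈ A, ∀ T ∈ F c, T.NoBlackVertex) →
      (M.treeOver (M.decompositionStep^[k] (A, F)).1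
        (M.decompositionStep^[k] (A, F)).2).NoBlackVertex := by
  induction k with
  | zero =>
    intro A F hs ho hF
    exact noBlackVertex_treeOver.2 ⟨not_isBlack_of_hasOddStrongDisks hs ho, hF⟩
  | succ k ih =>
    intro A F hs ho hF
    rw [Function.iterate_succ_apply, decompositionStep_eq]
    refine ih _ _ (hs.mono cut_subset) ho.cut fun c hc T hT => ?_
    rcases mem_cutTrees hT with h | ⟨S, hS, rfl⟩
    · exact hF c (cut_subset hc) T h
    · have hd := isDisk_of_mem_primeDisks hS
      exact noBlackVertex_treeOver.2 ⟨not_isBlack_of_hasOddStrongDisks (hs.mono hd.subset)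
        (ho.of_isDisk hd), fun c hc => hF c (hd.subset hc)⟩

theorem isIteratedSnake_of_hasOddStrongDisks (hs : M.IsSeparable Finset.univ)
    (ho : M.HasOddStrongDisks Finset.univ) : M.IsIteratedSnake :=
  noBlackVertex_of_hasOddStrongDisks n Finset.univ (fun _ => []) hs ho (by simp)

end Meander

/-! ### Sums of blocks of odd length -/

/-- `IsBlockSum d N l` says that the list `l` is a direct sum (`d = true`) or a skew sum
(`d = false`) of `N` blocks, each of which is a single entry or a sum, in the other direction, of
an odd number `≥ 3` of such blocks. -/
inductive IsBlockSum {α : Type*} [LT α] : Bool → ℕ → List α → Prop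
  | nil (d : Bool) : IsBlockSum d 0 []
  | point {d : Bool} {N : ℕ} {x : α} {v : List α} (hlt : ∀ y ∈ v, DirLT d x y)
      (hv : IsBlockSum d N v) : IsBlockSum d (N + 1) (x :: v)
  | block {d : Bool} {N K : ℕ} {u v : List α} (hK : Odd K) (h3 : 3 ≤ K)
      (hu : IsBlockSum (!d) K u) (hlt : ∀ x ∈ u, ∀ y ∈ v, DirLT d x y)
      (hv : IsBlockSum d N v) : IsBlockSum d (N + 1) (u ++ v)

/-- The lists that occur as blocks of a sum in direction `d`. -/
def IsBlock {α : Type*} [LT α] (d : Bool) (u : List α) : Prop :=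
  (∃ x, u = [x]) ∨ ∃ K, Odd K ∧ 3 ≤ K ∧ IsBlockSum (!d) K u

namespace IsBlockSum

section

variable {α : Type*} [LT α] {d : Bool} {N K : ℕ} {l u v : List α}

theorem cons (hu : IsBlock d u) (hlt : ∀ x ∈ u, ∀ y ∈ v, DirLT d x y)
    (hv : IsBlockSum d N v) : IsBlockSum d (N + 1) (u ++ v) := by
  rcases hu with ⟨x, rfl⟩ | ⟨K, hK, h3, hu⟩
  · exact point (fun y hy => hlt x (by simp) y hy) hv
  · exact block hK h3 hu hlt hv

theorem exists_of_succ (h : IsBlockSum d (N + 1) l) :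
    ∃ u v, IsBlock d u ∧ (∀ x ∈ u, ∀ y ∈ v, DirLT d x y) ∧ IsBlockSum d N v ∧ l = u ++ v := by
  cases h with
  | @point _ _ x v hlt hv => exact ⟨[x], v, Or.inl ⟨x, rfl⟩, by simpa using hlt, hv, rfl⟩
  | @block _ _ K u v hK h3 hu hlt hv => exact ⟨u, v, Or.inr ⟨K, hK, h3, hu⟩, hlt, hv, rfl⟩

theorem eq_nil_of_zero (h : IsBlockSum d 0 l) : l = [] := by
  cases h
  rfl

theorem le_length (h : IsBlockSum d N l) : N ≤ l.length := by
  induction h with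
  | nil => simp
  | point _ _ ih => simpa using ih
  | block _ h3 _ _ _ ih1 ih2 =>
    rw [List.length_append]
    omega

theorem length_mod_two (h : IsBlockSum d N l) : l.length % 2 = N % 2 := by
  induction h with
  | nil => simp
  | point _ _ ih =>
    rw [List.length_cons]
    omega
  | block hK _ _ _ _ ih1 ih2 =>
    rw [List.length_append]
    have := Nat.odd_iff.1 hK
    omega

theorem append (hu : IsBlockSum d N u) (hv : IsBlockSum d K v)
    (hlt : ∀ x ∈ u, ∀ y ∈ v, DirLT d x y) : IsBlockSum d (N + K) (u ++ v) := by
  induction hu with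
  | nil => simpa using hv
  | @point d N x u hxu hu ih =>
    rw [Nat.add_right_comm, List.cons_append]
    refine point (fun y hy => ?_) (ih hv fun x hx y hy => hlt x (by simp [hx]) y hy)
    rcases List.mem_append.1 hy with hy | hy
    · exact hxu y hy
    · exact hlt x (by simp) y hy
  | @block d N K' u u' hK h3 hu hlt' hu' ih1 ih2 =>
    rw [Nat.add_right_comm, List.append_assoc]
    refine block hK h3 hu (fun x hx y hy => ?_)
      (ih2 hv fun x hx y hy => hlt x (by simp [hx]) y hy)
    rcases List.mem_append.1 hy with hy | hy
    · exact hlt' x hx y hy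
    · exact hlt x (by simp [hx]) y hy

/-- A sum of an odd number of blocks is a sum of blocks in either direction. -/
theorem exists_of_odd (h : IsBlockSum d N l) (hN : Odd N) (d' : Bool) :
    ∃ K, IsBlockSum d' K l := by
  by_cases hd : d' = d
  · exact ⟨N, hd ▸ h⟩
  · have hd : d = !d' := by cases d <;> cases d' <;> simp_all
    rcases Nat.lt_or_ge N 3 with h3 | h3
    · obtain rfl : N = 1 := by
        rw [Nat.odd_iff] at hN
        omega
      obtain ⟨u, v, hu, -, hv, rfl⟩ := h.exists_of_succ
      rw [hv.eq_nil_of_zero, List.append_nil]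
      rcases hu with ⟨x, rfl⟩ | ⟨K, hK, h3, hu⟩
      · exact ⟨1, point (by simp) (nil d')⟩
      · refine ⟨K, ?_⟩
        rwa [hd, Bool.not_not] at hu
    · refine ⟨1, ?_⟩
      have := block (v := []) hN h3 (hd ▸ h) (by simp) (nil d')
      rwa [List.append_nil] at this

theorem map {β : Type*} [LT β] {f : α → β} {e : Bool → Bool} (he : ∀ d, e (!d) = !(e d))
    (h : IsBlockSum d N l)
    (hf : ∀ x ∈ l, ∀ y ∈ l, ∀ d, DirLT d x y → DirLT (e d) (f x) (f y)) :
    IsBlockSum (e d) N (l.map f) := by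
  induction h with
  | nil => exact nil _
  | @point d N x v hlt hv ih =>
    refine point (fun y hy => ?_) (ih fun x hx y hy => hf x (by simp [hx]) y (by simp [hy]))
    obtain ⟨z, hz, rfl⟩ := List.mem_map.1 hy
    exact hf x (by simp) z (by simp [hz]) d (hlt z hz)
  | @block d N K' u v hK h3 hu hlt hv ih1 ih2 =>
    rw [List.map_append]
    refine block hK h3 (he d ▸ ih1 fun x hx y hy => hf x (by simp [hx]) y (by simp [hy]))
      (fun x hx y hy => ?_) (ih2 fun x hx y hy => hf x (by simp [hx]) y (by simp [hy]))
    obtain ⟨z, hz, rfl⟩ := List.mem_map.1 hy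
    obtain ⟨w, hw, rfl⟩ := List.mem_map.1 hx
    exact hf w (by simp [hw]) z (by simp [hz]) d (hlt w hw z hz)

theorem map_of_lt {β : Type*} [LT β] {f : α → β} (h : IsBlockSum d N l)
    (hf : ∀ x ∈ l, ∀ y ∈ l, x < y → f x < f y) : IsBlockSum d N (l.map f) := by
  refine h.map (e := id) (fun _ => rfl) fun x hx y hy d hxy => ?_
  cases d
  · exact hf y hy x hx hxy
  · exact hf x hx y hy hxy

/-- An order reversing map exchanges direct sums and skew sums. -/
theorem map_of_gt {β : Type*} [LT β] {f : α → β} (h : IsBlockSum d N l)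
    (hf : ∀ x ∈ l, ∀ y ∈ l, x < y → f y < f x) : IsBlockSum (!d) N (l.map f) := by
  refine h.map (e := not) (fun _ => rfl) fun x hx y hy d hxy => ?_
  cases d
  · exact hf y hy x hx hxy
  · exact hf x hx y hy hxy

theorem ne_nil_of_isBlock (hu : IsBlock d u) : u ≠ [] := by
  rcases hu with ⟨x, rfl⟩ | ⟨K, hK, h3, hu⟩
  · simp
  · intro h
    have := hu.le_length
    rw [h, List.length_nil] at this
    omega

theorem odd_length_of_isBlock (hu : IsBlock d u) : Odd u.length := by
  rcases hu with ⟨x, rfl⟩ | ⟨K, hK, h3, hu⟩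
  · exact odd_one
  · rw [Nat.odd_iff, hu.length_mod_two, ← Nat.odd_iff]
    exact hK

theorem exists_split (h : IsBlockSum d N l) (hN : 2 ≤ N) :
    ∃ u v, u ≠ [] ∧ v ≠ [] ∧ (∀ x ∈ u, ∀ y ∈ v, DirLT d x y) ∧ l = u ++ v := by
  obtain ⟨N, rfl⟩ := Nat.exists_eq_add_of_le hN
  rw [Nat.add_comm] at h
  obtain ⟨u, v, hu, hlt, hv, rfl⟩ := h.exists_of_succ
  refine ⟨u, v, ne_nil_of_isBlock hu, fun h => ?_, hlt, rfl⟩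
  have := hv.le_length
  rw [h, List.length_nil] at this
  omega

theorem dirLT_head_getLast (h : IsBlockSum d N l) (hN : 2 ≤ N) (hl : l ≠ []) :
    DirLT d (l.head hl) (l.getLast hl) := by
  obtain ⟨u, v, hu, hv, hlt, rfl⟩ := h.exists_split hN
  rw [List.head_append_of_ne_nil hu, List.getLast_append_of_ne_nil _ hv]
  exact hlt _ (List.head_mem hu) _ (List.getLast_mem hv)

end

end IsBlockSum

namespace Meander

variable {n : ℕ} {M : Meander n} {A S T U V W X Y B C D : Finset (Fin n)}

/-! ### Sums of odd blocks have odd strong disks -/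

theorem isSeparable_of_card_le_one (h : A.card ≤ 1) : M.IsSeparable A := fun B hB hB2 => by
  have := Finset.card_le_card hB
  omega

theorem Precedes.isSeparable {d : Bool} (h : M.Precedes d C D) (hC : M.IsSeparable C)
    (hD : M.IsSeparable D) : M.IsSeparable (C ∪ D) := by
  intro B hB hB2
  by_cases h1 : B ⊆ C
  · exact hC B h1 hB2
  by_cases h2 : B ⊆ D
  · exact hD B h2 hB2
  obtain ⟨x, hxB, hxC⟩ := Finset.not_subset.1 h1
  obtain ⟨y, hyB, hyD⟩ := Finset.not_subset.1 h2
  refine ⟨d, B ∩ C, B ∩ D, ⟨y, ?_⟩, ⟨x, ?_⟩, ?_, ?_⟩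
  · exact Finset.mem_inter.2 ⟨hyB, (Finset.mem_union.1 (hB hyB)).resolve_right hyD⟩
  · exact Finset.mem_inter.2 ⟨hxB, (Finset.mem_union.1 (hB hxB)).resolve_left hxC⟩
  · rw [← Finset.inter_union_distrib_left, Finset.inter_eq_left.2 hB]
  · exact fun x hx y hy => h x (Finset.mem_inter.1 hx).2 y (Finset.mem_inter.1 hy).2

/-- A strong disk of a sum lies in one of the summands. -/
theorem Precedes.hasOddStrongDisks {d : Bool} (h : M.Precedes d C D) (hCne : C.Nonempty)
    (hDne : D.Nonempty) (hC : M.HasOddStrongDisks C) (hD : M.HasOddStrongDisks D)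
    (hCodd : Odd C.card) (hDodd : M.IsStrong (C ∪ D) D → Odd D.card) :
    M.HasOddStrongDisks (C ∪ D) := by
  intro S hS hne
  have hCd := h.isDisk_left hCne
  have hDd := h.isDisk_right hDne
  obtain ⟨s, hs⟩ := hS.1.1
  have key : S ⊆ C ∨ S ⊆ D := by
    by_contra hc
    rw [not_or, Finset.not_subset, Finset.not_subset] at hc
    obtain ⟨⟨x, hx, hxC⟩, ⟨y, hy, hyD⟩⟩ := hc
    have hxD := (Finset.mem_union.1 (hS.1.subset hx)).resolve_left hxC
    have hyC := (Finset.mem_union.1 (hS.1.subset hy)).resolve_right hyD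
    have h1 := (hS.subset_or_subset hCd ⟨y, Finset.mem_inter.2 ⟨hy, hyC⟩⟩).resolve_left
      fun h => hxC (h hx)
    have h2 := (hS.subset_or_subset hDd ⟨x, Finset.mem_inter.2 ⟨hx, hxD⟩⟩).resolve_left
      fun h => hyD (h hy)
    exact hne (hS.1.subset.antisymm (Finset.union_subset h1 h2))
  rcases key with h1 | h1
  · by_cases he : S = C
    · exact he ▸ hCodd
    · exact hC S (hS.of_subset hCd h1) he
  · by_cases he : S = D
    · subst he
      exact hDodd hS
    · exact hD S (hS.of_subset hDd h1) he

theorem hasOddStrongDisks_singleton (x : Fin n) : M.HasOddStrongDisks {x} := by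
  intro S hS hne
  exact absurd ((Finset.subset_singleton_iff.1 hS.1.subset).resolve_left hS.1.1.ne_empty) hne

theorem precedes_toFinset {d : Bool} {u v : List (Fin n)}
    (ht : (u ++ v).Pairwise fun x y => M.time x < M.time y)
    (hlt : ∀ x ∈ u, ∀ y ∈ v, DirLT d x y) : M.Precedes d u.toFinset v.toFinset := by
  intro x hx y hy
  rw [List.mem_toFinset] at hx hy
  exact ⟨(List.pairwise_append.1 ht).2.2 x hx y hy, hlt x hx y hy⟩

theorem card_toFinset_of_pairwise {u : List (Fin n)}
    (ht : u.Pairwise fun x y => M.time x < M.time y) : u.toFinset.card = u.length := by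
  refine List.toFinset_card_of_nodup (ht.imp fun h he => ?_)
  rw [he] at h
  exact lt_irrefl _ h

theorem isSeparable_and_hasOddStrongDisks_of_isBlockSum {d : Bool} {N : ℕ} {l : List (Fin n)}
    (h : IsBlockSum d N l) (ht : l.Pairwise fun x y => M.time x < M.time y) :
    M.IsSeparable l.toFinset ∧ M.HasOddStrongDisks l.toFinset := by
  -- the last part of a sum of at least three blocks is overlapped by the first part
  have key : ∀ {d : Bool} {N : ℕ} {u v : List (Fin n)}, IsBlock d u → IsBlockSum d N v →
      (u ++ v).Pairwise (fun x y => M.time x < M.time y) →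
      (∀ x ∈ u, ∀ y ∈ v, DirLT d x y) →
      M.IsSeparable u.toFinset ∧ M.HasOddStrongDisks u.toFinset →
      M.IsSeparable v.toFinset ∧ M.HasOddStrongDisks v.toFinset →
      M.IsSeparable (u ++ v).toFinset ∧ M.HasOddStrongDisks (u ++ v).toFinset := by
    intro d N u v hu hv ht hlt h1 h2
    have hpre := precedes_toFinset (M := M) ht hlt
    obtain ⟨hut, hvt, huvt⟩ := List.pairwise_append.1 ht
    have hune := IsBlockSum.ne_nil_of_isBlock hu
    rw [List.toFinset_append]
    refine ⟨hpre.isSeparable h1.1 h2.1, ?_⟩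
    by_cases hvne : v = []
    · subst hvne
      simpa using h1.2
    refine hpre.hasOddStrongDisks (List.toFinset_nonempty_iff u |>.2 hune)
      (List.toFinset_nonempty_iff v |>.2 hvne) h1.2 h2.2 ?_ fun hst => ?_
    · rw [card_toFinset_of_pairwise hut]
      exact IsBlockSum.odd_length_of_isBlock hu
    · rw [card_toFinset_of_pairwise hvt]
      rcases Nat.lt_or_ge N 2 with hN | hN
      · have h0 : N ≠ 0 := fun h0 => hvne (by
          subst h0
          exact hv.eq_nil_of_zero)
        have := hv.length_mod_two
        rw [Nat.odd_iff]
        omega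
      · exfalso
        obtain ⟨p, q, hp, hq, hpq, rfl⟩ := hv.exists_split hN
        rw [← List.append_assoc] at ht
        have hpre' := precedes_toFinset (M := M) (u := u ++ p) (v := q) (d := d) ht (by
          intro x hx y hy
          rcases List.mem_append.1 hx with hx | hx
          · exact hlt x hx y (by simp [hy])
          · exact hpq x hx y hy)
        have hd := hpre'.isDisk_left (List.toFinset_nonempty_iff _ |>.2 (by simp [hp]))
        rw [← List.toFinset_append, List.append_assoc, List.toFinset_append] at hd
        obtain ⟨x, hx⟩ := List.exists_mem_of_ne_nil u hune
        obtain ⟨y, hy⟩ := List.exists_mem_of_ne_nil p hp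
        obtain ⟨z, hz⟩ := List.exists_mem_of_ne_nil q hq
        have hzp : z ∉ (u ++ p).toFinset := fun h =>
          lt_irrefl _ (hpre' z h z (List.mem_toFinset.2 hz)).1
        have hxv : x ∉ (p ++ q) := fun h => lt_irrefl _ (huvt x hx x h)
        refine hst.2 _ hd ⟨⟨y, ?_⟩, ⟨z, ?_⟩, ⟨x, ?_⟩⟩
        · simp [hy]
        · rw [Finset.mem_sdiff]
          exact ⟨by simp [hz], hzp⟩
        · rw [Finset.mem_sdiff, List.mem_toFinset, List.mem_toFinset]
          exact ⟨by simp [hx], hxv⟩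
  induction h with
  | nil => exact ⟨isSeparable_of_card_le_one (by simp), fun S hS _ => by
      have := hS.1.subset
      rw [List.toFinset_nil, Finset.subset_empty] at this
      exact absurd this hS.1.1.ne_empty⟩
  | @point d N x v hlt hv ih =>
    refine key (u := [x]) (Or.inl ⟨x, rfl⟩) hv ht (by simpa using hlt)
      ⟨isSeparable_of_card_le_one (by simp), ?_⟩ (ih (List.pairwise_cons.1 ht).2)
    simpa using hasOddStrongDisks_singleton x
  | @block d N K u v hK h3 hu hlt hv ih1 ih2 =>
    obtain ⟨hut, hvt, -⟩ := List.pairwise_append.1 ht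
    exact key (Or.inr ⟨K, hK, h3, hu⟩) hv ht hlt (ih1 hut) (ih2 hvt)

end Meander

/-! ### Systems of arcs without crossings -/

/-- The entry `i` of a list of integers. -/
def entry (l : List ℤ) (i : ℕ) : ℤ := l.getD i 0

theorem entry_append_left {u v : List ℤ} {i : ℕ} (h : i < u.length) :
    entry (u ++ v) i = entry u i := List.getD_append u v 0 i h

theorem entry_append_right {u v : List ℤ} (i : ℕ) :
    entry (u ++ v) (u.length + i) = entry v i := by
  unfold entry
  rw [List.getD_append_right u v 0 _ (Nat.le_add_right _ _), Nat.add_sub_cancel_left]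

theorem entry_mem {l : List ℤ} {i : ℕ} (h : i < l.length) : entry l i ∈ l := by
  unfold entry
  rw [List.getD_eq_getElem l 0 h]
  exact List.getElem_mem h

theorem entry_ne {l : List ℤ} (hl : l.Nodup) {i j : ℕ} (hi : i < l.length) (hj : j < l.length)
    (h : i ≠ j) : entry l i ≠ entry l j := by
  unfold entry
  rw [List.getD_eq_getElem l 0 hi, List.getD_eq_getElem l 0 hj]
  exact fun he => h ((hl.getElem_inj_iff).1 he)

/-- A curve visits the points of `l` on a line in the given order, along arcs that lie alternately
on the two sides of the line, and comes from and goes to infinity: arcs on the same side are not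
linked, and no arc separates the first or last point from infinity on the side where the curve
enters or leaves. -/
structure IsArcSystem (l : List ℤ) : Prop where
  inner : ∀ i j, i + 1 < l.length → j + 1 < l.length → i % 2 = j % 2 →
    ¬ ArcsLinked (entry l i) (entry l (i + 1)) (entry l j) (entry l (j + 1))
  first : ∀ i, i + 1 < l.length → i % 2 = 1 →
    ¬ (min (entry l i) (entry l (i + 1)) < entry l 0 ∧
      entry l 0 < max (entry l i) (entry l (i + 1)))
  last : ∀ i, i + 1 < l.length → (i + 1) % 2 = l.length % 2 →
    ¬ (min (entry l i) (entry l (i + 1)) < entry l (l.length - 1) ∧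
      entry l (l.length - 1) < max (entry l i) (entry l (i + 1)))

section

variable {u v : List ℤ} {d : Bool}

theorem IsArcSystem.left (h : IsArcSystem (u ++ v)) (hv : v ≠ [])
    (hlt : ∀ x ∈ u, ∀ y ∈ v, DirLT d x y) : IsArcSystem u := by
  have hvl := List.length_pos_iff.2 hv
  have hlen : (u ++ v).length = u.length + v.length := List.length_append
  constructor
  · intro i j hi hj hij
    have := h.inner i j (by omega) (by omega) hij
    rwa [entry_append_left (by omega), entry_append_left (by omega),
      entry_append_left (by omega), entry_append_left (by omega)] at this
  · intro i hi h1
    have := h.first i (by omega) h1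
    rwa [entry_append_left (by omega), entry_append_left (by omega),
      entry_append_left (by omega)] at this
  · intro i hi h1
    -- the arc from `u` to `v` leaves `u` on the side of the `i`-th arc
    have h2 := h.inner i (u.length - 1) (by omega) (by omega) (by omega)
    have h3 := h.inner (u.length - 1) i (by omega) (by omega) (by omega)
    have h4 := entry_append_right (u := u) (v := v) 0
    rw [show u.length - 1 + 1 = u.length + 0 by omega, h4,
      entry_append_left (by omega), entry_append_left (by omega),
      entry_append_left (by omega)] at h2 h3
    have h5 := hlt _ (entry_mem (l := u) (i := i) (by omega)) _ (entry_mem (l := v) hvl)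
    have h6 := hlt _ (entry_mem (l := u) (i := i + 1) (by omega)) _ (entry_mem (l := v) hvl)
    have h7 := hlt _ (entry_mem (l := u) (i := u.length - 1) (by omega)) _
      (entry_mem (l := v) hvl)
    unfold ArcsLinked at h2 h3
    cases d
    · change entry v 0 < _ at h5 h6 h7
      omega
    · change _ < entry v 0 at h5 h6 h7
      omega

theorem IsArcSystem.right (h : IsArcSystem (u ++ v)) (hu : u ≠ [])
    (hlt : ∀ x ∈ u, ∀ y ∈ v, DirLT d x y) : IsArcSystem v := by
  have hul := List.length_pos_iff.2 hu
  have hlen : (u ++ v).length = u.length + v.length := List.length_append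
  have hr := fun i => entry_append_right (u := u) (v := v) i
  constructor
  · intro i j hi hj hij
    have := h.inner (u.length + i) (u.length + j) (by omega) (by omega) (by omega)
    rwa [Nat.add_assoc, Nat.add_assoc, hr, hr, hr, hr] at this
  · intro i hi h1
    have h2 := h.inner (u.length + i) (u.length - 1) (by omega) (by omega) (by omega)
    have h3 := h.inner (u.length - 1) (u.length + i) (by omega) (by omega) (by omega)
    rw [show u.length - 1 + 1 = u.length + 0 by omega, Nat.add_assoc, hr, hr, hr,
      entry_append_left (by omega)] at h2 h3
    have hl := entry_mem (l := u) (i := u.length - 1) (by omega)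
    have h5 := hlt _ hl _ (entry_mem (l := v) (i := i) (by omega))
    have h6 := hlt _ hl _ (entry_mem (l := v) (i := i + 1) (by omega))
    have h7 := hlt _ hl _ (entry_mem (l := v) (i := 0) (by omega))
    unfold ArcsLinked at h2 h3
    cases d
    · change _ < entry u (u.length - 1) at h5 h6 h7
      omega
    · change entry u (u.length - 1) < _ at h5 h6 h7
      omega
  · intro i hi h1
    have := h.last (u.length + i) (by omega) (by omega)
    rwa [Nat.add_assoc, hr, hr, show (u ++ v).length - 1 = u.length + (v.length - 1) by omega,
      hr] at this

/-- If the first part has even length, the arc that leaves it lies on the side where the curve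
enters it. -/
theorem IsArcSystem.dirLT_left (h : IsArcSystem (u ++ v)) (hv : v ≠ []) (hn : (u ++ v).Nodup)
    (hlt : ∀ x ∈ u, ∀ y ∈ v, DirLT d x y) (hu : 2 ≤ u.length) (he : u.length % 2 = 0) :
    DirLT d (entry u 0) (entry u (u.length - 1)) := by
  have hvl := List.length_pos_iff.2 hv
  have hlen : (u ++ v).length = u.length + v.length := List.length_append
  have h1 := h.first (u.length - 1) (by omega) (by omega)
  rw [show u.length - 1 + 1 = u.length + 0 by omega, entry_append_right,
    entry_append_left (by omega), entry_append_left (by omega)] at h1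
  have h2 := entry_ne (List.nodup_append.1 hn).1 (i := 0) (j := u.length - 1)
    (by omega) (by omega) (by omega)
  have h3 := hlt _ (entry_mem (l := u) (i := 0) (by omega)) _ (entry_mem (l := v) hvl)
  cases d
  · change entry v 0 < _ at h3
    change entry u (u.length - 1) < _
    omega
  · change _ < entry v 0 at h3
    change _ < entry u (u.length - 1)
    omega

theorem IsArcSystem.dirLT_right (h : IsArcSystem (u ++ v)) (hu : u ≠ []) (hn : (u ++ v).Nodup)
    (hlt : ∀ x ∈ u, ∀ y ∈ v, DirLT d x y) (hv : 2 ≤ v.length) (he : v.length % 2 = 0) :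
    DirLT d (entry v 0) (entry v (v.length - 1)) := by
  have hul := List.length_pos_iff.2 hu
  have hlen : (u ++ v).length = u.length + v.length := List.length_append
  have h1 := h.last (u.length - 1) (by omega) (by omega)
  rw [show u.length - 1 + 1 = u.length + 0 by omega, entry_append_right,
    entry_append_left (by omega),
    show (u ++ v).length - 1 = u.length + (v.length - 1) by omega, entry_append_right] at h1
  have h2 := entry_ne (List.nodup_append.1 hn).2.1 (i := 0) (j := v.length - 1)
    (by omega) (by omega) (by omega)
  have h3 := hlt _ (entry_mem (l := u) (i := u.length - 1) (by omega)) _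
    (entry_mem (l := v) (i := v.length - 1) (by omega))
  cases d
  · change _ < entry u (u.length - 1) at h3
    change entry v (v.length - 1) < _
    omega
  · change entry u (u.length - 1) < _ at h3
    change _ < entry v (v.length - 1)
    omega

theorem IsArcSystem.append (hu : IsArcSystem u) (hv : IsArcSystem v)
    (hlt : ∀ x ∈ u, ∀ y ∈ v, DirLT d x y) (ho : u.length % 2 = 1)
    (he : v.length % 2 = 0 → v ≠ [] → DirLT d (entry v 0) (entry v (v.length - 1))) :
    IsArcSystem (u ++ v) := by
  by_cases hvne : v = []
  · subst hvne
    rwa [List.append_nil]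
  have hvl := List.length_pos_iff.2 hvne
  have hlen : (u ++ v).length = u.length + v.length := List.length_append
  have hr := fun i => entry_append_right (u := u) (v := v) i
  have hl : ∀ {i}, i < u.length → entry (u ++ v) i = entry u i := entry_append_left
  have hc : ∀ i j, i < u.length → j < v.length → DirLT d (entry u i) (entry v j) :=
    fun i j hi hj => hlt _ (entry_mem hi) _ (entry_mem hj)
  have hcases : ∀ i, i + 1 < (u ++ v).length →
      i + 1 < u.length ∨ i = u.length - 1 ∨ ∃ k, i = u.length + k ∧ k + 1 < v.length := by
    intro i hi
    rcases Nat.lt_or_ge (i + 1) u.length with h1 | h1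
    · exact Or.inl h1
    · rcases Nat.lt_or_ge i u.length with h2 | h2
      · exact Or.inr (Or.inl (by omega))
      · exact Or.inr (Or.inr ⟨i - u.length, by omega, by omega⟩)
  have hcr : u.length - 1 + 1 = u.length + 0 := by omega
  constructor
  · intro i j hi hj hij
    rcases hcases i hi with h1 | rfl | ⟨i, rfl, h1⟩ <;>
      rcases hcases j hj with h2 | rfl | ⟨j, rfl, h2⟩
    · rw [hl (by omega), hl (by omega), hl (by omega), hl (by omega)]
      exact hu.inner i j h1 h2 hij
    · rw [hcr, hr, hl (by omega), hl (by omega), hl (by omega)]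
      have h3 := hu.last i h1 (by omega)
      have h4 := hc i 0 (by omega) (by omega)
      have h5 := hc (i + 1) 0 (by omega) (by omega)
      have h6 := hc (u.length - 1) 0 (by omega) (by omega)
      unfold ArcsLinked
      cases d <;> simp only [DirLT, if_true, Bool.false_eq_true, if_false] at h4 h5 h6 <;> omega
    · rw [hl (by omega), hl (by omega), Nat.add_assoc, hr, hr]
      have h3 := hc i j (by omega) (by omega)
      have h4 := hc i (j + 1) (by omega) (by omega)
      have h5 := hc (i + 1) j (by omega) (by omega)
      have h6 := hc (i + 1) (j + 1) (by omega) (by omega)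
      unfold ArcsLinked
      cases d <;> simp only [DirLT, if_true, Bool.false_eq_true, if_false] at h3 h4 h5 h6 <;>
        omega
    · rw [hcr, hr, hl (by omega), hl (by omega), hl (by omega)]
      have h3 := hu.last j h2 (by omega)
      have h4 := hc j 0 (by omega) (by omega)
      have h5 := hc (j + 1) 0 (by omega) (by omega)
      have h6 := hc (u.length - 1) 0 (by omega) (by omega)
      unfold ArcsLinked
      cases d <;> simp only [DirLT, if_true, Bool.false_eq_true, if_false] at h4 h5 h6 <;> omega
    · unfold ArcsLinked
      omega
    · rw [hcr, hr, hl (by omega), Nat.add_assoc, hr, hr]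
      have h3 := hv.first j h2 (by omega)
      have h4 := hc (u.length - 1) 0 (by omega) (by omega)
      have h5 := hc (u.length - 1) j (by omega) (by omega)
      have h6 := hc (u.length - 1) (j + 1) (by omega) (by omega)
      unfold ArcsLinked
      cases d <;> simp only [DirLT, if_true, Bool.false_eq_true, if_false] at h4 h5 h6 <;> omega
    · rw [Nat.add_assoc, hr, hr, hl (by omega), hl (by omega)]
      have h3 := hc j i (by omega) (by omega)
      have h4 := hc j (i + 1) (by omega) (by omega)
      have h5 := hc (j + 1) i (by omega) (by omega)
      have h6 := hc (j + 1) (i + 1) (by omega) (by omega)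
      unfold ArcsLinked
      cases d <;> simp only [DirLT, if_true, Bool.false_eq_true, if_false] at h3 h4 h5 h6 <;>
        omega
    · rw [hcr, hr, Nat.add_assoc, hr, hr, hl (by omega)]
      have h3 := hv.first i h1 (by omega)
      have h4 := hc (u.length - 1) 0 (by omega) (by omega)
      have h5 := hc (u.length - 1) i (by omega) (by omega)
      have h6 := hc (u.length - 1) (i + 1) (by omega) (by omega)
      unfold ArcsLinked
      cases d <;> simp only [DirLT, if_true, Bool.false_eq_true, if_false] at h4 h5 h6 <;> omega
    · rw [Nat.add_assoc, Nat.add_assoc, hr, hr, hr, hr]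
      exact hv.inner i j h1 h2 (by omega)
  · intro i hi hi1
    rcases hcases i hi with h1 | rfl | ⟨i, rfl, h1⟩
    · rw [hl (by omega), hl (by omega), hl (by omega)]
      exact hu.first i h1 hi1
    · omega
    · rw [Nat.add_assoc, hr, hr, hl (by omega)]
      have h3 := hc 0 i (by omega) (by omega)
      have h4 := hc 0 (i + 1) (by omega) (by omega)
      cases d <;> simp only [DirLT, if_true, Bool.false_eq_true, if_false] at h3 h4 <;> omega
  · intro i hi hi1
    rw [show (u ++ v).length - 1 = u.length + (v.length - 1) by omega, hr]
    rcases hcases i hi with h1 | rfl | ⟨i, rfl, h1⟩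
    · rw [hl (by omega), hl (by omega)]
      have h3 := hc i (v.length - 1) (by omega) (by omega)
      have h4 := hc (i + 1) (v.length - 1) (by omega) (by omega)
      cases d <;> simp only [DirLT, if_true, Bool.false_eq_true, if_false] at h3 h4 <;> omega
    · rw [hcr, hr, hl (by omega)]
      have h3 := hc (u.length - 1) (v.length - 1) (by omega) (by omega)
      have h4 := hc (u.length - 1) 0 (by omega) (by omega)
      have h5 := he (by omega) hvne
      cases d <;> simp only [DirLT, if_true, Bool.false_eq_true, if_false] at h3 h4 h5 <;> omega
    · rw [Nat.add_assoc, hr, hr]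
      exact hv.last i h1 (by omega)

end

theorem isArcSystem_of_length_le_one {l : List ℤ} (h : l.length ≤ 1) : IsArcSystem l :=
  ⟨fun _ _ _ _ => by omega, fun _ _ => by omega, fun _ _ => by omega⟩

theorem entry_zero {l : List ℤ} (hl : l ≠ []) : entry l 0 = l.head hl := by
  unfold entry
  rw [List.getD_eq_getElem l 0 (List.length_pos_iff.2 hl), List.head_eq_getElem]

theorem entry_length_sub_one {l : List ℤ} (hl : l ≠ []) :
    entry l (l.length - 1) = l.getLast hl := by
  unfold entry
  have := List.length_pos_iff.2 hl
  rw [List.getD_eq_getElem l 0 (by omega), List.getLast_eq_getElem]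

theorem IsBlockSum.dirLT_entry {d : Bool} {N : ℕ} {l : List ℤ} (h : IsBlockSum d N l)
    (hN : 2 ≤ N) : DirLT d (entry l 0) (entry l (l.length - 1)) := by
  have hl : l ≠ [] := fun hl => by
    have := h.le_length
    rw [hl, List.length_nil] at this
    omega
  rw [entry_zero hl, entry_length_sub_one hl]
  exact h.dirLT_head_getLast hN hl

theorem IsBlockSum.isArcSystem {d : Bool} {N : ℕ} {l : List ℤ} (h : IsBlockSum d N l) :
    IsArcSystem l := by
  have key : ∀ {d : Bool} {N : ℕ} {v : List ℤ}, IsBlockSum d N v → v.length % 2 = 0 → v ≠ [] →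
      DirLT d (entry v 0) (entry v (v.length - 1)) := by
    intro d N v hv he hne
    refine hv.dirLT_entry ?_
    have h1 := hv.length_mod_two
    have h2 : N ≠ 0 := fun h0 => hne (by subst h0; exact hv.eq_nil_of_zero)
    omega
  induction h with
  | nil => exact isArcSystem_of_length_le_one (by simp)
  | @point d N x v hlt hv ih =>
    exact IsArcSystem.append (u := [x]) (isArcSystem_of_length_le_one (by simp)) ih
      (by simpa using hlt) (by simp) (key hv)
  | @block d N K u v hK h3 hu hlt hv ih1 ih2 =>
    refine IsArcSystem.append ih1 ih2 hlt ?_ (key hv)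
    rw [hu.length_mod_two, ← Nat.odd_iff]
    exact hK

namespace Meander

variable {n : ℕ} {M : Meander n} {A S T U V W X Y B C D : Finset (Fin n)}

theorem eq_filter_append_filter {α : Type*} {R : α → α → Prop} {p : α → Bool} {l : List α}
    (hl : l.Pairwise R) (h : ∀ x ∈ l, ∀ y ∈ l, R x y → p y → p x) :
    l = l.filter p ++ l.filter (fun x => !p x) := by
  induction l with
  | nil => rfl
  | cons x l ih =>
    rw [List.pairwise_cons] at hl
    have ih := ih hl.2 fun a ha b hb => h a (by simp [ha]) b (by simp [hb])
    by_cases hx : p x = true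
    · rw [List.filter_cons_of_pos hx, List.filter_cons_of_neg (by simp [hx]), List.cons_append,
        ← ih]
    · have h1 : l.filter p = [] := by
        rw [List.filter_eq_nil_iff]
        exact fun y hy hpy => hx (h x (by simp) y (by simp [hy]) (hl.1 y hy) hpy)
      rw [h1, List.nil_append] at ih
      rw [List.filter_cons_of_neg hx, h1, List.filter_cons_of_pos (by simp [hx]), ← ih,
        List.nil_append]

theorem IsDecomposable.exists_append {l : List (Fin n)}
    (ht : l.Pairwise fun x y => M.time x < M.time y) (h : M.IsDecomposable l.toFinset) :
    ∃ (d : Bool) (u v : List (Fin n)), u ≠ [] ∧ v ≠ [] ∧ l = u ++ v ∧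
      ∀ x ∈ u, ∀ y ∈ v, DirLT d x y := by
  obtain ⟨d, C, D, ⟨c, hc⟩, ⟨e, he⟩, hCD, hlt⟩ := h
  have hor : ∀ x ∈ l, x ∈ C ∨ x ∈ D := fun x hx =>
    Finset.mem_union.1 (hCD ▸ List.mem_toFinset.2 hx)
  have hl := eq_filter_append_filter (p := fun x => decide (x ∈ C)) ht (by
    intro x hx y hy hxy hyC
    rw [decide_eq_true_iff] at hyC ⊢
    exact (hor x hx).resolve_right fun hxD => lt_asymm hxy (hlt y hyC x hxD).1)
  have hcl : c ∈ l := List.mem_toFinset.1 (hCD ▸ Finset.mem_union_left D hc)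
  have hel : e ∈ l := List.mem_toFinset.1 (hCD ▸ Finset.mem_union_right C he)
  have heC : e ∉ C := fun h => lt_irrefl _ (hlt e h e he).1
  refine ⟨d, _, _, List.ne_nil_of_mem (a := c) ?_, List.ne_nil_of_mem (a := e) ?_, hl, ?_⟩
  · exact List.mem_filter.2 ⟨hcl, by simpa using hc⟩
  · exact List.mem_filter.2 ⟨hel, by simpa using heC⟩
  · intro x hx y hy
    rw [List.mem_filter] at hx hy
    simp only [decide_eq_true_eq, Bool.not_eq_true', decide_eq_false_iff_not] at hx hy
    exact (hlt x hx.2 y ((hor y hy.1).resolve_left hy.2)).2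

/-- The labels of the points of a list as integers. -/
def labels (l : List (Fin n)) : List ℤ := l.map fun x : Fin n => ((x : ℕ) : ℤ)

theorem isBlockSum_labels {d : Bool} {N : ℕ} {l : List (Fin n)} (h : IsBlockSum d N l) :
    IsBlockSum d N (labels l) :=
  h.map_of_lt fun x _ y _ hxy => by exact_mod_cast hxy

/-- In a decomposition of a separable arc system into two parts, a part of even length is itself
decomposed in the same direction, and a part of odd length can be decomposed in both. -/
theorem exists_isBlockSum (m : ℕ) : ∀ l : List (Fin n), l.length ≤ m →
    l.Pairwise (fun x y => M.time x < M.time y) → M.IsSeparable l.toFinset →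
    IsArcSystem (labels l) → ∃ d N, IsBlockSum d N l := by
  induction m with
  | zero =>
    intro l hl _ _ _
    rw [List.length_eq_zero_iff.1 (by omega : l.length = 0)]
    exact ⟨true, 0, .nil _⟩
  | succ m ih =>
    intro l hl ht hs ha
    rcases Nat.lt_or_ge l.length 2 with h2 | h2
    · rcases l with _ | ⟨x, _ | ⟨y, l⟩⟩
      · exact ⟨true, 0, .nil _⟩
      · exact ⟨true, 1, .point (by simp) (.nil _)⟩
      · simp at h2
    · obtain ⟨d, u, v, hu, hv, rfl, hlt⟩ := (hs _ subset_rfl (by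
        rwa [card_toFinset_of_pairwise ht])).exists_append ht
      have hul := List.length_pos_iff.2 hu
      have hvl := List.length_pos_iff.2 hv
      rw [List.length_append] at hl
      have hnod : (labels (u ++ v)).Nodup := by
        refine List.Nodup.map (fun x y hxy => ?_) (ht.imp fun h he => ?_)
        · exact Fin.ext (by exact_mod_cast hxy)
        · rw [he] at h
          exact lt_irrefl _ h
      have hlab : labels (u ++ v) = labels u ++ labels v := List.map_append
      rw [hlab] at ha hnod
      have hlt' : ∀ x ∈ labels u, ∀ y ∈ labels v, DirLT d x y := by
        intro x hx y hy
        obtain ⟨a, ha, rfl⟩ := List.mem_map.1 hx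
        obtain ⟨b, hb, rfl⟩ := List.mem_map.1 hy
        have := hlt a ha b hb
        cases d
        · exact Int.ofNat_lt.2 this
        · exact Int.ofNat_lt.2 this
      have hlu : (labels u).length = u.length := List.length_map _
      have hlv : (labels v).length = v.length := List.length_map _
      have hu' : labels u ≠ [] := List.length_pos_iff.1 (by omega)
      have hv' : labels v ≠ [] := List.length_pos_iff.1 (by omega)
      obtain ⟨hut, hvt, -⟩ := List.pairwise_append.1 ht
      rw [List.toFinset_append] at hs
      obtain ⟨d₁, N₁, h₁⟩ := ih u (by omega) hut (hs.mono Finset.subset_union_left)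
        (ha.left hv' hlt')
      obtain ⟨d₂, N₂, h₂⟩ := ih v (by omega) hvt (hs.mono Finset.subset_union_right)
        (ha.right hu' hlt')
      have key : ∀ {w : List (Fin n)} {d' N}, w ≠ [] → IsBlockSum d' N w →
          ((labels w).length % 2 = 0 → 2 ≤ (labels w).length →
            DirLT d (entry (labels w) 0) (entry (labels w) ((labels w).length - 1))) →
          ∃ K, IsBlockSum d K w := by
        intro w d' N hw h hd
        have hlw : (labels w).length = w.length := List.length_map _
        have hpos := List.length_pos_iff.2 hw
        have hmod := h.length_mod_two
        rcases Nat.even_or_odd N with hN | hN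
        · rw [Nat.even_iff] at hN
          have hN0 : N ≠ 0 := fun h0 => hw (by subst h0; exact h.eq_nil_of_zero)
          have h1 := hd (by omega) (by omega)
          have h2 := (isBlockSum_labels h).dirLT_entry (by omega)
          by_cases hdd : d' = d
          · exact ⟨N, hdd ▸ h⟩
          · have : d' = !d := by cases d <;> cases d' <;> simp_all
            exact absurd (this ▸ h2) h1.not_dirLT_not
        · exact h.exists_of_odd hN d
      obtain ⟨K₁, hK₁⟩ := key hu h₁ fun he h2 => ha.dirLT_left hv' hnod hlt' h2 he
      obtain ⟨K₂, hK₂⟩ := key hv h₂ fun he h2 => ha.dirLT_right hu' hnod hlt' h2 he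
      exact ⟨d, _, hK₁.append hK₂ hlt⟩

/-! ### The list of a permutation -/

/-- The values of a permutation in the order of the arguments. -/
def word (σ : Equiv.Perm (Fin n)) : List (Fin n) := List.ofFn σ

theorem visit_succ (σ : Equiv.Perm (Fin n)) {i : ℕ} (hi : i < n) :
    visit σ (i + 1) = entry (labels (word σ)) i := by
  unfold visit entry labels word
  rw [if_neg (by omega), dif_pos (by simpa using hi),
    List.getD_eq_getElem _ _ (by simpa using hi)]
  simp

theorem visit_last (σ : Equiv.Perm (Fin n)) : visit σ (n + 1) = n := by
  unfold visit
  simp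

theorem visit_bounds (σ : Equiv.Perm (Fin n)) {i : ℕ} (hi : i < n) :
    0 ≤ visit σ (i + 1) ∧ visit σ (i + 1) < n := by
  unfold visit
  rw [if_neg (by omega), dif_pos (by simpa using hi)]
  have := (σ ⟨i + 1 - 1, by simpa using hi⟩).2
  omega

theorem length_labels_word (σ : Equiv.Perm (Fin n)) : (labels (word σ)).length = n := by
  unfold labels word
  simp

/-- The arcs from `p₁` and to `p₃` play the role of the arcs from and to infinity. -/
theorem isArcSystem_word (M : Meander n) : IsArcSystem (labels (word M.perm)) := by
  have hlen := length_labels_word M.perm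
  constructor
  · intro i j hi hj hij
    rw [hlen] at hi hj
    have := M.noncrossing (i + 1) (j + 1) (by omega) (by omega) (by omega)
    rwa [visit_succ _ (by omega), visit_succ _ (by omega), visit_succ _ (by omega),
      visit_succ _ (by omega)] at this
  · intro i hi h1
    rw [hlen] at hi
    have h2 := M.noncrossing 0 (i + 1) (by omega) (by omega) (by omega)
    have h3 := M.noncrossing (i + 1) 0 (by omega) (by omega) (by omega)
    have h4 := visit_bounds M.perm (i := i) (by omega)
    have h5 := visit_bounds M.perm (i := i + 1) (by omega)
    have h6 := visit_bounds M.perm (i := 0) (by omega)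
    have h0 : visit M.perm 0 = -1 := rfl
    rw [← visit_succ _ (by omega), ← visit_succ _ (by omega), ← visit_succ _ (by omega)]
    unfold ArcsLinked at h2 h3
    rw [h0] at h2 h3
    omega
  · intro i hi h1
    rw [hlen] at hi h1
    have h2 := M.noncrossing n (i + 1) (by omega) (by omega) (by omega)
    have h3 := M.noncrossing (i + 1) n (by omega) (by omega) (by omega)
    have h4 := visit_bounds M.perm (i := i) (by omega)
    have h5 := visit_bounds M.perm (i := i + 1) (by omega)
    have h6 := visit_bounds M.perm (i := n - 1) (by omega)
    rw [hlen, ← visit_succ _ (by omega), ← visit_succ _ (by omega), ← visit_succ _ (by omega)]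
    rw [show n - 1 + 1 = n by omega] at *
    unfold ArcsLinked at h2 h3
    rw [visit_last] at h2 h3
    omega

/-- In a meander of even order, `m` arrives and leaves on the same side of `l`. -/
theorem entry_zero_le_of_even (M : Meander n) (hn : 2 ≤ n) (he : n % 2 = 0) :
    entry (labels (word M.perm)) 0 ≤ entry (labels (word M.perm)) (n - 1) := by
  have h1 := M.noncrossing 0 n (by omega) (by omega) (by omega)
  have h2 := visit_bounds M.perm (i := 0) (by omega)
  have h3 := visit_bounds M.perm (i := n - 1) (by omega)
  have h0 : visit M.perm 0 = -1 := rfl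
  rw [← visit_succ _ (by omega), ← visit_succ _ (by omega)]
  rw [show n - 1 + 1 = n by omega] at *
  unfold ArcsLinked at h1
  rw [visit_last, h0] at h1
  omega

theorem noncrossing_of_isArcSystem {σ : Equiv.Perm (Fin n)} (hn : 2 ≤ n)
    (ha : IsArcSystem (labels (word σ)))
    (he : n % 2 = 0 → entry (labels (word σ)) 0 ≤ entry (labels (word σ)) (n - 1)) (i j : ℕ)
    (hi : i ≤ n) (hj : j ≤ n) (hij : i % 2 = j % 2) :
    ¬ ArcsLinked (visit σ i) (visit σ (i + 1)) (visit σ j) (visit σ (j + 1)) := by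
  have hlen := length_labels_word σ
  have h0 : visit σ 0 = -1 := rfl
  have hl : visit σ (n + 1) = n := visit_last σ
  have hb0 := visit_bounds σ (i := 0) (by omega)
  have hbn := visit_bounds σ (i := n - 1) (by omega)
  have hinner : ∀ i j, i + 1 < n → j + 1 < n → i % 2 = j % 2 →
      ¬ ArcsLinked (visit σ (i + 1)) (visit σ (i + 1 + 1)) (visit σ (j + 1))
        (visit σ (j + 1 + 1)) := by
    intro i j hi hj hij
    rw [visit_succ _ (by omega), visit_succ _ (by omega), visit_succ _ (by omega),
      visit_succ _ (by omega)]
    exact ha.inner i j (by omega) (by omega) hij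
  have hfirst : ∀ i, i + 1 < n → i % 2 = 1 →
      ¬ (min (visit σ (i + 1)) (visit σ (i + 1 + 1)) < visit σ (0 + 1) ∧
        visit σ (0 + 1) < max (visit σ (i + 1)) (visit σ (i + 1 + 1))) := by
    intro i hi h1
    rw [visit_succ _ (by omega), visit_succ _ (by omega), visit_succ _ (by omega)]
    exact ha.first i (by omega) h1
  have hlast : ∀ i, i + 1 < n → (i + 1) % 2 = n % 2 →
      ¬ (min (visit σ (i + 1)) (visit σ (i + 1 + 1)) < visit σ (n - 1 + 1) ∧
        visit σ (n - 1 + 1) < max (visit σ (i + 1)) (visit σ (i + 1 + 1))) := by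
    intro i hi h1
    rw [visit_succ _ (by omega), visit_succ _ (by omega), visit_succ _ (by omega)]
    have := ha.last i (by omega) (by omega)
    rwa [hlen] at this
  have he' : n % 2 = 0 → visit σ (0 + 1) ≤ visit σ (n - 1 + 1) := by
    rw [visit_succ _ (by omega), visit_succ _ (by omega)]
    exact he
  rw [show n - 1 + 1 = n by omega] at *
  rw [Nat.zero_add] at *
  have hbd : ∀ i, i + 1 < n → 0 ≤ visit σ (i + 1) ∧ visit σ (i + 1) < n ∧
      0 ≤ visit σ (i + 1 + 1) ∧ visit σ (i + 1 + 1) < n := fun i hi =>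
    ⟨(visit_bounds σ (by omega)).1, (visit_bounds σ (by omega)).2,
      (visit_bounds σ hi).1, (visit_bounds σ hi).2⟩
  have hcases : ∀ i ≤ n, i = 0 ∨ i = n ∨ ∃ k, i = k + 1 ∧ k + 1 < n := by
    intro i hi
    rcases Nat.eq_zero_or_pos i with h | h
    · exact Or.inl h
    · rcases Nat.lt_or_ge i n with h' | h'
      · exact Or.inr (Or.inr ⟨i - 1, by omega, by omega⟩)
      · exact Or.inr (Or.inl (by omega))
  rcases hcases i hi with rfl | rfl | ⟨i, rfl, h1⟩ <;>
    rcases hcases j hj with rfl | rfl | ⟨j, rfl, h2⟩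
  · unfold ArcsLinked
    omega
  · have := he' (by omega)
    unfold ArcsLinked
    rw [h0, hl, Nat.zero_add]
    omega
  · have h3 := hfirst j h2 (by omega)
    have h4 := hbd j h2
    unfold ArcsLinked
    rw [h0, Nat.zero_add]
    omega
  · have := he' (by omega)
    unfold ArcsLinked
    rw [h0, hl, Nat.zero_add]
    omega
  · unfold ArcsLinked
    omega
  · have h3 := hlast j h2 (by omega)
    have h4 := hbd j h2
    unfold ArcsLinked
    rw [hl]
    omega
  · have h3 := hfirst i h1 (by omega)
    have h4 := hbd i h1
    unfold ArcsLinked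
    rw [h0, Nat.zero_add]
    omega
  · have h3 := hlast i h1 (by omega)
    have h4 := hbd i h1
    unfold ArcsLinked
    rw [hl]
    omega
  · exact hinner i j h1 h2 (by omega)

end Meander

/-! ### Counting sums of blocks -/

namespace IsBlockSum

section

variable {α : Type*} [Preorder α] {d : Bool} {N K : ℕ} {l u v u' v' : List α}

/-- A block is not a sum in its own direction. -/
theorem not_split_of_isBlock (h : IsBlock d (u ++ v)) (hu : u ≠ []) (hv : v ≠ [])
    (hlt : ∀ x ∈ u, ∀ y ∈ v, DirLT d x y) : False := by
  rcases h with ⟨x, hx⟩ | ⟨K, -, h3, h⟩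
  · have h1 := List.length_pos_iff.2 hu
    have h2 := List.length_pos_iff.2 hv
    have h3 := congrArg List.length hx
    rw [List.length_append, List.length_singleton] at h3
    omega
  · have h1 := h.dirLT_head_getLast (by omega) (by simp [hu])
    rw [List.head_append_of_ne_nil hu, List.getLast_append_of_ne_nil _ hv] at h1
    exact (hlt _ (List.head_mem hu) _ (List.getLast_mem hv)).not_dirLT_not h1

/-- The first block of a sum is uniquely determined. -/
theorem block_unique (hu : IsBlock d u) (hu' : IsBlock d u')
    (hlt : ∀ x ∈ u, ∀ y ∈ v, DirLT d x y) (hlt' : ∀ x ∈ u', ∀ y ∈ v', DirLT d x y)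
    (h : u ++ v = u' ++ v') : u = u' ∧ v = v' := by
  rcases List.append_eq_append_iff.1 h with ⟨p, rfl, rfl⟩ | ⟨p, rfl, rfl⟩
  · by_cases hp : p = []
    · simp [hp]
    · exact (not_split_of_isBlock hu' (ne_nil_of_isBlock hu) hp fun x hx y hy =>
        hlt x hx y (by simp [hy])).elim
  · by_cases hp : p = []
    · simp [hp]
    · exact (not_split_of_isBlock hu (ne_nil_of_isBlock hu') hp fun x hx y hy =>
        hlt' x hx y (by simp [hy])).elim

theorem number_unique {N : ℕ} : ∀ {K : ℕ} {l : List α}, IsBlockSum d N l → IsBlockSum d K l →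
    N = K := by
  have h0 : ∀ {K : ℕ}, IsBlockSum d K ([] : List α) → K = 0 := fun h => by
    simpa using h.le_length
  induction N with
  | zero =>
    intro K l h h'
    rw [h.eq_nil_of_zero] at h'
    exact (h0 h').symm
  | succ N ih =>
    intro K l h h'
    rcases K with _ | K
    · rw [h'.eq_nil_of_zero] at h
      exact h0 h
    · obtain ⟨u, v, hu, hlt, hv, rfl⟩ := h.exists_of_succ
      obtain ⟨u', v', hu', hlt', hv', he⟩ := h'.exists_of_succ
      obtain ⟨rfl, rfl⟩ := block_unique hu hu' hlt hlt' he
      rw [ih hv hv']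

theorem not_isBlockSum_not (h : IsBlockSum d N l) (h' : IsBlockSum (!d) K l) (hN : 2 ≤ N)
    (hK : 2 ≤ K) : False := by
  have hl : l ≠ [] := fun hl => by
    have := h.le_length
    rw [hl, List.length_nil] at this
    omega
  exact (h.dirLT_head_getLast hN hl).not_dirLT_not (h'.dirLT_head_getLast hK hl)

end

end IsBlockSum

open scoped Classical in
/-- The arrangements of `0, …, n - 1` that are sums of `N` blocks in direction `d`. -/
noncomputable def blockSums (d : Bool) (N n : ℕ) : Finset (List ℕ) :=
  (List.range n).permutations.toFinset.filter (IsBlockSum d N)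

open scoped Classical in
/-- The arrangements of `0, …, n - 1` that are blocks of direct sums. -/
noncomputable def blocks (n : ℕ) : Finset (List ℕ) :=
  (List.range n).permutations.toFinset.filter (IsBlock true)

open scoped Classical in
/-- The arrangements of `0, …, n - 1` that are sums of at least two blocks in direction `d`. -/
noncomputable def properSums (d : Bool) (n : ℕ) : Finset (List ℕ) :=
  (List.range n).permutations.toFinset.filter fun l => ∃ N, 2 ≤ N ∧ IsBlockSum d N l

theorem mem_blockSums {d : Bool} {N n : ℕ} {l : List ℕ} :
    l ∈ blockSums d N n ↔ l.Perm (List.range n) ∧ IsBlockSum d N l := by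
  classical
  unfold blockSums
  rw [Finset.mem_filter, List.mem_toFinset, List.mem_permutations]

theorem mem_blocks {n : ℕ} {l : List ℕ} :
    l ∈ blocks n ↔ l.Perm (List.range n) ∧ IsBlock true l := by
  classical
  unfold blocks
  rw [Finset.mem_filter, List.mem_toFinset, List.mem_permutations]

theorem mem_properSums {d : Bool} {n : ℕ} {l : List ℕ} :
    l ∈ properSums d n ↔ l.Perm (List.range n) ∧ ∃ N, 2 ≤ N ∧ IsBlockSum d N l := by
  classical
  unfold properSums
  rw [Finset.mem_filter, List.mem_toFinset, List.mem_permutations]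

theorem length_of_perm_range {l : List ℕ} {n : ℕ} (h : l.Perm (List.range n)) : l.length = n := by
  rw [h.length_eq, List.length_range]

theorem perm_range_of_nodup {l : List ℕ} {n : ℕ} (h : l.Nodup) (hm : ∀ x, x ∈ l ↔ x < n) :
    l.Perm (List.range n) :=
  (List.perm_ext_iff_of_nodup h List.nodup_range).2 fun x => by rw [hm, List.mem_range]

theorem card_blockSums_zero (d : Bool) (n : ℕ) :
    (blockSums d 0 n).card = if n = 0 then 1 else 0 := by
  split_ifs with h
  · subst h
    rw [Finset.card_eq_one]
    refine ⟨[], Finset.ext fun l => ?_⟩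
    rw [mem_blockSums, Finset.mem_singleton]
    refine ⟨fun h => h.2.eq_nil_of_zero, ?_⟩
    rintro rfl
    exact ⟨by simp, .nil d⟩
  · rw [Finset.card_eq_zero, Finset.eq_empty_iff_forall_notMem]
    intro l hl
    rw [mem_blockSums] at hl
    have := length_of_perm_range hl.1
    rw [hl.2.eq_nil_of_zero, List.length_nil] at this
    exact h this.symm

/-- In an arrangement of `0, …, n - 1` the first summand of a direct sum consists of the smallest
numbers. -/
theorem perm_range_of_append {u w : List ℕ} {n : ℕ} (h : (u ++ w).Perm (List.range n))
    (hlt : ∀ x ∈ u, ∀ y ∈ w, x < y) :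
    u.Perm (List.range u.length) ∧ ∀ y ∈ w, u.length ≤ y := by
  have hnd : (u ++ w).Nodup := h.nodup_iff.2 List.nodup_range
  have hmem : ∀ x, x ∈ u ∨ x ∈ w ↔ x < n := fun x => by
    rw [← List.mem_append, h.mem_iff, List.mem_range]
  obtain ⟨hu, -, -⟩ := List.nodup_append.1 hnd
  have hsub : ∀ x ∈ u, x < u.length := by
    intro x hx
    by_contra hc
    have h1 : Finset.range (x + 1) ⊆ u.toFinset := by
      intro y hy
      rw [Finset.mem_range] at hy
      rw [List.mem_toFinset]
      have := (hmem x).1 (Or.inl hx)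
      refine ((hmem y).2 (by omega)).resolve_right fun hyw => ?_
      have := hlt x hx y hyw
      omega
    have h2 := Finset.card_le_card h1
    rw [Finset.card_range, List.toFinset_card_of_nodup hu] at h2
    omega
  have heq : u.toFinset = Finset.range u.length := by
    refine Finset.eq_of_subset_of_card_le (fun x hx => ?_) ?_
    · exact Finset.mem_range.2 (hsub x (List.mem_toFinset.1 hx))
    · rw [Finset.card_range, List.toFinset_card_of_nodup hu]
  have hiff : ∀ x, x ∈ u ↔ x < u.length := fun x => by
    rw [← List.mem_toFinset, heq, Finset.mem_range]
  refine ⟨perm_range_of_nodup hu hiff, fun y hy => ?_⟩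
  by_contra hc
  exact lt_irrefl _ (hlt y ((hiff y).2 (not_le.1 hc)) y hy)

theorem dirLT_append_map {u v : List ℕ} {b : ℕ} (hu : u.Perm (List.range b)) :
    ∀ x ∈ u, ∀ y ∈ v.map (b + ·), DirLT true x y := by
  intro x hx y hy
  obtain ⟨z, -, rfl⟩ := List.mem_map.1 hy
  have := List.mem_range.1 (hu.mem_iff.1 hx)
  change x < b + z
  omega

theorem card_blockSums_succ (N n : ℕ) :
    (blockSums true (N + 1) n).card =
      ∑ p ∈ Finset.HasAntidiagonal.antidiagonal n,
        (blocks p.1).card * (blockSums true N p.2).card := by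
  simp_rw [← Finset.card_product]
  rw [← Finset.card_sigma]
  symm
  refine Finset.card_bij (fun x _ => x.2.1 ++ x.2.2.map (x.1.1 + ·)) ?_ ?_ ?_
  · rintro ⟨⟨b, m⟩, u, v⟩ h
    rw [Finset.mem_sigma, Finset.mem_product, Finset.HasAntidiagonal.mem_antidiagonal, mem_blocks,
      mem_blockSums] at h
    obtain ⟨rfl, ⟨hu, hub⟩, hv, hvb⟩ := h
    dsimp only at hu hub hv hvb ⊢
    rw [mem_blockSums]
    constructor
    · rw [List.range_add]
      exact hu.append (hv.map _)
    · refine IsBlockSum.cons hub (dirLT_append_map hu) (hvb.map_of_lt fun x _ y _ hxy => ?_)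
      omega
  · rintro ⟨⟨b, m⟩, u, v⟩ h ⟨⟨b', m'⟩, u', v'⟩ h' he
    rw [Finset.mem_sigma, Finset.mem_product, Finset.HasAntidiagonal.mem_antidiagonal, mem_blocks,
      mem_blockSums] at h h'
    obtain ⟨hb, ⟨hu, hub⟩, hv, hvb⟩ := h
    obtain ⟨hb', ⟨hu', hub'⟩, hv', hvb'⟩ := h'
    dsimp only at hb hb' hu hub hv hvb hu' hub' hv' hvb' he
    obtain ⟨rfl, h2⟩ := IsBlockSum.block_unique hub hub' (dirLT_append_map hu)
      (dirLT_append_map hu') he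
    obtain rfl : b = b' := (length_of_perm_range hu).symm.trans (length_of_perm_range hu')
    obtain rfl : m = m' := by omega
    rw [List.map_injective_iff.2 (add_right_injective b) h2]
  · intro l hl
    rw [mem_blockSums] at hl
    obtain ⟨hl, hb⟩ := hl
    obtain ⟨u, w, hu, hlt, hw, rfl⟩ := hb.exists_of_succ
    obtain ⟨h1, h2⟩ := perm_range_of_append hl hlt
    have hlen := length_of_perm_range hl
    rw [List.length_append] at hlen
    have hnd : (u ++ w).Nodup := hl.nodup_iff.2 List.nodup_range
    obtain ⟨-, hwn, hdis⟩ := List.nodup_append.1 hnd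
    have hmap : (w.map (· - u.length)).map (u.length + ·) = w := by
      rw [List.map_map]
      refine (List.map_congr_left fun x hx => ?_).trans (List.map_id w)
      have := h2 x hx
      change u.length + (x - u.length) = x
      omega
    refine ⟨⟨(u.length, w.length), u, w.map (· - u.length)⟩, ?_, ?_⟩
    · rw [Finset.mem_sigma, Finset.mem_product, Finset.HasAntidiagonal.mem_antidiagonal, mem_blocks,
        mem_blockSums]
      refine ⟨hlen, ⟨h1, hu⟩, perm_range_of_nodup ?_ fun x => ?_, hw.map_of_lt ?_⟩
      · refine List.Nodup.of_map (u.length + ·) ?_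
        rw [hmap]
        exact hwn
      · have hx : x ∈ w.map (· - u.length) ↔ u.length + x ∈ w := by
          conv_rhs => rw [← hmap]
          exact (List.mem_map_of_injective (add_right_injective u.length)).symm
        rw [hx]
        have hiff := (hl.mem_iff (a := u.length + x))
        rw [List.mem_append, List.mem_range] at hiff
        have hxu : u.length + x ∉ u := fun h => by
          have := List.mem_range.1 (h1.mem_iff.1 h)
          omega
        dsimp only
        constructor
        · intro h
          have := hiff.1 (Or.inr h)
          omega
        · intro h
          exact (hiff.2 (by omega)).resolve_left hxu
      · intro x hx y hy hxy
        have := h2 x hx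
        omega
    · exact congrArg (u ++ ·) hmap

theorem le_and_mod_two_of_mem_blockSums {d : Bool} {N n : ℕ} {l : List ℕ}
    (h : l ∈ blockSums d N n) : N ≤ n ∧ N % 2 = n % 2 := by
  rw [mem_blockSums] at h
  have h1 := h.2.le_length
  have h2 := h.2.length_mod_two
  rw [length_of_perm_range h.1] at h1 h2
  exact ⟨h1, h2.symm⟩

theorem card_properSums (d : Bool) (n : ℕ) :
    (properSums d n).card =
      ∑ r ∈ Finset.Icc 1 (n / 2), (blockSums d (2 * r + n % 2) n).card := by
  have h1 : properSums d n = (Finset.Icc 1 (n / 2)).biUnion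
      fun r => blockSums d (2 * r + n % 2) n := by
    ext l
    rw [Finset.mem_biUnion, mem_properSums]
    constructor
    · rintro ⟨hl, N, hN, hs⟩
      have hm := mem_blockSums.2 ⟨hl, hs⟩
      obtain ⟨hle, hmod⟩ := le_and_mod_two_of_mem_blockSums hm
      refine ⟨N / 2, by rw [Finset.mem_Icc]; omega, ?_⟩
      rwa [← hmod, Nat.div_add_mod]
    · rintro ⟨r, hr, hm⟩
      rw [Finset.mem_Icc] at hr
      exact ⟨(mem_blockSums.1 hm).1, _, by omega, (mem_blockSums.1 hm).2⟩
  rw [h1, Finset.card_biUnion]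
  intro r _ r' _ hne
  refine Finset.disjoint_left.2 fun l hl hl' => hne ?_
  have := (mem_blockSums.1 hl).2.number_unique (mem_blockSums.1 hl').2
  omega

/-- Complementation exchanges direct and skew sums. -/
theorem card_properSums_not (d : Bool) (n : ℕ) :
    (properSums (!d) n).card = (properSums d n).card := by
  have hinv : ∀ l : List ℕ, l.Perm (List.range n) →
      (l.map (n - 1 - ·)).map (n - 1 - ·) = l := by
    intro l hl
    rw [List.map_map]
    refine (List.map_congr_left fun x hx => ?_).trans (List.map_id l)
    have := List.mem_range.1 (hl.mem_iff.1 hx)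
    change n - 1 - (n - 1 - x) = x
    omega
  have hmem : ∀ d l, l ∈ properSums d n → l.map (n - 1 - ·) ∈ properSums (!d) n := by
    intro d l hl
    rw [mem_properSums] at hl ⊢
    obtain ⟨hl, N, hN, hs⟩ := hl
    have hnd : l.Nodup := hl.nodup_iff.2 List.nodup_range
    refine ⟨perm_range_of_nodup (List.Nodup.of_map (n - 1 - ·) ?_) fun x => ?_, N, hN,
      hs.map_of_gt fun x hx y hy hxy => ?_⟩
    · rwa [hinv l hl]
    · rw [List.mem_map]
      constructor
      · rintro ⟨y, hy, rfl⟩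
        have := List.mem_range.1 (hl.mem_iff.1 hy)
        omega
      · intro hx
        exact ⟨n - 1 - x, hl.mem_iff.2 (List.mem_range.2 (by omega)), by omega⟩
    · have := List.mem_range.1 (hl.mem_iff.1 hy)
      omega
  refine Finset.card_nbij' (fun l => l.map (n - 1 - ·)) (fun l => l.map (n - 1 - ·)) ?_ ?_ ?_ ?_
  · intro l hl
    have := hmem _ l hl
    rwa [Bool.not_not] at this
  · intro l hl
    exact hmem _ l hl
  · intro l hl
    exact hinv l (mem_properSums.1 hl).1
  · intro l hl
    exact hinv l (mem_properSums.1 hl).1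

theorem card_blocks_one : (blocks 1).card = 1 := by
  rw [Finset.card_eq_one]
  refine ⟨[0], Finset.ext fun l => ?_⟩
  rw [mem_blocks, Finset.mem_singleton]
  constructor
  · exact fun h => List.perm_singleton.1 h.1
  · rintro rfl
    exact ⟨List.Perm.refl _, Or.inl ⟨0, rfl⟩⟩

theorem card_blocks_of_even {n : ℕ} (h : n % 2 = 0) : (blocks n).card = 0 := by
  rw [Finset.card_eq_zero, Finset.eq_empty_iff_forall_notMem]
  intro l hl
  rw [mem_blocks] at hl
  have := IsBlockSum.odd_length_of_isBlock hl.2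
  rw [length_of_perm_range hl.1, Nat.odd_iff] at this
  omega

theorem card_blocks_of_odd {n : ℕ} (h : n % 2 = 1) (h3 : 3 ≤ n) :
    (blocks n).card = (properSums true n).card := by
  rw [← card_properSums_not]
  congr 1
  ext l
  rw [mem_blocks, mem_properSums]
  refine and_congr_right fun hl => ?_
  have hlen := length_of_perm_range hl
  constructor
  · rintro (⟨x, rfl⟩ | ⟨K, hK, hK3, hs⟩)
    · rw [List.length_singleton] at hlen
      omega
    · exact ⟨K, by omega, hs⟩
  · rintro ⟨N, hN, hs⟩
    have hmod := hs.length_mod_two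
    exact Or.inr ⟨N, Nat.odd_iff.2 (by omega), by omega, hs⟩

namespace Meander

variable {n : ℕ}

/-! ### Iterated snakes as sums of blocks -/

theorem time_perm (M : Meander n) (i : Fin n) : M.time (M.perm i) = i :=
  M.perm.symm_apply_apply i

theorem pairwise_word (M : Meander n) :
    (word M.perm).Pairwise fun x y => M.time x < M.time y := by
  unfold word
  rw [List.pairwise_ofFn]
  intro i j hij
  rwa [time_perm, time_perm]

theorem toFinset_word (σ : Equiv.Perm (Fin n)) : (word σ).toFinset = Finset.univ := by
  ext x
  simp only [List.mem_toFinset, Finset.mem_univ, iff_true]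
  unfold word
  rw [List.mem_ofFn]
  exact ⟨σ.symm x, σ.apply_symm_apply x⟩

theorem isIteratedSnake_iff (M : Meander n) :
    M.IsIteratedSnake ↔ ∃ d N, IsBlockSum d N (word M.perm) := by
  constructor
  · intro h
    exact exists_isBlockSum _ _ le_rfl M.pairwise_word (by
      rw [toFinset_word]
      exact h.isSeparable) M.isArcSystem_word
  · rintro ⟨d, N, h⟩
    have := isSeparable_and_hasOddStrongDisks_of_isBlockSum h M.pairwise_word
    rw [toFinset_word] at this
    exact isIteratedSnake_of_hasOddStrongDisks this.1 this.2

/-- The word of a permutation as a list of natural numbers. -/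
def natWord (σ : Equiv.Perm (Fin n)) : List ℕ := (word σ).map Fin.val

theorem length_natWord (σ : Equiv.Perm (Fin n)) : (natWord σ).length = n := by
  simp [natWord, word]

theorem natWord_perm (σ : Equiv.Perm (Fin n)) : (natWord σ).Perm (List.range n) := by
  have hnd : (word σ).Nodup := List.nodup_ofFn.2 σ.injective
  refine perm_range_of_nodup (hnd.map Fin.val_injective) fun x => ?_
  unfold natWord
  rw [List.mem_map]
  constructor
  · rintro ⟨y, -, rfl⟩
    exact y.2
  · intro hx
    refine ⟨⟨x, hx⟩, ?_, rfl⟩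
    rw [← List.mem_toFinset, toFinset_word]
    exact Finset.mem_univ _

theorem natWord_injective : Function.Injective (natWord (n := n)) := by
  intro σ τ h
  have h1 : word σ = word τ := List.map_injective_iff.2 Fin.val_injective h
  exact DFunLike.coe_injective (List.ofFn_injective h1)

theorem exists_natWord_eq {l : List ℕ} (hl : l.Perm (List.range n)) :
    ∃ σ : Equiv.Perm (Fin n), natWord σ = l := by
  have hlen := length_of_perm_range hl
  have hnd : l.Nodup := hl.nodup_iff.2 List.nodup_range
  have hlt : ∀ i : Fin n, l[(i : ℕ)]'(by omega) < n := fun i =>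
    List.mem_range.1 (hl.mem_iff.1 (List.getElem_mem _))
  have hinj : Function.Injective fun i : Fin n => (⟨l[(i : ℕ)]'(by omega), hlt i⟩ : Fin n) := by
    intro i j hij
    exact Fin.ext (hnd.getElem_inj_iff.1 (Fin.mk.inj_iff.1 hij))
  refine ⟨Equiv.ofBijective _ (Finite.injective_iff_bijective.1 hinj), ?_⟩
  refine List.ext_getElem (by rw [length_natWord, hlen]) fun i h1 h2 => ?_
  simp [natWord, word]

theorem isBlockSum_natWord_iff {d : Bool} {N : ℕ} (σ : Equiv.Perm (Fin n)) :
    IsBlockSum d N (natWord σ) ↔ IsBlockSum d N (word σ) := by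
  constructor
  · intro h
    rcases Nat.eq_zero_or_pos n with rfl | hn
    · have h1 : natWord σ = [] := List.eq_nil_of_length_eq_zero (length_natWord σ)
      have h2 : word σ = [] := by
        unfold natWord at h1
        exact List.map_eq_nil_iff.1 h1
      have := h.le_length
      rw [h1, List.length_nil] at this
      rw [h2, Nat.le_zero.1 this]
      exact .nil d
    · have hmap : (natWord σ).map (fun x => if h : x < n then (⟨x, h⟩ : Fin n) else ⟨0, hn⟩) =
          word σ := by
        unfold natWord
        rw [List.map_map]
        refine (List.map_congr_left fun x _ => ?_).trans (List.map_id _)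
        simp
      rw [← hmap]
      refine h.map_of_lt fun x hx y hy hxy => ?_
      have hx' := List.mem_range.1 ((natWord_perm σ).mem_iff.1 hx)
      have hy' := List.mem_range.1 ((natWord_perm σ).mem_iff.1 hy)
      rw [dif_pos hx', dif_pos hy']
      exact hxy
  · intro h
    exact h.map_of_lt fun x _ y _ hxy => hxy

/-- A single block is a sum of several blocks in the other direction. -/
theorem exists_two_le_isBlockSum {l : List ℕ} {d : Bool} {N : ℕ} (h : IsBlockSum d N l)
    (hl : 2 ≤ l.length) : ∃ d K, 2 ≤ K ∧ IsBlockSum d K l := by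
  rcases Nat.lt_or_ge N 2 with hN | hN
  · have hN1 : N = 1 := by
      rcases Nat.eq_zero_or_pos N with h0 | h0
      · subst h0
        rw [h.eq_nil_of_zero] at hl
        simp at hl
      · omega
    subst hN1
    obtain ⟨u, v, hu, -, hv, rfl⟩ := h.exists_of_succ
    rw [hv.eq_nil_of_zero, List.append_nil] at hl ⊢
    rcases hu with ⟨x, rfl⟩ | ⟨K, -, h3, hs⟩
    · simp at hl
    · exact ⟨_, K, by omega, hs⟩
  · exact ⟨d, N, hN, h⟩

theorem isIteratedSnake_iff_mem_properSums (M : Meander n) (hn : 2 ≤ n) :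
    M.IsIteratedSnake ↔ natWord M.perm ∈ properSums true n ∨
      n % 2 = 1 ∧ natWord M.perm ∈ properSums false n := by
  have hlen := length_natWord M.perm
  simp only [isIteratedSnake_iff, mem_properSums, natWord_perm, true_and,
    ← isBlockSum_natWord_iff]
  constructor
  · rintro ⟨d, N, h⟩
    obtain ⟨d, K, hK, hs⟩ := exists_two_le_isBlockSum h (by omega)
    cases d
    · right
      refine ⟨?_, K, hK, hs⟩
      by_contra hodd
      have h1 := entry_zero_le_of_even M hn (by omega)
      have h2 := (isBlockSum_labels ((isBlockSum_natWord_iff _).1 hs)).dirLT_entry hK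
      rw [length_labels_word] at h2
      exact absurd h1 (not_le.2 h2)
    · exact Or.inl ⟨K, hK, hs⟩
  · rintro (⟨N, -, h⟩ | ⟨-, N, -, h⟩) <;> exact ⟨_, N, h⟩

/-- Every sum of at least two blocks is the word of a meander, except that skew sums must have odd
length. -/
theorem exists_meander_of_mem_properSums (hn : 2 ≤ n) {l : List ℕ}
    (h : l ∈ properSums true n ∨ n % 2 = 1 ∧ l ∈ properSums false n) :
    ∃ M : Meander n, natWord M.perm = l := by
  have hl : l.Perm (List.range n) := by
    rcases h with h | ⟨-, h⟩ <;> exact (mem_properSums.1 h).1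
  obtain ⟨σ, rfl⟩ := exists_natWord_eq hl
  have key : ∀ {d N}, 2 ≤ N → IsBlockSum d N (natWord σ) → (n % 2 = 0 → d = true) →
      ∃ M : Meander n, natWord M.perm = natWord σ := by
    intro d N hN hs hd
    have hs' := isBlockSum_labels ((isBlockSum_natWord_iff _).1 hs)
    refine ⟨⟨σ, noncrossing_of_isArcSystem hn hs'.isArcSystem fun he => ?_⟩, rfl⟩
    have h2 := hs'.dirLT_entry hN
    rw [length_labels_word, hd he] at h2
    exact le_of_lt h2
  rcases h with h | ⟨ho, h⟩
  · obtain ⟨-, N, hN, hs⟩ := mem_properSums.1 h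
    exact key hN hs fun _ => rfl
  · obtain ⟨-, N, hN, hs⟩ := mem_properSums.1 h
    exact key hN hs fun he => by omega

end Meander

open Meander in
theorem numIteratedSnakes_eq {n : ℕ} (hn : 2 ≤ n) :
    numIteratedSnakes n = (1 + n % 2) * (properSums true n).card := by
  classical
  set F : Finset (List ℕ) :=
    properSums true n ∪ if n % 2 = 1 then properSums false n else ∅ with hF
  have hmem : ∀ l, l ∈ F ↔ l ∈ properSums true n ∨ n % 2 = 1 ∧ l ∈ properSums false n := by
    intro l
    rw [hF, Finset.mem_union]
    split_ifs with h <;> simp [h]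
  have h1 : numIteratedSnakes n = F.card := by
    unfold numIteratedSnakes
    rw [← Nat.card_eq_finsetCard]
    refine Nat.card_congr (Equiv.ofBijective (fun M => ⟨natWord M.1.perm,
      (hmem _).2 ((isIteratedSnake_iff_mem_properSums M.1 hn).1 M.2)⟩) ⟨?_, ?_⟩)
    · rintro ⟨⟨σ, h⟩, hM⟩ ⟨⟨τ, h'⟩, hM'⟩ he
      obtain rfl : σ = τ := natWord_injective (Subtype.mk.inj he)
      rfl
    · rintro ⟨l, hl⟩
      obtain ⟨M, rfl⟩ := exists_meander_of_mem_properSums hn ((hmem l).1 hl)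
      exact ⟨⟨M, (isIteratedSnake_iff_mem_properSums M hn).2 ((hmem _).1 hl)⟩, rfl⟩
  rw [h1, hF]
  rcases Nat.mod_two_eq_zero_or_one n with h | h
  · simp [h]
  · rw [if_pos h, h, Finset.card_union_of_disjoint]
    · have := card_properSums_not true n
      rw [Bool.not_true] at this
      omega
    · refine Finset.disjoint_left.2 fun l hl hl' => ?_
      obtain ⟨-, N, hN, hs⟩ := mem_properSums.1 hl
      obtain ⟨-, K, hK, hs'⟩ := mem_properSums.1 hl'
      exact hs.not_isBlockSum_not hs' hN hK

/-! ### Generating functions -/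

open PowerSeries in
/-- The recursion of `c N m` is that of the coefficient of `X ^ m` in the `N`-th power of a power
series. Up to degree `n` it involves only the coefficients of degree at most `n`. -/
theorem coeff_pow_of_recursion {g : ℕ → ℚ} {c : ℕ → ℕ → ℚ} {n : ℕ} {T : ℚ⟦X⟧}
    (hT : ∀ b ≤ n, coeff b T = g b) (h0 : ∀ m, c 0 m = if m = 0 then 1 else 0)
    (hc : ∀ N m, c (N + 1) m =
      ∑ p ∈ Finset.HasAntidiagonal.antidiagonal m, g p.1 * c N p.2) (N : ℕ) :
    ∀ m ≤ n, coeff m (T ^ N) = c N m := by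
  induction N with
  | zero =>
    intro m _
    rw [pow_zero, coeff_one, h0]
  | succ N ih =>
    intro m hm
    rw [pow_succ', coeff_mul, hc]
    refine Finset.sum_congr rfl fun p hp => ?_
    have := Finset.HasAntidiagonal.mem_antidiagonal.1 hp
    rw [hT _ (by omega), ih _ (by omega)]

open PowerSeries in
theorem coeff_pow_sum_odd (h : ℕ → ℚ) (s : Finset ℕ) (N k : ℕ) :
    coeff (2 * k + N) ((∑ i ∈ s, C (h i) * X ^ (2 * i + 1) : ℚ⟦X⟧) ^ N) =
      ∑ κ ∈ s.piAntidiag N with ∑ i ∈ s, κ i * i = k,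
        (Nat.multinomial s κ : ℚ) * ∏ i ∈ s, h i ^ κ i := by
  rw [Finset.sum_pow_eq_sum_piAntidiag, map_sum, Finset.sum_filter]
  refine Finset.sum_congr rfl fun κ hκ => ?_
  rw [Finset.mem_piAntidiag] at hκ
  have h1 : (∏ i ∈ s, (C (h i) * X ^ (2 * i + 1) : ℚ⟦X⟧) ^ κ i) =
      C (∏ i ∈ s, h i ^ κ i) * X ^ (2 * (∑ i ∈ s, κ i * i) + N) := by
    rw [map_prod, ← hκ.1, Finset.mul_sum, ← Finset.sum_add_distrib, ← Finset.prod_pow_eq_pow_sum,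
      ← Finset.prod_mul_distrib]
    refine Finset.prod_congr rfl fun i _ => ?_
    rw [mul_pow, map_pow, ← pow_mul]
    congr 2
    ring
  rw [h1, ← nsmul_eq_mul, map_nsmul, coeff_C_mul, coeff_X_pow, nsmul_eq_mul]
  by_cases he : ∑ i ∈ s, κ i * i = k
  · rw [if_pos he, if_pos (by omega), mul_one]
  · rw [if_neg he, if_neg (by omega), mul_zero, mul_zero]

theorem count_sum_smul_singleton (s : Finset ℕ) (κ : ℕ → ℕ) (j : ℕ) :
    (∑ i ∈ s, κ i • ({i} : Multiset ℕ)).count j = if j ∈ s then κ j else 0 := by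
  rw [Multiset.count_sum']
  simp only [Multiset.count_nsmul, Multiset.count_singleton]
  simp

theorem sum_count_mul {s : Finset ℕ} {m : Multiset ℕ} (h : m.toFinset ⊆ s) :
    ∑ i ∈ s, m.count i * i = m.sum := by
  rw [Finset.sum_multiset_count]
  symm
  refine Finset.sum_subset h fun i _ hi => ?_
  rw [Multiset.count_eq_zero_of_notMem fun h => hi (Multiset.mem_toFinset.2 h), zero_smul]

/-- The exponents of the nonconstant terms in a product of `N` terms form a partition. -/
theorem sum_multinomial_eq_sum_partition {h : ℕ → ℚ} (h0 : h 0 = 1) {N k n : ℕ} (hkn : k ≤ n) :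
    ∑ κ ∈ (Finset.range (n + 1)).piAntidiag N with ∑ i ∈ Finset.range (n + 1), κ i * i = k,
        (Nat.multinomial (Finset.range (n + 1)) κ : ℚ) *
          ∏ i ∈ Finset.range (n + 1), h i ^ κ i =
      ∑ μ : Nat.Partition k, partitionBinom N μ *
        ∏ i ∈ μ.parts.toFinset, h i ^ μ.parts.count i := by
  classical
  have hsub : ∀ μ : Nat.Partition k, μ.parts.toFinset ⊆ (Finset.range (n + 1)).erase 0 := by
    intro μ i hi
    rw [Multiset.mem_toFinset] at hi
    have h1 := μ.parts_pos hi
    have h2 := Multiset.single_le_sum (fun x _ => Nat.zero_le x) i hi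
    rw [μ.parts_sum] at h2
    rw [Finset.mem_erase, Finset.mem_range]
    omega
  have hz : 0 ∈ Finset.range (n + 1) := by simp
  rw [← Finset.sum_filter_add_sum_filter_not Finset.univ
    (fun μ : Nat.Partition k => μ.parts.card ≤ N)]
  rw [Finset.sum_eq_zero (s := Finset.univ.filter fun μ : Nat.Partition k => ¬ μ.parts.card ≤ N),
    add_zero]
  swap
  · intro μ hμ
    rw [Finset.mem_filter] at hμ
    unfold partitionBinom
    rw [if_neg hμ.2, zero_mul]
  symm
  have hcnt : ∀ μ : Nat.Partition k,
      ∑ i ∈ (Finset.range (n + 1)).erase 0, μ.parts.count i = μ.parts.card := fun μ =>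
    Multiset.sum_count_eq_card fun a ha => hsub μ (Multiset.mem_toFinset.2 ha)
  refine Finset.sum_bij
    (fun μ _ i => if i = 0 then N - μ.parts.card else μ.parts.count i) ?_ ?_ ?_ ?_
  · intro μ hμ
    rw [Finset.mem_filter] at hμ
    rw [Finset.mem_filter, Finset.mem_piAntidiag]
    refine ⟨⟨?_, ?_⟩, ?_⟩
    · rw [← Finset.add_sum_erase _ _ hz, if_pos rfl, Finset.sum_congr rfl (g := μ.parts.count),
        hcnt]
      · have := hμ.2
        omega
      · intro i hi
        rw [if_neg (Finset.ne_of_mem_erase hi)]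
    · intro i hi
      by_cases h0 : i = 0
      · subst h0
        exact hz
      · rw [if_neg h0] at hi
        exact Finset.mem_of_mem_erase (hsub μ (Multiset.mem_toFinset.2
          (Multiset.count_ne_zero.1 hi)))
    · rw [← Finset.add_sum_erase _ _ hz, mul_zero, zero_add,
        Finset.sum_congr rfl (g := fun i => μ.parts.count i * i), sum_count_mul (hsub μ),
        μ.parts_sum]
      intro i hi
      dsimp only
      rw [if_neg (Finset.ne_of_mem_erase hi)]
  · intro μ _ ν _ he
    refine Nat.Partition.ext (Multiset.ext.2 fun i => ?_)
    by_cases h0 : i = 0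
    · subst h0
      rw [Multiset.count_eq_zero_of_notMem fun h => lt_irrefl _ (μ.parts_pos h),
        Multiset.count_eq_zero_of_notMem fun h => lt_irrefl _ (ν.parts_pos h)]
    · have := congrFun he i
      simpa [h0] using this
  · intro κ hκ
    rw [Finset.mem_filter, Finset.mem_piAntidiag] at hκ
    obtain ⟨⟨hN, hs⟩, hk⟩ := hκ
    set m : Multiset ℕ := ∑ i ∈ (Finset.range (n + 1)).erase 0, κ i • ({i} : Multiset ℕ) with hm
    have hcount : ∀ j, m.count j = if j ∈ (Finset.range (n + 1)).erase 0 then κ j else 0 :=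
      fun j => count_sum_smul_singleton _ κ j
    have hmsub : ∀ a ∈ m, a ∈ (Finset.range (n + 1)).erase 0 := by
      intro a ha
      by_contra hc
      have := hcount a
      rw [if_neg hc] at this
      exact Multiset.count_ne_zero.2 ha this
    have hsum : m.sum = k := by
      rw [← sum_count_mul fun a ha => hmsub a (Multiset.mem_toFinset.1 ha), ← hk,
        ← Finset.add_sum_erase (Finset.range (n + 1)) _ hz, mul_zero, zero_add]
      refine Finset.sum_congr rfl fun i hi => ?_
      rw [hcount, if_pos hi]
    have hcard : κ 0 + m.card = N := by
      rw [← hN, ← Finset.add_sum_erase _ _ hz, ← Multiset.sum_count_eq_card hmsub]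
      congr 1
      refine Finset.sum_congr rfl fun i hi => ?_
      rw [hcount, if_pos hi]
    refine ⟨⟨m, fun {i} hi => Nat.pos_of_ne_zero (Finset.ne_of_mem_erase (hmsub i hi)), hsum⟩,
      ?_, ?_⟩
    · rw [Finset.mem_filter]
      refine ⟨Finset.mem_univ _, ?_⟩
      dsimp only
      omega
    · funext i
      by_cases h0 : i = 0
      · subst h0
        rw [if_pos rfl]
        dsimp only
        omega
      · rw [if_neg h0]
        dsimp only
        rw [hcount]
        split_ifs with hi
        · rfl
        · by_contra hne
          exact hi (Finset.mem_erase.2 ⟨h0, hs i (Ne.symm hne)⟩)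
  · intro μ hμ
    rw [Finset.mem_filter] at hμ
    have hle := hμ.2
    set κ : ℕ → ℕ := fun i => if i = 0 then N - μ.parts.card else μ.parts.count i with hκ
    have hκ0 : κ 0 = N - μ.parts.card := if_pos rfl
    have hκi : ∀ i ∈ (Finset.range (n + 1)).erase 0, κ i = μ.parts.count i := fun i hi =>
      if_neg (Finset.ne_of_mem_erase hi)
    have hout : ∀ i ∈ (Finset.range (n + 1)).erase 0, i ∉ μ.parts.toFinset →
        μ.parts.count i = 0 := fun i _ hi =>
      Multiset.count_eq_zero_of_notMem fun h => hi (Multiset.mem_toFinset.2 h)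
    have hprod : ∏ i ∈ Finset.range (n + 1), h i ^ κ i =
        ∏ i ∈ μ.parts.toFinset, h i ^ μ.parts.count i := by
      rw [← Finset.mul_prod_erase _ _ hz, h0, one_pow, one_mul,
        Finset.prod_congr rfl fun i hi => by rw [hκi i hi]]
      symm
      refine Finset.prod_subset (hsub μ) fun i hi hi' => ?_
      rw [hout i hi hi', pow_zero]
    have hfact : ∏ i ∈ Finset.range (n + 1), (κ i).factorial =
        (∏ i ∈ μ.parts.toFinset, (μ.parts.count i).factorial) *
          (N - μ.parts.card).factorial := by
      rw [← Finset.mul_prod_erase _ _ hz, hκ0, mul_comm,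
        Finset.prod_congr rfl fun i hi => by rw [hκi i hi]]
      congr 1
      symm
      refine Finset.prod_subset (hsub μ) fun i hi hi' => ?_
      rw [hout i hi hi', Nat.factorial_zero]
    have hsumκ : ∑ i ∈ Finset.range (n + 1), κ i = N := by
      rw [← Finset.add_sum_erase _ _ hz, hκ0, Finset.sum_congr rfl hκi, hcnt]
      omega
    have hspec := Nat.multinomial_spec (Finset.range (n + 1)) κ
    rw [hfact, hsumκ] at hspec
    rw [hprod]
    congr 1
    unfold partitionBinom
    rw [if_pos hle, div_eq_iff, ← hspec]
    · push_cast
      ring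
    · have h1 : (∏ i ∈ μ.parts.toFinset, ((μ.parts.count i).factorial : ℚ)) ≠ 0 :=
        Finset.prod_ne_zero_iff.2 fun i _ => by exact_mod_cast Nat.factorial_ne_zero _
      have h2 : ((N - μ.parts.card).factorial : ℚ) ≠ 0 := by
        exact_mod_cast Nat.factorial_ne_zero _
      exact mul_ne_zero h1 h2

theorem card_blocks_eq {i : ℕ} (hi : i ≠ 0) :
    ((blocks (2 * i + 1)).card : ℚ) = (numIteratedSnakes (2 * i + 1) : ℚ) / 2 := by
  rw [card_blocks_of_odd (by omega) (by omega), numIteratedSnakes_eq (by omega),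
    show (2 * i + 1) % 2 = 1 by omega]
  push_cast
  ring

theorem card_blockSums_eq (N k : ℕ) :
    ((blockSums true N (2 * k + N)).card : ℚ) =
      ∑ μ : Nat.Partition k, partitionBinom N μ * ∏ i ∈ μ.parts.toFinset,
        ((numIteratedSnakes (2 * i + 1) : ℚ) / 2) ^ μ.parts.count i := by
  set n := 2 * k + N with hn
  set h : ℕ → ℚ := fun i => ((blocks (2 * i + 1)).card : ℚ) with hh
  have h0 : h 0 = 1 := by
    rw [hh]
    dsimp only
    rw [Nat.mul_zero, Nat.zero_add, card_blocks_one, Nat.cast_one]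
  have hT : ∀ b ≤ n, PowerSeries.coeff b
      (∑ i ∈ Finset.range (n + 1), PowerSeries.C (h i) * PowerSeries.X ^ (2 * i + 1) :
        PowerSeries ℚ) = ((blocks b).card : ℚ) := by
    intro b hb
    rw [map_sum]
    simp_rw [PowerSeries.coeff_C_mul, PowerSeries.coeff_X_pow]
    rcases Nat.even_or_odd' b with ⟨j, rfl | rfl⟩
    · rw [card_blocks_of_even (by omega), Nat.cast_zero]
      refine Finset.sum_eq_zero fun i _ => ?_
      rw [if_neg (by omega), mul_zero]
    · rw [Finset.sum_eq_single j]
      · rw [if_pos rfl, mul_one]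
      · intro i _ hij
        rw [if_neg (by omega), mul_zero]
      · intro hj
        rw [Finset.mem_range] at hj
        omega
  have key := coeff_pow_of_recursion (g := fun b => ((blocks b).card : ℚ))
    (c := fun N m => ((blockSums true N m).card : ℚ)) hT
    (fun m => by
      rw [card_blockSums_zero]
      split_ifs <;> simp)
    (fun N m => by
      rw [card_blockSums_succ]
      push_cast
      rfl) N n le_rfl
  rw [← key, coeff_pow_sum_odd, sum_multinomial_eq_sum_partition h0 (by omega)]
  refine Finset.sum_congr rfl fun μ _ => ?_
  congr 1
  refine Finset.prod_congr rfl fun i hi => ?_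
  rw [hh]
  dsimp only
  rw [card_blocks_eq (μ.parts_pos (Multiset.mem_toFinset.1 hi)).ne']

theorem mainTheorem6 (n : ℕ) (hn : 2 ≤ n) :
    (numIteratedSnakes n : ℚ) =
      (1 + ((n % 2 : ℕ) : ℚ)) *
        ∑ r ∈ Finset.Icc 1 (n / 2),
          ∑ μ : Nat.Partition ((n - 2 * r - n % 2) / 2),
            partitionBinom (2 * r + n % 2) μ *
              ∏ i ∈ μ.parts.toFinset,
                ((numIteratedSnakes (2 * i + 1) : ℚ) / 2) ^ (μ.parts.count i) := by
  rw [numIteratedSnakes_eq hn, card_properSums]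
  push_cast
  congr 1
  refine Finset.sum_congr rfl fun r hr => ?_
  rw [Finset.mem_Icc] at hr
  rw [← card_blockSums_eq]
  congr 3
  omega
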